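/- Let $\widehat{\mathbf n}=\{n_k\}_{k\ge 1}$ be a sequence of integers with $n_k>1$ for all $k$, and put $N_k=n_1n_2\cdots n_k$. For $k\le j$ identify $\{0,\dots,N_k-1\}\times\{0,\dots,N_j/N_k-1\}$ with $\{0,\dots,N_j-1\}$ by $(x_1,x_2)\mapsto x_1+N_kx_2$, and embed the symmetric group $\mathfrak S_{N_k}$ into $\mathfrak S_{N_j}$ by $\mathfrak i_{k,j}(\sigma)(x_1,x_2)=(\sigma(x_1),x_2)$. Let $\mathfrak S_{\widehat{\mathbf n}}=\varinjlim\mathfrak S_{N_k}$ be the inductive limit along these embeddings. For $\sigma\in\mathfrak S_{N_k}\subset\mathfrak S_{\widehat{\mathbf n}}$ put $$\chi_{\rm nat}(\sigma)=1-\frac{\#\{x:\sigma(x)\ne x\}}{N_k},\qquad \operatorname{sgn}_\infty(\sigma)=\lim_{j\to\infty}\operatorname{sgn}_{N_j}(\mathfrak i_{k,j}(\sigma));$$ both are well defined on $\mathfrak S_{\widehat{\mathbf n}}$. Put $\chi_{\rm nat}^p(\sigma)=\chi_{\rm nat}(\sigma)^p$ for $p\in\{0,1,2,\dots\}$ (with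 $0^0=1$), let $\chi_{\rm nat}^\infty$ be the indicator function of the identity element (the regular character), and $$\mathrm{ExChar}=\{\chi_{\rm nat}^p: p=0,1,2,\dots\}\cup\{\operatorname{sgn}_\infty\cdot\chi_{\rm nat}^p: p=0,1,2,\dots\}\cup\{\chi_{\rm nat}^\infty\}.$$ A character of a group $G$ is a positive definite function $\chi:G\to\mathbb C$ with $\chi(gh)=\chi(hg)$ for all $g,h\in G$ and $\chi(1)=1$. A character $\chi$ is called indecomposable if its GNS representation, that is, the unitary representation $\pi$ of $G$ (unique up to unitary equivalence) on a Hilbert space with a cyclic vector $\xi$ such that $\chi(g)=\langle\pi(g)\xi,\xi\rangle$ for all $g\in G$, is a factor representation, i.e. the von Neumann algebra generated by $\pi(G)$ has trivial center. Then: 1. every function in $\mathrm{ExChar}$ is a character of $\mathfrak S_{\widehat{\mathbf n}}$; 2. every function in $\mathrm{ExChar}$ is indecomposable; 3. every indecomposable character of $\mathfrak S_{\widehat{\mathbf n}}$ belongs to $\mathrm{ExChar}$. Consequently $\mathrm{ExChar}$ is exactly the set of indecomposable characters, and it is also exactly the set of extreme points of the convex set of all characters of $\mathfrak S_{\widehat{\mathbf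 n}}$. -/

import Mathlib

open scoped ComplexOrder
open Filter Topology

namespace SymLimit

/-! ### The inductive limit of symmetric groups -/

/-- `N n k = n 0 * n 1 * ⋯ * n k`, the size of the set permuted at stage `k`
(the sequence and the stages are indexed from `0`). -/
def N (n : ℕ → ℕ) (k : ℕ) : ℕ := ∏ i ∈ Finset.range (k + 1), n i

theorem N_dvd (n : ℕ → ℕ) {k j : ℕ} (h : k ≤ j) : N n k ∣ N n j :=
  Finset.prod_dvd_prod_of_subset _ _ _ (Finset.range_subset_range.2 (by omega))

theorem N_pos {n : ℕ → ℕ} (hn : ∀ k, 1 < n k) (k : ℕ) : 0 < N n k :=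
  Finset.prod_pos fun i _ => lt_trans one_pos (hn i)

/-- The identification of `X_{N_k} × X_{N_j / N_k}` with `X_{N_j}`,
`(x₁, x₂) ↦ x₁ + N_k * x₂`, for `k ≤ j`. -/
def stageEquiv (n : ℕ → ℕ) {k j : ℕ} (h : k ≤ j) :
    Fin (N n k) × Fin (N n j / N n k) ≃ Fin (N n j) :=
  (Equiv.prodComm _ _).trans
    (finProdFinEquiv.trans (finCongr (Nat.div_mul_cancel (N_dvd n h))))

theorem stageEquiv_val (n : ℕ → ℕ) {k j : ℕ} (h : k ≤ j)
    (x : Fin (N n k) × Fin (N n j / N n k)) :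
    (stageEquiv n h x : ℕ) = x.1 + N n k * x.2 := rfl

/-- The diagonal embedding of the symmetric group of stage `k` into that of stage `j`:
`(x₁, x₂) ↦ (σ x₁, x₂)`. -/
def embed (n : ℕ → ℕ) (k j : ℕ) (h : k ≤ j) :
    Equiv.Perm (Fin (N n k)) →* Equiv.Perm (Fin (N n j)) where
  toFun σ := (stageEquiv n h).permCongr (Equiv.prodCongr σ (Equiv.refl _))
  map_one' := by ext x; simp [Equiv.permCongr_apply]
  map_mul' σ τ := by ext x; simp [Equiv.permCongr_apply, Prod.map_map]

theorem embed_stageEquiv (n : ℕ → ℕ) {k j : ℕ} (h : k ≤ j) (σ : Equiv.Perm (Fin (N n k)))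
    (x₁ : Fin (N n k)) (x₂ : Fin (N n j / N n k)) :
    embed n k j h σ (stageEquiv n h (x₁, x₂)) = stageEquiv n h (σ x₁, x₂) := by
  simp [embed, Equiv.permCongr_apply]

theorem embed_val (n : ℕ → ℕ) {k j : ℕ} (h : k ≤ j) (σ : Equiv.Perm (Fin (N n k)))
    (a : Fin (N n k)) (x : Fin (N n j)) (q : ℕ) (hx : (x : ℕ) = a + N n k * q) :
    (embed n k j h σ x : ℕ) = σ a + N n k * q := by
  obtain ⟨⟨y₁, y₂⟩, rfl⟩ := (stageEquiv n h).surjective x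
  rw [stageEquiv_val] at hx
  have hpos : 0 < N n k := a.pos
  have h1 : y₁ = a := by
    apply Fin.ext
    have := congrArg (· % N n k) hx
    simpa [Nat.add_mul_mod_self_left, Nat.mod_eq_of_lt] using this
  subst h1
  have h2 : (y₂ : ℕ) = q := Nat.eq_of_mul_eq_mul_left hpos (by simpa using hx)
  rw [embed_stageEquiv, stageEquiv_val, h2]

instance directedSystem (n : ℕ → ℕ) :
    DirectedSystem (fun k => Equiv.Perm (Fin (N n k))) (fun k j h => embed n k j h) where
  map_self k σ := by
    ext x
    rw [embed_val n le_rfl σ x x 0 (by simp)]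
    simp
  map_map l j k hkj hjl σ := by
    ext x
    obtain ⟨⟨y, q⟩, rfl⟩ := (stageEquiv n hjl).surjective x
    obtain ⟨⟨a, r⟩, rfl⟩ := (stageEquiv n hkj).surjective y
    obtain ⟨c, hc⟩ := N_dvd n hkj
    rw [embed_stageEquiv, embed_stageEquiv, stageEquiv_val,
      embed_val n (hkj.trans hjl) σ a _ (r + c * q)]
    · simp only [stageEquiv_val, hc]; ring
    · simp only [stageEquiv_val, hc]; ring

/-- The inductive limit `S_n̂` of the symmetric groups on `N n k` points along the
diagonal embeddings. -/
abbrev LimitGroup (n : ℕ → ℕ) : Type :=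
  DirectLimit (fun k => Equiv.Perm (Fin (N n k))) (embed n)

/-! ### The functions `sgn_∞` and `χ_nat` -/

theorem sign_embed (n : ℕ → ℕ) {k j : ℕ} (h : k ≤ j) (σ : Equiv.Perm (Fin (N n k))) :
    Equiv.Perm.sign (embed n k j h σ) = Equiv.Perm.sign σ ^ (N n j / N n k) := by
  have : (Equiv.prodCongr σ (Equiv.refl (Fin (N n j / N n k)))) =
      Equiv.prodCongrLeft (fun _ => σ) := by ext x <;> rfl
  change Equiv.Perm.sign ((stageEquiv n h).permCongr _) = _
  rw [Equiv.Perm.sign_permCongr, this, Equiv.Perm.sign_prodCongrLeft]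
  simp

/-- The sign at stage `j` of an element represented by `σ` at stage `k`
(with the irrelevant value `1` for `j < k`). -/
noncomputable def signAt (n : ℕ → ℕ) (k : ℕ) (σ : Equiv.Perm (Fin (N n k))) (j : ℕ) : ℂ :=
  if h : k ≤ j then ((Equiv.Perm.sign (embed n k j h σ) : ℤ) : ℂ) else 1

theorem signAt_embed (n : ℕ → ℕ) {k l : ℕ} (h : k ≤ l) (σ : Equiv.Perm (Fin (N n k))) :
    signAt n k σ =ᶠ[atTop] signAt n l (embed n k l h σ) := by
  filter_upwards [eventually_ge_atTop l] with j hj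
  rw [signAt, signAt, dif_pos (h.trans hj), dif_pos hj,
    DirectedSystem.map_map' (embed n) h hj σ]

/-- `sgn_∞(s)` is the limit of the signs of `s` at the stages `j → ∞`. -/
noncomputable def sgnInf (n : ℕ → ℕ) : LimitGroup n → ℂ :=
  DirectLimit.lift (embed n) (fun k σ => limUnder atTop (signAt n k σ))
    (fun _ _ h σ => congrArg lim (Filter.map_congr (signAt_embed n h σ)))

/-- The limit that defines `sgn_∞` exists. -/
theorem tendsto_signAt (n : ℕ → ℕ) (k : ℕ) (σ : Equiv.Perm (Fin (N n k))) :
    Tendsto (signAt n k σ) atTop (𝓝 (sgnInf n ⟦⟨k, σ⟩⟧)) := by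
  refine tendsto_nhds_limUnder ?_
  have key : ∀ l (hl : k ≤ l), Equiv.Perm.sign (embed n k l hl σ) = 1 →
      Tendsto (signAt n k σ) atTop (𝓝 1) := fun l hl h1 => by
    refine tendsto_const_nhds.congr' ?_
    filter_upwards [eventually_ge_atTop l] with j hj
    rw [signAt, dif_pos (hl.trans hj), ← DirectedSystem.map_map' (embed n) hl hj σ,
      sign_embed, h1]
    simp
  by_cases hex : ∃ l, ∃ hl : k ≤ l, Equiv.Perm.sign (embed n k l hl σ) = 1
  · obtain ⟨l, hl, h1⟩ := hex
    exact ⟨1, key l hl h1⟩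
  · push Not at hex
    refine ⟨-1, tendsto_const_nhds.congr' ?_⟩
    filter_upwards [eventually_ge_atTop k] with j hj
    rw [signAt, dif_pos hj, (Int.units_eq_one_or _).resolve_left (hex j hj)]
    simp

theorem card_support_embed (n : ℕ → ℕ) {k j : ℕ} (h : k ≤ j) (σ : Equiv.Perm (Fin (N n k))) :
    (embed n k j h σ).support.card = σ.support.card * (N n j / N n k) := by
  have : (embed n k j h σ).support =
      (σ.support ×ˢ (Finset.univ : Finset (Fin (N n j / N n k)))).map
        (stageEquiv n h).toEmbedding := by
    ext x
    obtain ⟨⟨a, b⟩, rfl⟩ := (stageEquiv n h).surjective x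
    simp [embed_stageEquiv]
  rw [this, Finset.card_map, Finset.card_product]
  simp

/-- The natural character: `χ_nat(σ) = 1 - #supp σ / N_k` for `σ` at stage `k`. -/
noncomputable def chiNat (n : ℕ → ℕ) (hn : ∀ k, 1 < n k) : LimitGroup n → ℂ :=
  DirectLimit.lift (embed n) (fun k σ => 1 - (σ.support.card : ℂ) / (N n k : ℂ)) (by
    intro k j h σ
    have hk : (N n k : ℂ) ≠ 0 := by exact_mod_cast (N_pos hn k).ne'
    have hj : (N n j : ℂ) ≠ 0 := by exact_mod_cast (N_pos hn j).ne'
    rw [card_support_embed, Nat.cast_mul, Nat.cast_div (N_dvd n h) hk]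
    field_simp)

open Classical in
/-- The regular character `χ_nat^∞`, the indicator function of the identity. -/
noncomputable def chiReg (n : ℕ → ℕ) : LimitGroup n → ℂ := fun s => if s = 1 then 1 else 0

/-- The set of the functions `χ_nat ^ p` and `sgn_∞ · χ_nat ^ p` for `p = 0, 1, 2, …`, together
with the regular character. -/
def exChar (n : ℕ → ℕ) (hn : ∀ k, 1 < n k) : Set (LimitGroup n → ℂ) :=
  {χ | ∃ p : ℕ, χ = fun s => chiNat n hn s ^ p} ∪
  {χ | ∃ p : ℕ, χ = fun s => sgnInf n s * chiNat n hn s ^ p} ∪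
  {chiReg n}

/-! ### Characters and indecomposable characters of a group -/

/-- A (normalized) character of a group: a positive definite central function with value `1`
at the identity. The order on `ℂ` is the one for which `0 ≤ z` means that `z` is real and
nonnegative. -/
structure IsCharacter {G : Type*} [Group G] (χ : G → ℂ) : Prop where
  posDef : ∀ (S : Finset G) (c : G → ℂ),
    0 ≤ ∑ g ∈ S, ∑ h ∈ S, starRingEnd ℂ (c g) * c h * χ (g⁻¹ * h)
  central : ∀ g h : G, χ (g * h) = χ (h * g)
  map_one : χ 1 = 1

section
variable {H : Type*} [NormedAddCommGroup H] [InnerProductSpace ℂ H] [CompleteSpace H]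

/-- The von Neumann algebra generated by a set of bounded operators: the double commutant of the
set and its adjoints. -/
noncomputable def generatedVN (S : Set (H →L[ℂ] H)) : VonNeumannAlgebra H where
  toStarSubalgebra := StarSubalgebra.centralizer ℂ
    (StarSubalgebra.centralizer ℂ S : Set (H →L[ℂ] H))
  centralizer_centralizer' := by
    have hstar : ∀ T : Set (H →L[ℂ] H), ∃ U : Set (H →L[ℂ] H),
        ((StarSubalgebra.centralizer ℂ T : StarSubalgebra ℂ (H →L[ℂ] H)) :
          Set (H →L[ℂ] H)) = Set.centralizer U := fun T => ⟨T ∪ star T, rfl⟩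
    obtain ⟨U, hU⟩ := hstar (StarSubalgebra.centralizer ℂ S : Set (H →L[ℂ] H))
    change Set.centralizer (Set.centralizer
      ((StarSubalgebra.centralizer ℂ (StarSubalgebra.centralizer ℂ S : Set (H →L[ℂ] H)) :
        StarSubalgebra ℂ (H →L[ℂ] H)) : Set (H →L[ℂ] H))) = _
    rw [hU, Set.centralizer_centralizer_centralizer]
    exact hU.symm

/-- A von Neumann algebra is a factor if its center consists of the scalar operators. -/
def IsFactor (M : VonNeumannAlgebra H) : Prop :=
  ∀ T : H →L[ℂ] H, T ∈ M → T ∈ M.commutant → ∃ c : ℂ, T = c • (1 : H →L[ℂ] H)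

/-- `(π, ξ)` is a GNS representation of the function `χ`, on the Hilbert space `H`: `π` is a
unitary representation, `ξ` is a cyclic vector, and `χ(g) = ⟨π(g) ξ, ξ⟩` (the inner product of
Mathlib is linear in its second argument). It is determined by `χ` up to unitary equivalence. -/
structure IsGNS {G : Type*} [Group G] (χ : G → ℂ) (π : G →* unitary (H →L[ℂ] H)) (ξ : H) :
    Prop where
  cyclic : Dense (Submodule.span ℂ (Set.range fun g => (π g : H →L[ℂ] H) ξ) : Set H)
  apply_eq : ∀ g, χ g = inner ℂ ξ ((π g : H →L[ℂ] H) ξ)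

end

/-- A character is indecomposable if its GNS representation is a factor representation, i.e.
generates a von Neumann algebra that is a factor. -/
def IsIndecomposable.{u} {G : Type u} [Group G] (χ : G → ℂ) : Prop :=
  IsCharacter χ ∧
    ∃ (H : Type u) (_ : NormedAddCommGroup H) (_ : InnerProductSpace ℂ H) (_ : CompleteSpace H)
      (π : G →* unitary (H →L[ℂ] H)) (ξ : H),
      IsGNS χ π ξ ∧ IsFactor (generatedVN (Set.range fun g => (π g : H →L[ℂ] H)))

end SymLimit

/-! Extremality and indecomposability are both trapped between two conditions on the function $\chi$
alone.

The sufficient condition is `HasScalarMeans`: in the GNS space, finite means of the vectors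
$\pi(tgt^{-1})\xi$ come arbitrarily close to $\chi(g)\xi$. A central operator $T$ pairs $T\xi$
equally with all these conjugates, so $T\xi$ is a multiple of $\xi$; and the squared distance of
such a mean to a fixed multiple of $\xi$ is affine in $\chi$, which gives extremality. The members
of `exChar` satisfy the condition because $g$ has arbitrarily many nearly independent conjugates,
obtained by letting it act on different coordinates of a deeper stage (`exists_mixing`). They are
positive definite because $\chi_{\rm nat}$ is a Gram kernel of permutation matrices and such a
kernel may be multiplied into any positive definite function.

The necessary condition is `IsAsympMul`: the mean of $\chi(tgt^{-1}x)$ over $t$ in stage $j$ tends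
to $\chi(g)\chi(x)$. It holds because averages over larger and larger stages become central in the
limit. It implies $\chi(gx)\approx\chi(g)\chi(x)$ when $x$ commutes with a large stage.

It remains to classify characters with `IsAsympMul`. The main tool (`exists_translations`) is a
family of commuting elements $C(v)$, with $v$ a function from the points of stage $k$ to a finite
group $F$ of exponent 2, permuted by stage $k$ through the points. If $v=w-w\circ\sigma^{-1}$, then
$C(v)\sigma$ is conjugate to $\sigma$, so averaging over such $v$ bounds $|\chi(\sigma)|$ by values
at involutions. Combined with asymptotic multiplicativity this shows that the supremum of $|\chi|$
off the identity is at most its own square: either $\chi$ is regular or the supremum is 1. In the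
second case small even involutions have values near 1, so on even involutions $\chi$ is a continuous
function of the proportion of moved points, multiplicative in the proportion of fixed points, that
is, $(1-\mathrm{moved})^p$ with $p$ real. Odd involutions follow the same law up to one global sign,
which `sgnInf` absorbs. A sharper use of the coboundary argument (`norm_sub_rpow_le`) carries the
formula to all elements, and positivity on elementary abelian 2-groups, read as a sign condition on
finite differences of $x^p$, makes $p$ an integer. -/

namespace SymLimit

/-! ### Hilbert spaces generated by invariant kernels -/

section Kernel

variable {X H : Type*} [NormedAddCommGroup H] [InnerProductSpace ℂ H]

theorem denseRange_linearCombination {e : X → H}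
    (he : Dense (Submodule.span ℂ (Set.range e) : Set H)) :
    DenseRange (Finsupp.linearCombination ℂ e) := by
  have := Finsupp.range_linearCombination (R := ℂ) (v := e)
  rw [DenseRange, ← LinearMap.coe_range, this]
  exact he

theorem continuousLinearMap_ext_of_dense_span {F : Type*} [NormedAddCommGroup F] [NormedSpace ℂ F]
    {e : X → H} (he : Dense (Submodule.span ℂ (Set.range e) : Set H)) {S T : H →L[ℂ] F}
    (h : ∀ x, S (e x) = T (e x)) : S = T :=
  ContinuousLinearMap.ext_on he (by rintro _ ⟨x, rfl⟩; exact h x)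

/-- A family of vectors with dense span whose Gram matrix is invariant under a group action
carries a unitary representation of the group. -/
theorem exists_unitary_of_invariant_gram [CompleteSpace H] {Γ : Type*} [Group Γ] [MulAction Γ X]
    {e : X → H}
    (he : Dense (Submodule.span ℂ (Set.range e) : Set H))
    (hinv : ∀ (γ : Γ) (x y : X), inner ℂ (e (γ • x)) (e (γ • y)) = inner ℂ (e x) (e y)) :
    ∃ U : Γ →* unitary (H →L[ℂ] H), ∀ γ x, (U γ : H →L[ℂ] H) (e x) = e (γ • x) := by
  set D := Finsupp.linearCombination ℂ e with hD
  have hdense : DenseRange D := denseRange_linearCombination he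
  have hnorm : ∀ (γ : Γ) (x : X →₀ ℂ),
      ‖D (Finsupp.domLCongr (R := ℂ) (M := ℂ) (MulAction.toPerm γ) x)‖ = ‖D x‖ := by
    intro γ x
    have h : inner ℂ (D (Finsupp.domLCongr (R := ℂ) (M := ℂ) (MulAction.toPerm γ) x))
        (D (Finsupp.domLCongr (R := ℂ) (M := ℂ) (MulAction.toPerm γ) x)) = inner ℂ (D x) (D x) := by
      have h1 : D (Finsupp.domLCongr (R := ℂ) (M := ℂ) (MulAction.toPerm γ) x)
          = x.sum fun y a => a • e (γ • y) := by
        rw [hD, Finsupp.linearCombination_apply, Finsupp.domLCongr_apply, Finsupp.domCongr_apply,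
          Finsupp.equivMapDomain_eq_mapDomain, Finsupp.sum_mapDomain_index] <;>
          simp [add_smul]
      rw [h1, hD, Finsupp.linearCombination_apply]
      simp only [Finsupp.sum, sum_inner, inner_sum, inner_smul_left, inner_smul_right, hinv]
    rw [inner_self_eq_norm_sq_to_K, inner_self_eq_norm_sq_to_K] at h
    have h2 : ‖D (Finsupp.domLCongr (R := ℂ) (M := ℂ) (MulAction.toPerm γ) x)‖ ^ 2 = ‖D x‖ ^ 2 := by
      exact_mod_cast h
    exact (sq_eq_sq₀ (norm_nonneg _) (norm_nonneg _)).1 h2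
  let V : Γ → (H ≃ₗᵢ[ℂ] H) := fun γ =>
    (Finsupp.domLCongr (R := ℂ) (M := ℂ) (MulAction.toPerm γ : X ≃ X)).extendOfIsometry D D hdense
      hdense (hnorm γ)
  have hV : ∀ γ x, V γ (e x) = e (γ • x) := by
    intro γ x
    have : e x = D (Finsupp.single x 1) := by simp [hD]
    rw [this]
    simp only [V]
    rw [LinearEquiv.extendOfIsometry_eq]
    simp [hD]
  have hext : ∀ A B : H ≃ₗᵢ[ℂ] H, (∀ x, A (e x) = B (e x)) → A = B := by
    intro A B h
    ext v
    have := continuousLinearMap_ext_of_dense_span he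
      (S := (A.toContinuousLinearEquiv : H →L[ℂ] H))
      (T := (B.toContinuousLinearEquiv : H →L[ℂ] H)) (by simpa using h)
    exact congrArg (fun T : H →L[ℂ] H => T v) this
  let V' : Γ →* (H ≃ₗᵢ[ℂ] H) :=
    { toFun := V
      map_one' := hext _ _ fun x => by simp [hV]
      map_mul' := fun a b => hext _ _ fun x => by
        change _ = V a (V b (e x))
        simp [hV, mul_smul] }
  refine ⟨(Unitary.linearIsometryEquiv (𝕜 := ℂ) (H := H)).symm.toMonoidHom.comp V', fun γ x => ?_⟩
  exact hV γ x

end Kernel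

/-! ### The GNS construction of a character -/

namespace IsCharacter

variable {G : Type*} [Group G] {χ : G → ℂ}

theorem posDef_finsupp (hχ : IsCharacter χ) (f : G →₀ ℂ) :
    0 ≤ f.sum fun g a => f.sum fun h b => starRingEnd ℂ a * b * χ (g⁻¹ * h) :=
  hχ.posDef f.support f

theorem map_inv (hχ : IsCharacter χ) (g : G) : χ g⁻¹ = starRingEnd ℂ (χ g) := by
  classical
  rcases eq_or_ne g 1 with rfl | hg
  · simp [hχ.map_one]
  -- Coefficients $(1,1)$ and $(1,i)$: reality of the two quadratic forms determines the imaginary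
  -- and the real part of $\chi(g^{-1})$.
  have h1 := hχ.posDef {1, g} (fun x => if x = 1 then 1 else 1)
  have h2 := hχ.posDef {1, g} (fun x => if x = 1 then 1 else Complex.I)
  rw [Finset.sum_pair hg.symm, Finset.sum_pair hg.symm, Finset.sum_pair hg.symm] at h1 h2
  simp only [hg, if_true, if_false, inv_one, one_mul, mul_one, _root_.map_one, inv_mul_cancel,
    hχ.map_one, Complex.conj_I] at h1 h2
  have e1 := (Complex.le_def.1 h1).2
  have e2 := (Complex.le_def.1 h2).2
  simp at e1 e2
  apply Complex.ext
  · simp; linarith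
  · simp; linarith

end IsCharacter

open RKHS in
/-- Every positive definite function is the Gram matrix of a family of vectors with dense span. -/
theorem exists_vectors_of_isCharacter.{u} {G : Type u} [Group G] {χ : G → ℂ}
    (hχ : IsCharacter χ) :
    ∃ (H : Type u) (_ : NormedAddCommGroup H) (_ : InnerProductSpace ℂ H) (_ : CompleteSpace H)
      (e : G → H), Dense (Submodule.span ℂ (Set.range e) : Set H) ∧
        ∀ g h, inner ℂ (e g) (e h) = χ (g⁻¹ * h) := by
  let K : Matrix G G (ℂ →L[ℂ] ℂ) := .of fun x y => χ (x⁻¹ * y) • (1 : ℂ →L[ℂ] ℂ)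
  have hK : K.PosSemidef := by
    have key : K.PosSemidef ↔ K.IsHermitian ∧ ∀ (f : G →₀ ℂ),
        0 ≤ RCLike.re (f.sum fun x w => f.sum fun x' w' => inner ℂ (K x' x w) w') :=
      (posSemidef_tfae (K := K)).out 0 2
    refine key.2 ⟨?_, fun f => ?_⟩
    · ext x y
      simp [K, Matrix.conjTranspose_apply]
      rw [← hχ.map_inv]
      simp
    · have h := hχ.posDef_finsupp f
      have h' := (Complex.le_def.1 h).1
      refine h'.trans_eq (congrArg Complex.re ?_)
      refine Finset.sum_congr rfl fun x _ => Finset.sum_congr rfl fun y _ => ?_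
      have : χ (y⁻¹ * x) = starRingEnd ℂ (χ (x⁻¹ * y)) := by rw [← hχ.map_inv]; simp
      simp [K, this]
      ring
  have : Fact K.PosSemidef := ⟨hK⟩
  refine ⟨OfKernel K, inferInstance, inferInstance, inferInstance,
    fun g => kerFun (OfKernel K) g 1, ?_, fun g h => ?_⟩
  · have h := kerFun_dense (OfKernel K)
    have h2 : Submodule.span ℂ {kerFun (OfKernel K) x v | (x) (v)} ≤
        Submodule.span ℂ (Set.range fun g => kerFun (OfKernel K) g (1 : ℂ)) := by
      rw [Submodule.span_le]
      rintro _ ⟨x, v, rfl⟩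
      have : kerFun (OfKernel K) x v = v • kerFun (OfKernel K) x (1 : ℂ) := by
        rw [← map_smul]; simp
      rw [this]
      exact Submodule.smul_mem _ _ (Submodule.subset_span ⟨x, rfl⟩)
    have h3 := Submodule.dense_iff_topologicalClosure_eq_top.2 h
    exact h3.mono h2
  · rw [kerFun_inner, kerFun_apply, OfKernel.kernel_ofKernel]
    simp [K]

/-- A GNS representation of a character together with the commuting right action. -/
structure BiGNS {G : Type*} [Group G] (χ : G → ℂ) {H : Type*} [NormedAddCommGroup H]
    [InnerProductSpace ℂ H] [CompleteSpace H] (π ρ : G →* unitary (H →L[ℂ] H)) (ξ : H) :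
    Prop extends IsGNS χ π ξ where
  right_apply : ∀ g h, (ρ g : H →L[ℂ] H) ((π h : H →L[ℂ] H) ξ) = (π (h * g⁻¹) : H →L[ℂ] H) ξ

/-- The Gram matrix $\chi(g^{-1}h)$ is invariant under left translation for any $\chi$, and under
right translation because $\chi$ is central; each invariance yields a unitary representation. -/
theorem IsCharacter.exists_biGNS.{u} {G : Type u} [Group G] {χ : G → ℂ} (hχ : IsCharacter χ) :
    ∃ (H : Type u) (_ : NormedAddCommGroup H) (_ : InnerProductSpace ℂ H) (_ : CompleteSpace H)
      (π ρ : G →* unitary (H →L[ℂ] H)) (ξ : H), BiGNS χ π ρ ξ := by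
  obtain ⟨H, i1, i2, i3, e, he, hin⟩ := exists_vectors_of_isCharacter hχ
  obtain ⟨π, hπ⟩ := exists_unitary_of_invariant_gram (Γ := G) he
    (fun γ x y => by simp [hin, mul_assoc])
  obtain ⟨ρ, hρ⟩ := exists_unitary_of_invariant_gram (Γ := Gᵐᵒᵖ) he
    (fun γ x y => by
      rw [hin, hin, MulOpposite.smul_eq_mul_unop, MulOpposite.smul_eq_mul_unop, mul_inv_rev,
        mul_assoc, hχ.central]
      simp [mul_assoc])
  refine ⟨H, i1, i2, i3, π, ρ.comp (MulEquiv.inv' G).toMonoidHom, e 1, ⟨⟨?_, ?_⟩, ?_⟩⟩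
  · simpa [hπ] using he
  · intro g; simp [hπ, hin]
  · intro g h
    change (ρ (MulOpposite.op g⁻¹) : H →L[ℂ] H) _ = _
    rw [hπ, hπ, hρ]
    simp

end SymLimit

namespace SymLimit

/-! ### A criterion for extremality and indecomposability -/

section Criterion

variable {G : Type*} [Group G] {χ : G → ℂ}

/-- The mean of `χ ((t i g (t i)⁻¹)⁻¹ (t l g (t l)⁻¹))` over a finite family `t`. -/
noncomputable def conjGram (χ : G → ℂ) (g : G) {ι : Type*} [Fintype ι] (t : ι → G) : ℂ :=
  (Fintype.card ι : ℂ)⁻¹ * (Fintype.card ι : ℂ)⁻¹ *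
    ∑ i, ∑ l, χ ((t i * g * (t i)⁻¹)⁻¹ * (t l * g * (t l)⁻¹))

/-- Some finite means of conjugates of `g` are close to the scalar `χ g`. -/
def HasScalarMeans (χ : G → ℂ) : Prop :=
  ∀ (g : G) (ε : ℝ), 0 < ε → ∃ (n : ℕ) (t : Fin n → G), 0 < n ∧
    ‖conjGram χ g t - χ g⁻¹ * χ g‖ ≤ ε

variable {H : Type*} [NormedAddCommGroup H] [InnerProductSpace ℂ H] [CompleteSpace H]
  {π ρ : G →* unitary (H →L[ℂ] H)} {ξ : H}

theorem IsGNS.inner_apply (h : IsGNS χ π ξ) (a b : G) :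
    inner ℂ ((π a : H →L[ℂ] H) ξ) ((π b : H →L[ℂ] H) ξ) = χ (a⁻¹ * b) := by
  have h1 : (π b : H →L[ℂ] H) ξ = (π a : H →L[ℂ] H) ((π (a⁻¹ * b) : H →L[ℂ] H) ξ) := by
    have : π b = π a * π (a⁻¹ * b) := by rw [← map_mul]; simp
    rw [this]; rfl
  rw [h1, Unitary.inner_map_map, h.apply_eq]

theorem IsGNS.mul_apply (π : G →* unitary (H →L[ℂ] H)) (a b : G) (x : H) :
    (π (a * b) : H →L[ℂ] H) x = (π a : H →L[ℂ] H) ((π b : H →L[ℂ] H) x) := by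
  rw [map_mul]; rfl

theorem IsGNS.inner_self (h : IsGNS χ π ξ) : inner ℂ ξ ξ = χ 1 := by
  simpa using (h.apply_eq 1).symm

theorem IsGNS.norm_apply (h : IsGNS χ π ξ) (hχ : IsCharacter χ) (g : G) :
    ‖(π g : H →L[ℂ] H) ξ‖ = 1 := by
  have h2 := h.inner_self
  have : ‖ξ‖ ^ 2 = 1 := by
    rw [← inner_self_eq_norm_sq (𝕜 := ℂ), h2, hχ.map_one]; simp
  rw [Unitary.norm_map]
  exact (pow_eq_one_iff_of_nonneg (norm_nonneg _) two_ne_zero).1 this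

/-- The mean of the vectors `π (t g t⁻¹) ξ`. -/
noncomputable def conjMean (π : G →* unitary (H →L[ℂ] H)) (ξ : H) (g : G) {ι : Type*} [Fintype ι]
    (t : ι → G) : H :=
  (Fintype.card ι : ℂ)⁻¹ • ∑ i, (π (t i * g * (t i)⁻¹) : H →L[ℂ] H) ξ

theorem IsCharacter.conj_apply (hχ : IsCharacter χ) (t g : G) : χ (t * g * t⁻¹) = χ g := by
  rw [hχ.central]; simp

theorem inner_conjMean (h : IsGNS χ π ξ) (hχ : IsCharacter χ) (g : G) {ι : Type*} [Fintype ι]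
    [Nonempty ι] (t : ι → G) : inner ℂ ξ (conjMean π ξ g t) = χ g := by
  rw [conjMean, inner_smul_right, inner_sum]
  simp only [← h.apply_eq, hχ.conj_apply]
  simp

theorem inner_conjMean_self (h : IsGNS χ π ξ) (g : G) {ι : Type*} [Fintype ι]
    (t : ι → G) : inner ℂ (conjMean π ξ g t) (conjMean π ξ g t) = conjGram χ g t := by
  rw [conjMean, inner_smul_right, inner_smul_left, sum_inner, conjGram]
  simp only [inner_sum, h.inner_apply]
  simp [mul_assoc]

theorem norm_conjMean_sub_sq (h : IsGNS χ π ξ) (hχ : IsCharacter χ) (g : G) (z : ℂ) {ι : Type*}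
    [Fintype ι] [Nonempty ι] (t : ι → G) :
    ((‖conjMean π ξ g t - z • ξ‖ ^ 2 : ℝ) : ℂ) =
      conjGram χ g t - z * starRingEnd ℂ (χ g) - starRingEnd ℂ z * χ g + starRingEnd ℂ z * z := by
  have := inner_self_eq_norm_sq_to_K (𝕜 := ℂ) (conjMean π ξ g t - z • ξ)
  push_cast
  erw [← this]
  rw [inner_sub_left, inner_sub_right, inner_sub_right, inner_smul_left, inner_smul_left,
    inner_smul_right, inner_smul_right, inner_conjMean_self h, inner_conjMean h hχ, h.inner_self,
    hχ.map_one, ← inner_conj_symm, inner_conjMean h hχ]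
  ring

theorem norm_conjMean_sub_le (h : IsGNS χ π ξ) (hχ : IsCharacter χ) (g : G) {ι : Type*}
    [Fintype ι] [Nonempty ι] (t : ι → G) :
    ‖conjMean π ξ g t - χ g • ξ‖ ^ 2 ≤ ‖conjGram χ g t - χ g⁻¹ * χ g‖ := by
  have h1 := norm_conjMean_sub_sq h hχ g (χ g) t
  rw [hχ.map_inv]
  have h2 : ((‖conjMean π ξ g t - χ g • ξ‖ ^ 2 : ℝ) : ℂ) =
      conjGram χ g t - starRingEnd ℂ (χ g) * χ g := by rw [h1]; ring
  rw [← h2, Complex.norm_real]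
  exact le_abs_self _

/-- Cauchy–Schwarz against the unit vector $\xi$. The bound is phrased without the Hilbert space
and, for fixed $z$, is affine in $\chi$, so that it can be averaged over a convex combination of
characters. -/
theorem norm_sub_sq_le_conjGram (hχ : IsCharacter χ) (g : G) (z : ℂ) {ι : Type*}
    [Fintype ι] [Nonempty ι] (t : ι → G) :
    ‖χ g - z‖ ^ 2 ≤ (conjGram χ g t - z * starRingEnd ℂ (χ g) - starRingEnd ℂ z * χ g
      + starRingEnd ℂ z * z).re := by
  obtain ⟨H, i1, i2, i3, π, ρ, ξ, h⟩ := hχ.exists_biGNS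
  rw [← norm_conjMean_sub_sq h.toIsGNS hχ g z t, Complex.ofReal_re]
  have h1 : χ g - z = inner ℂ ξ (conjMean π ξ g t - z • ξ) := by
    rw [inner_sub_right, inner_smul_right, inner_conjMean h.toIsGNS hχ, h.inner_self, hχ.map_one,
      mul_one]
  have h2 : ‖ξ‖ = 1 := by simpa using h.toIsGNS.norm_apply hχ 1
  rw [h1]
  have := norm_inner_le_norm (𝕜 := ℂ) ξ (conjMean π ξ g t - z • ξ)
  rw [h2, one_mul] at this
  gcongr

theorem conjGram_combo (χ₁ χ₂ : G → ℂ) (a b : ℝ) (g : G) {ι : Type*} [Fintype ι] (t : ι → G) :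
    conjGram (a • χ₁ + b • χ₂) g t = a * conjGram χ₁ g t + b * conjGram χ₂ g t := by
  simp only [conjGram, Pi.add_apply, Pi.smul_apply, Complex.real_smul, Finset.sum_add_distrib,
    ← Finset.mul_sum]
  ring

/-- With $z=\chi(g)$, the defect $\mathrm{conjGram}\,\chi-|\chi(g)|^2$ is the convex combination of
the nonnegative bounds for $\chi_1$ and $\chi_2$. Making it small forces $\chi_1(g)=\chi(g)$. -/
theorem HasScalarMeans.mem_extremePoints (hm : HasScalarMeans χ) (hχ : IsCharacter χ) :
    χ ∈ Set.extremePoints ℝ {χ : G → ℂ | IsCharacter χ} := by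
  rw [_root_.mem_extremePoints]
  refine ⟨hχ, ?_⟩
  have key : ∀ χ₁ χ₂ : G → ℂ, IsCharacter χ₁ → IsCharacter χ₂ → ∀ a b : ℝ, 0 < a → 0 < b →
      a + b = 1 → a • χ₁ + b • χ₂ = χ → χ₁ = χ := by
    intro χ₁ χ₂ h₁ h₂ a b ha hb hab hs
    funext g
    by_contra hne
    have hpos : 0 < ‖χ₁ g - χ g‖ := norm_pos_iff.2 (sub_ne_zero.2 hne)
    obtain ⟨n, t, hn, ht⟩ := hm g (a * ‖χ₁ g - χ g‖ ^ 2 / 2) (by positivity)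
    have : Nonempty (Fin n) := ⟨⟨0, hn⟩⟩
    have k₁ := norm_sub_sq_le_conjGram h₁ g (χ g) t
    have k₂ := norm_sub_sq_le_conjGram h₂ g (χ g) t
    have hg : (a : ℂ) * χ₁ g + b * χ₂ g = χ g := by
      have := congrFun hs g; simpa using this
    have hab' : (a : ℂ) + b = 1 := by exact_mod_cast hab
    have e : conjGram χ g t - χ g⁻¹ * χ g =
        a * (conjGram χ₁ g t - χ g * starRingEnd ℂ (χ₁ g) - starRingEnd ℂ (χ g) * χ₁ g
          + starRingEnd ℂ (χ g) * χ g) +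
        b * (conjGram χ₂ g t - χ g * starRingEnd ℂ (χ₂ g) - starRingEnd ℂ (χ g) * χ₂ g
          + starRingEnd ℂ (χ g) * χ g) := by
      have e1 : conjGram χ g t = a * conjGram χ₁ g t + b * conjGram χ₂ g t := by
        rw [← conjGram_combo, hs]
      have e2 : starRingEnd ℂ (χ g) = a * starRingEnd ℂ (χ₁ g) + b * starRingEnd ℂ (χ₂ g) := by
        rw [← hg]; simp
      rw [hχ.map_inv, e1]
      linear_combination -(χ g) * e2 + (starRingEnd ℂ (χ g)) * hg
        - (starRingEnd ℂ (χ g) * χ g) * hab'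
    have e' := congrArg Complex.re e
    rw [Complex.add_re, Complex.re_ofReal_mul, Complex.re_ofReal_mul] at e'
    have h3 := (Complex.re_le_norm (conjGram χ g t - χ g⁻¹ * χ g)).trans ht
    rw [e'] at h3
    have h4 : 0 ≤ b * (conjGram χ₂ g t - χ g * starRingEnd ℂ (χ₂ g) - starRingEnd ℂ (χ g) * χ₂ g
          + starRingEnd ℂ (χ g) * χ g).re :=
      mul_nonneg hb.le ((sq_nonneg _).trans k₂)
    have h5 := mul_le_mul_of_nonneg_left k₁ ha.le
    have h6 : 0 < a * ‖χ₁ g - χ g‖ ^ 2 := by positivity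
    linarith
  intro χ₁ h₁ χ₂ h₂ hseg
  obtain ⟨a, b, ha, hb, hab, hs⟩ := hseg
  exact ⟨key χ₁ χ₂ h₁ h₂ a b ha hb hab hs,
    key χ₂ χ₁ h₂ h₁ b a hb ha (by linarith) (by rw [add_comm]; exact hs)⟩

theorem BiGNS.commute (h : BiGNS χ π ρ ξ) (a g : G) :
    (ρ a : H →L[ℂ] H) * (π g : H →L[ℂ] H) = (π g : H →L[ℂ] H) * (ρ a : H →L[ℂ] H) := by
  refine continuousLinearMap_ext_of_dense_span h.cyclic fun x => ?_
  change (ρ a : H →L[ℂ] H) ((π g : H →L[ℂ] H) _) = (π g : H →L[ℂ] H) ((ρ a : H →L[ℂ] H) _)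
  rw [h.right_apply, ← IsGNS.mul_apply, ← IsGNS.mul_apply, h.right_apply, mul_assoc]

theorem star_coe_map (π : G →* unitary (H →L[ℂ] H)) (g : G) :
    star (π g : H →L[ℂ] H) = (π g⁻¹ : H →L[ℂ] H) := by
  rw [map_inv]; rfl

theorem mem_centralizer_range_iff (π : G →* unitary (H →L[ℂ] H)) (T : H →L[ℂ] H) :
    T ∈ StarSubalgebra.centralizer ℂ (Set.range fun g => (π g : H →L[ℂ] H)) ↔
      ∀ g, (π g : H →L[ℂ] H) * T = T * (π g : H →L[ℂ] H) := by
  rw [StarSubalgebra.mem_centralizer_iff]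
  constructor
  · intro h g
    exact (h _ ⟨g, rfl⟩).1
  · rintro h _ ⟨g, rfl⟩
    refine ⟨h g, ?_⟩
    simp only [star_coe_map]
    exact h g⁻¹

theorem mem_generatedVN_iff (S : Set (H →L[ℂ] H)) (T : H →L[ℂ] H) :
    T ∈ generatedVN S ↔ ∀ A ∈ StarSubalgebra.centralizer ℂ S, A * T = T * A := by
  change T ∈ StarSubalgebra.centralizer ℂ (StarSubalgebra.centralizer ℂ S : Set (H →L[ℂ] H)) ↔ _
  rw [StarSubalgebra.mem_centralizer_iff]
  exact ⟨fun h A hA => (h A hA).1, fun h A hA => ⟨h A hA, h _ (star_mem hA)⟩⟩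

theorem mem_generatedVN_commutant_iff (S : Set (H →L[ℂ] H)) (T : H →L[ℂ] H) :
    T ∈ (generatedVN S).commutant ↔ T ∈ StarSubalgebra.centralizer ℂ S := by
  rw [VonNeumannAlgebra.mem_commutant_iff]
  constructor
  · intro h
    rw [StarSubalgebra.mem_centralizer_iff]
    intro A hA
    have hmem : ∀ B ∈ S, B ∈ generatedVN S := by
      intro B hB
      rw [mem_generatedVN_iff]
      intro C hC
      rw [StarSubalgebra.mem_centralizer_iff] at hC
      exact ((hC B hB).1).symm
    exact ⟨h A (hmem A hA), h _ (star_mem (hmem A hA))⟩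
  · intro h A hA
    rw [mem_generatedVN_iff] at hA
    exact (hA T h).symm

/-- A central $T$ commutes with both actions, so $T\xi$ is fixed by every $\pi(a)\rho(a)$ and has
the same inner product with all conjugates $\pi(tgt^{-1})\xi$. Passing to means that approach
$\chi(g)\xi$ gives $T\xi=c\,\xi$, and cyclicity gives $T=c$. -/
theorem HasScalarMeans.isFactor (hm : HasScalarMeans χ) (hχ : IsCharacter χ)
    (h : BiGNS χ π ρ ξ) : IsFactor (generatedVN (Set.range fun g => (π g : H →L[ℂ] H))) := by
  intro T hT hT'
  rw [mem_generatedVN_commutant_iff, mem_centralizer_range_iff] at hT'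
  rw [mem_generatedVN_iff] at hT
  have hTρ : ∀ a, (ρ a : H →L[ℂ] H) * T = T * (ρ a : H →L[ℂ] H) := fun a =>
    hT _ ((mem_centralizer_range_iff _ _).2 fun g => (h.commute a g).symm)
  have hπ : ∀ a x, (π a : H →L[ℂ] H) (T x) = T ((π a : H →L[ℂ] H) x) := fun a x =>
    congrArg (fun A : H →L[ℂ] H => A x) (hT' a)
  have hρ : ∀ a x, (ρ a : H →L[ℂ] H) (T x) = T ((ρ a : H →L[ℂ] H) x) := fun a x =>
    congrArg (fun A : H →L[ℂ] H => A x) (hTρ a)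
  have hξ : ∀ a g, (π a : H →L[ℂ] H) ((ρ a : H →L[ℂ] H) ((π g : H →L[ℂ] H) ξ)) =
      (π (a * g * a⁻¹) : H →L[ℂ] H) ξ := by
    intro a g
    rw [h.right_apply, ← IsGNS.mul_apply, mul_assoc]
  have hinv : ∀ a, (π a : H →L[ℂ] H) ((ρ a : H →L[ℂ] H) (T ξ)) = T ξ := by
    intro a
    have := hξ a 1
    simp only [map_one, OneMemClass.coe_one, one_apply_eq_self, mul_one,
      mul_inv_cancel] at this
    rw [hρ, hπ, this]
  have hin : ∀ t g, inner ℂ ((π (t * g * t⁻¹) : H →L[ℂ] H) ξ) (T ξ) =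
      inner ℂ ((π g : H →L[ℂ] H) ξ) (T ξ) := by
    intro t g
    conv_lhs => rw [← hinv t, ← hξ]
    rw [Unitary.inner_map_map, Unitary.inner_map_map]
  have key : ∀ g, inner ℂ ((π g : H →L[ℂ] H) ξ) (T ξ) =
      inner ℂ ((π g : H →L[ℂ] H) ξ) ((inner ℂ ξ (T ξ)) • ξ) := by
    intro g
    have e1 : inner ℂ ((π g : H →L[ℂ] H) ξ) ((inner ℂ ξ (T ξ)) • ξ) =
        inner ℂ (χ g • ξ) (T ξ) := by
      rw [inner_smul_right, inner_smul_left, ← inner_conj_symm ((π g : H →L[ℂ] H) ξ) ξ,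
          ← h.apply_eq, mul_comm]
    rw [e1, ← sub_eq_zero, ← inner_sub_left]
    by_contra hne
    set d := inner ℂ ((π g : H →L[ℂ] H) ξ - χ g • ξ) (T ξ) with hd
    have hdpos : 0 < ‖d‖ := norm_pos_iff.2 hne
    -- The summand 1 keeps `C` positive when `T ξ = 0`; the tolerance $(\|d\|/2C)^2$ then leads to
    -- $\|d\|\le\|d\|/2$.
    set C := ‖T ξ‖ + 1 with hC
    have hCpos : 0 < C := by positivity
    obtain ⟨n, t, hn, ht⟩ := hm g ((‖d‖ / (2 * C)) ^ 2) (by positivity)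
    have : Nonempty (Fin n) := ⟨⟨0, hn⟩⟩
    have h2 := (norm_conjMean_sub_le h.toIsGNS hχ g t).trans ht
    have h3 : ‖conjMean π ξ g t - χ g • ξ‖ ≤ ‖d‖ / (2 * C) :=
      (sq_le_sq₀ (norm_nonneg _) (by positivity)).1 h2
    have h4 : inner ℂ (conjMean π ξ g t - χ g • ξ) (T ξ) = d := by
      rw [hd, inner_sub_left, inner_sub_left, conjMean, inner_smul_left, sum_inner]
      simp only [hin]
      have hn' : (n : ℂ) ≠ 0 := by exact_mod_cast hn.ne'
      simp [hn']
    have h5 := norm_inner_le_norm (𝕜 := ℂ) (conjMean π ξ g t - χ g • ξ) (T ξ)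
    rw [h4] at h5
    have h6 : ‖d‖ ≤ ‖d‖ / (2 * C) * C :=
      h5.trans (mul_le_mul h3 (by linarith) (norm_nonneg _) (by positivity))
    have h7 : ‖d‖ / (2 * C) * C = ‖d‖ / 2 := by field_simp
    linarith
  have hTξ : T ξ = (inner ℂ ξ (T ξ)) • ξ := by
    have hz : T ξ - (inner ℂ ξ (T ξ)) • ξ = 0 := by
      have := continuousLinearMap_ext_of_dense_span h.cyclic
        (S := innerSL ℂ (T ξ - (inner ℂ ξ (T ξ)) • ξ)) (T := 0) (fun g => by
          simp only [innerSL_apply_apply, zero_apply]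
          rw [← inner_conj_symm, inner_sub_right, key, sub_self, map_zero])
      have h1 := congrArg (fun A : H →L[ℂ] ℂ => A (T ξ - (inner ℂ ξ (T ξ)) • ξ)) this
      simp only [innerSL_apply_apply, zero_apply] at h1
      exact inner_self_eq_zero.1 h1
    exact sub_eq_zero.1 hz
  refine ⟨inner ℂ ξ (T ξ), continuousLinearMap_ext_of_dense_span h.cyclic fun g => ?_⟩
  rw [← hπ]
  conv_lhs => rw [hTξ]
  simp

theorem HasScalarMeans.isIndecomposable {χ : G → ℂ} (hm : HasScalarMeans χ)
    (hχ : IsCharacter χ) : IsIndecomposable χ := by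
  obtain ⟨H, i1, i2, i3, π, ρ, ξ, h⟩ := hχ.exists_biGNS
  exact ⟨hχ, H, i1, i2, i3, π, ξ, h.toIsGNS, hm.isFactor hχ h⟩

end Criterion

end SymLimit

namespace SymLimit

/-! ### Asymptotic multiplicativity of extreme and of indecomposable characters -/

section PosDef

variable {G : Type*} [Group G] {χ : G → ℂ}

/-- Positive definite functions on a group. -/
def IsPosDef (φ : G → ℂ) : Prop :=
  ∀ (S : Finset G) (c : G → ℂ), 0 ≤ ∑ g ∈ S, ∑ h ∈ S, starRingEnd ℂ (c g) * c h * φ (g⁻¹ * h)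

theorem IsPosDef.smul {φ : G → ℂ} (hφ : IsPosDef φ) {r : ℂ} (hr : 0 ≤ r) :
    IsPosDef fun x => r * φ x := by
  intro S c
  have : ∑ g ∈ S, ∑ h ∈ S, starRingEnd ℂ (c g) * c h * (r * φ (g⁻¹ * h)) =
      r * ∑ g ∈ S, ∑ h ∈ S, starRingEnd ℂ (c g) * c h * φ (g⁻¹ * h) := by
    simp only [Finset.mul_sum]
    exact Finset.sum_congr rfl fun g _ => Finset.sum_congr rfl fun h _ => by ring
  rw [this]
  exact mul_nonneg hr (hφ S c)

theorem IsPosDef.sum {ι : Type*} {φ : ι → G → ℂ} (s : Finset ι) (hφ : ∀ i ∈ s, IsPosDef (φ i)) :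
    IsPosDef fun x => ∑ i ∈ s, φ i x := by
  intro S c
  have : ∑ g ∈ S, ∑ h ∈ S, starRingEnd ℂ (c g) * c h * (∑ i ∈ s, φ i (g⁻¹ * h)) =
      ∑ i ∈ s, ∑ g ∈ S, ∑ h ∈ S, starRingEnd ℂ (c g) * c h * φ i (g⁻¹ * h) := by
    simp only [Finset.mul_sum]
    rw [Finset.sum_comm]
    conv_rhs => rw [Finset.sum_comm]
    conv_rhs => enter [2, y]; rw [Finset.sum_comm]
    rw [Finset.sum_comm]
  rw [this]
  exact Finset.sum_nonneg fun i hi => hφ i hi S c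

theorem IsPosDef.of_tendsto {ι : Type*} {l : Filter ι} [l.NeBot] {φ : ι → G → ℂ} {ψ : G → ℂ}
    (hφ : ∀ i, IsPosDef (φ i)) (hlim : ∀ x, Tendsto (fun i => φ i x) l (𝓝 (ψ x))) :
    IsPosDef ψ := by
  intro S c
  have : Tendsto (fun i => ∑ g ∈ S, ∑ h ∈ S, starRingEnd ℂ (c g) * c h * φ i (g⁻¹ * h)) l
      (𝓝 (∑ g ∈ S, ∑ h ∈ S, starRingEnd ℂ (c g) * c h * ψ (g⁻¹ * h))) :=
    tendsto_finsetSum _ fun g _ => tendsto_finsetSum _ fun h _ => (hlim _).const_mul _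
  exact ge_of_tendsto' this fun i => hφ i S c

theorem IsCharacter.norm_le_one (hχ : IsCharacter χ) (g : G) : ‖χ g‖ ≤ 1 := by
  obtain ⟨H, i1, i2, i3, π, ρ, ξ, h⟩ := hχ.exists_biGNS
  have h1 : ‖ξ‖ = 1 := by simpa using h.toIsGNS.norm_apply hχ 1
  have := norm_inner_le_norm (𝕜 := ℂ) ξ ((π g : H →L[ℂ] H) ξ)
  rwa [← h.apply_eq, h1, h.toIsGNS.norm_apply hχ, one_mul] at this

/-- Left translation of the argument by $u$ turns the quadratic form into
$\langle\rho(u)\zeta,\zeta\rangle$, of modulus at most $\|\zeta\|^2$. With the factor $1/4$ the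
perturbation subtracts at most half of the form $\|\zeta\|^2$ of $\chi$. -/
theorem IsCharacter.isPosDef_perturb (hχ : IsCharacter χ) (u : G) {θ : ℂ} (hθ : ‖θ‖ ≤ 1) :
    IsPosDef fun x => χ x + (1 / 4) * (θ * χ (u * x) + starRingEnd ℂ θ * χ (u⁻¹ * x)) := by
  obtain ⟨H, i1, i2, i3, π, ρ, ξ, h⟩ := hχ.exists_biGNS
  intro S c
  set ζ : H := ∑ g ∈ S, c g • (π g : H →L[ℂ] H) ξ with hζ
  have e : ∀ v : G, ∑ g ∈ S, ∑ h ∈ S, starRingEnd ℂ (c g) * c h * χ (v * (g⁻¹ * h)) =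
      inner ℂ ((ρ v : H →L[ℂ] H) ζ) ζ := by
    intro v
    rw [hζ, map_sum, sum_inner]
    simp only [inner_sum, map_smul, h.right_apply, inner_smul_left, inner_smul_right,
      h.toIsGNS.inner_apply]
    refine Finset.sum_congr rfl fun a _ => Finset.sum_congr rfl fun b _ => ?_
    rw [mul_inv_rev, inv_inv, mul_assoc v]
    ring
  have e1 := e 1
  simp only [one_mul, _root_.map_one, OneMemClass.coe_one, one_apply_eq_self] at e1
  have e2 : inner ℂ ((ρ u⁻¹ : H →L[ℂ] H) ζ) ζ =
      starRingEnd ℂ (inner ℂ ((ρ u : H →L[ℂ] H) ζ) ζ) := by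
    rw [inner_conj_symm, ← Unitary.inner_map_map (ρ u), ← IsGNS.mul_apply]
    simp
  set w := inner ℂ ((ρ u : H →L[ℂ] H) ζ) ζ with hw
  have hwn : ‖w‖ ≤ ‖ζ‖ ^ 2 := by
    have := norm_inner_le_norm (𝕜 := ℂ) ((ρ u : H →L[ℂ] H) ζ) ζ
    rw [Unitary.norm_map] at this
    rw [sq]; exact this
  have tot : ∑ g ∈ S, ∑ h ∈ S, starRingEnd ℂ (c g) * c h *
      (χ (g⁻¹ * h) + (1 / 4) * (θ * χ (u * (g⁻¹ * h)) + starRingEnd ℂ θ * χ (u⁻¹ * (g⁻¹ * h)))) =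
      inner ℂ ζ ζ + (1 / 4) * (θ * w + starRingEnd ℂ θ * starRingEnd ℂ w) := by
    rw [← e1, ← e2, hw, ← e u, ← e u⁻¹]
    simp only [Finset.mul_sum, ← Finset.sum_add_distrib]
    exact Finset.sum_congr rfl fun a _ => Finset.sum_congr rfl fun b _ => by ring
  rw [tot, ← map_mul, Complex.add_conj, inner_self_eq_norm_sq_to_K]
  have h3 : |(θ * w).re| ≤ ‖ζ‖ ^ 2 := by
    refine (Complex.abs_re_le_norm _).trans ?_
    rw [norm_mul]
    exact (mul_le_mul hθ hwn (norm_nonneg _) zero_le_one).trans_eq (one_mul _)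
  have h4 := (abs_le.1 h3).1
  have : (0 : ℂ) ≤ ((‖ζ‖ ^ 2 + 1 / 4 * (2 * (θ * w).re) : ℝ) : ℂ) := by
    rw [Complex.zero_le_real]; nlinarith [sq_nonneg ‖ζ‖]
  convert this using 1
  push_cast
  rfl

/-- A central positive definite function below an extreme character is a multiple of it. -/
theorem eq_smul_of_mem_extremePoints
    (hχ : χ ∈ Set.extremePoints ℝ {χ : G → ℂ | IsCharacter χ}) {φ φ' : G → ℂ}
    (h₁ : IsPosDef φ) (h₂ : IsPosDef φ') (c₁ : ∀ g h, φ (g * h) = φ (h * g))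
    (c₂ : ∀ g h, φ' (g * h) = φ' (h * g)) (hsum : ∀ x, φ x + φ' x = χ x) {r : ℝ}
    (hr : φ 1 = r) (h0 : 0 < r) (h1 : r < 1) (x : G) : φ x = r * χ x := by
  rw [_root_.mem_extremePoints] at hχ
  obtain ⟨hc, hext⟩ := hχ
  have hr' : φ' 1 = ((1 - r : ℝ) : ℂ) := by
    have := hsum 1
    rw [hc.map_one, hr] at this
    push_cast
    linear_combination this
  have hr0 : (r : ℂ) ≠ 0 := by exact_mod_cast h0.ne'
  have hr1 : ((1 - r : ℝ) : ℂ) ≠ 0 := by exact_mod_cast (by linarith : (1 - r) ≠ 0)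
  have hinv : ∀ {s : ℝ}, 0 < s → (0 : ℂ) ≤ (s : ℂ)⁻¹ := by
    intro s hs
    rw [← Complex.ofReal_inv, Complex.zero_le_real]
    positivity
  have k₁ : IsCharacter fun x => (r : ℂ)⁻¹ * φ x :=
    ⟨h₁.smul (hinv h0), fun g h => by rw [c₁], by rw [hr]; field_simp⟩
  have k₂ : IsCharacter fun x => ((1 - r : ℝ) : ℂ)⁻¹ * φ' x :=
    ⟨h₂.smul (hinv (by linarith)), fun g h => by rw [c₂], by rw [hr']; field_simp⟩
  have := (hext _ k₁ _ k₂ ⟨r, 1 - r, h0, by linarith, by ring, by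
    funext y
    simp only [Pi.add_apply, Pi.smul_apply, Complex.real_smul]
    rw [mul_inv_cancel_left₀ hr0, mul_inv_cancel_left₀ hr1, hsum]⟩).1
  rw [← congrFun this x, mul_inv_cancel_left₀ hr0]

end PosDef

/-! ### Asymptotic multiplicativity along an increasing sequence of finite subgroups. -/

section Asymptotic

variable {G : Type*} [Group G] {χ : G → ℂ} (K : ℕ → Subgroup G) [∀ j, Fintype (K j)]

/-- The mean of `χ (t g t⁻¹ x)` over the elements `t` of the finite subgroup `K j`. -/
noncomputable def conjAvg (χ : G → ℂ) (g x : G) (j : ℕ) : ℂ :=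
  (Fintype.card (K j) : ℂ)⁻¹ * ∑ t : K j, χ (t * g * (t : G)⁻¹ * x)

/-- Asymptotic multiplicativity of a function along a sequence of finite subgroups. -/
def IsAsympMul (χ : G → ℂ) : Prop :=
  ∀ g x : G, Tendsto (conjAvg K χ g x) atTop (𝓝 (χ g * χ x))

variable {K}

theorem card_inv_mul_card (j : ℕ) :
    (Fintype.card (K j) : ℂ)⁻¹ * (Fintype.card (K j) : ℂ) = 1 :=
  inv_mul_cancel₀ (by exact_mod_cast Fintype.card_ne_zero)

theorem conjAvg_one (hχ : IsCharacter χ) (g : G) (j : ℕ) : conjAvg K χ g 1 j = χ g := by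
  simp only [conjAvg, mul_one, hχ.conj_apply, Finset.sum_const, Finset.card_univ, nsmul_eq_mul]
  rw [← mul_assoc, card_inv_mul_card, one_mul]

theorem conjAvg_one' (hχ : IsCharacter χ) (g : G) : conjAvg K χ g 1 = fun _ => χ g :=
  funext (conjAvg_one hχ g)

theorem norm_conjAvg_le (hχ : IsCharacter χ) (g x : G) (j : ℕ) : ‖conjAvg K χ g x j‖ ≤ 1 := by
  rw [conjAvg, norm_mul]
  have h1 : ‖∑ t : K j, χ (t * g * (t : G)⁻¹ * x)‖ ≤ Fintype.card (K j) := by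
    refine (norm_sum_le_of_le _ fun t _ => hχ.norm_le_one _).trans_eq ?_
    simp
  refine (mul_le_mul_of_nonneg_left h1 (norm_nonneg _)).trans_eq ?_
  simp

theorem conjAvg_mul_comm (hχ : IsCharacter χ) (g x : G) {y : G} {j : ℕ} (hy : y ∈ K j) :
    conjAvg K χ g (x * y) j = conjAvg K χ g (y * x) j := by
  rw [conjAvg, conjAvg]
  congr 1
  refine Fintype.sum_equiv (Equiv.mulLeft (⟨y, hy⟩ : K j)) _ _ fun t => ?_
  rw [← mul_assoc, hχ.central]
  congr 1
  simp [mul_assoc]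

theorem exists_tendsto_ultrafilter (U : Ultrafilter ℕ) {f : ℕ → ℂ} {C : ℝ} (hf : ∀ j, ‖f j‖ ≤ C) :
    ∃ z, Tendsto f U (𝓝 z) := by
  obtain ⟨z, -, hz⟩ := (isCompact_closedBall (0 : ℂ) C).ultrafilter_le_nhds (U.map f) (by
    rw [le_principal_iff]
    exact Filter.mem_map.2 (Filter.univ_mem' fun j => by simpa using hf j))
  exact ⟨z, hz⟩

/-- An ultrafilter limit $\psi$ of the averages is central, since averaging over $K_j$ absorbs any
element of $K_j$. The functions $\varphi_\theta=\frac12(\chi+\frac14(\theta\psi+\bar\theta\psi'))$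
are positive definite and $\varphi_\theta+\varphi_{-\theta}=\chi$, so extremality makes them
proportional to $\chi$. -/
theorem isAsympMul_of_mem_extremePoints (hmono : Monotone K) (hexh : ∀ g, ∃ j, g ∈ K j)
    (hext : χ ∈ Set.extremePoints ℝ {χ : G → ℂ | IsCharacter χ}) : IsAsympMul K χ := by
  have hχ : IsCharacter χ := hext.1
  intro g x
  rw [tendsto_iff_ultrafilter]
  intro U hU
  choose ψ hψ using fun y => exists_tendsto_ultrafilter U (norm_conjAvg_le (K := K) hχ g y)
  choose ψ' hψ' using fun y => exists_tendsto_ultrafilter U (norm_conjAvg_le (K := K) hχ g⁻¹ y)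
  have hone : ψ 1 = χ g := tendsto_nhds_unique (hψ 1) (by simp [conjAvg_one' hχ])
  have hone' : ψ' 1 = starRingEnd ℂ (χ g) :=
    tendsto_nhds_unique (hψ' 1) (by simp [conjAvg_one' hχ, hχ.map_inv])
  have hcen : ∀ (k : G) (φ : G → ℂ) (_ : ∀ y, Tendsto (conjAvg K χ k y) U (𝓝 (φ y))) (a b : G),
      φ (a * b) = φ (b * a) := by
    intro k φ hφ a b
    refine tendsto_nhds_unique (hφ _) ((hφ (b * a)).congr' ?_)
    obtain ⟨j, hj⟩ := hexh b
    refine hU ((eventually_ge_atTop j).mono fun i hi => ?_)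
    exact (conjAvg_mul_comm hχ k a (hmono hi hj)).symm
  let φ : ℂ → G → ℂ := fun θ y =>
    1 / 2 * (χ y + (1 / 4) * (θ * ψ y + starRingEnd ℂ θ * ψ' y))
  have hφpd : ∀ θ : ℂ, ‖θ‖ ≤ 1 → IsPosDef (φ θ) := by
    intro θ hθ
    refine IsPosDef.smul (φ := fun y => χ y + (1 / 4) * (θ * ψ y + starRingEnd ℂ θ * ψ' y)) ?_
      (by rw [Complex.le_def]; norm_num)
    refine IsPosDef.of_tendsto (l := (U : Filter ℕ)) (φ := fun j y => χ y + (1 / 4) *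
      (θ * conjAvg K χ g y j + starRingEnd ℂ θ * conjAvg K χ g⁻¹ y j)) (fun j => ?_) fun y =>
        tendsto_const_nhds.add ((((hψ y).const_mul _).add ((hψ' y).const_mul _)).const_mul _)
    have h1 := (IsPosDef.sum (Finset.univ : Finset (K j)) (fun t _ =>
      hχ.isPosDef_perturb (t * g * (t : G)⁻¹) hθ)).smul (r := (Fintype.card (K j) : ℂ)⁻¹) (by
        rw [← Complex.ofReal_natCast, ← Complex.ofReal_inv, Complex.zero_le_real]; positivity)
    convert h1 using 2 with y
    simp only [Finset.sum_add_distrib, ← Finset.mul_sum, Finset.sum_const, Finset.card_univ,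
      nsmul_eq_mul, conjAvg, mul_inv_rev, inv_inv, mul_assoc]
    linear_combination -(χ y) * card_inv_mul_card (K := K) j
  have hφc : ∀ θ a b, φ θ (a * b) = φ θ (b * a) := by
    intro θ a b
    simp only [φ]
    rw [hχ.central, hcen g ψ hψ, hcen g⁻¹ ψ' hψ']
  have key : ∀ θ : ℂ, ‖θ‖ = 1 → ∀ y, θ * ψ y + starRingEnd ℂ θ * ψ' y =
      (θ * χ g + starRingEnd ℂ (θ * χ g)) * χ y := by
    intro θ hθ y
    have hre : |(θ * χ g).re| ≤ 1 := by
      refine (Complex.abs_re_le_norm _).trans ?_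
      rw [norm_mul, hθ, one_mul]
      exact hχ.norm_le_one g
    have hre' := abs_le.1 hre
    have h := eq_smul_of_mem_extremePoints hext (hφpd θ hθ.le) (hφpd (-θ) (by simp [hθ]))
      (hφc θ) (hφc (-θ)) (fun x => by simp only [φ, map_neg]; ring)
      (r := 1 / 2 * (1 + 1 / 4 * (2 * (θ * χ g).re)))
      (by
        simp only [φ]
        rw [hχ.map_one, hone, hone', ← map_mul, Complex.add_conj]
        push_cast
        ring) (by linarith) (by linarith) y
    simp only [φ] at h
    rw [Complex.add_conj]
    push_cast at h ⊢
    linear_combination 8 * h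
  -- The values $\theta=1$ and $\theta=i$ separate $\psi$ from $\psi'$.
  have k1 := key 1 (by simp) x
  have k2 := key Complex.I (by simp) x
  simp only [map_mul, map_one, Complex.conj_I, one_mul] at k1 k2
  have : ψ x = χ g * χ x := by
    linear_combination (1 / 2) * k1 - (Complex.I / 2) * k2 +
      (1 / 2) * (ψ x - ψ' x - χ g * χ x + starRingEnd ℂ (χ g) * χ x) * Complex.I_sq
  rw [← this]
  exact hψ x

/-! ### Asymptotic multiplicativity from the factor condition. -/

section Factor

variable {H : Type*} [NormedAddCommGroup H] [InnerProductSpace ℂ H] [CompleteSpace H]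
  {π : G →* unitary (H →L[ℂ] H)} {ξ : H}

/-- The mean of the operators `π (t g t⁻¹)` over the finite subgroup `K j`. -/
noncomputable def avgOp (K : ℕ → Subgroup G) [∀ j, Fintype (K j)] (π : G →* unitary (H →L[ℂ] H))
    (g : G) (j : ℕ) : H →L[ℂ] H :=
  (Fintype.card (K j) : ℂ)⁻¹ • ∑ t : K j, (π (t * g * (t : G)⁻¹) : H →L[ℂ] H)

theorem norm_avgOp_apply_le (g : G) (j : ℕ) (x : H) : ‖avgOp K π g j x‖ ≤ ‖x‖ := by
  simp only [avgOp, smul_apply, sum_apply]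
  rw [norm_smul]
  have h1 : ‖∑ t : K j, (π (t * g * (t : G)⁻¹) : H →L[ℂ] H) x‖ ≤ Fintype.card (K j) * ‖x‖ := by
    refine (norm_sum_le_of_le _ fun t _ => (Unitary.norm_map _ _).le).trans_eq ?_
    simp
  refine (mul_le_mul_of_nonneg_left h1 (norm_nonneg _)).trans_eq ?_
  have := congrArg norm (card_inv_mul_card (K := K) j)
  rw [norm_mul, Complex.norm_natCast, norm_one] at this
  rw [← mul_assoc, this, one_mul]

theorem avgOp_commute (g : G) {y : G} {j : ℕ} (hy : y ∈ K j) :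
    (π y : H →L[ℂ] H) * avgOp K π g j = avgOp K π g j * (π y : H →L[ℂ] H) := by
  simp only [avgOp, mul_smul_comm, smul_mul_assoc, Finset.mul_sum, Finset.sum_mul]
  congr 1
  refine Fintype.sum_equiv (Equiv.mulLeft (⟨y, hy⟩ : K j)) _ _ fun t => ?_
  have e : ∀ a b : G, (π a : H →L[ℂ] H) * (π b : H →L[ℂ] H) = (π (a * b) : H →L[ℂ] H) := by
    intro a b; rw [map_mul]; rfl
  rw [e, e]
  refine congrArg (fun a => (π a : H →L[ℂ] H)) ?_
  simp [mul_assoc]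

theorem IsGNS.inner_avgOp (h : IsGNS χ π ξ) (g x : G) (j : ℕ) :
    inner ℂ ξ (avgOp K π g j ((π x : H →L[ℂ] H) ξ)) = conjAvg K χ g x j := by
  simp only [avgOp, smul_apply, sum_apply, inner_smul_right, inner_sum,
    ← IsGNS.mul_apply, ← h.apply_eq, conjAvg]

/-- The bounded sesquilinear form $\lim_U\langle x,A_jy\rangle$ is represented by an operator. As
$S$ stands in the first slot, it is the adjoint of the weak limit of the $A_j$. -/
theorem exists_ultralimit_operator (U : Ultrafilter ℕ) {A : ℕ → H →L[ℂ] H}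
    (hA : ∀ j x, ‖A j x‖ ≤ ‖x‖) :
    ∃ S : H →L[ℂ] H, ∀ x y, Tendsto (fun j => inner ℂ x (A j y)) U (𝓝 (inner ℂ (S x) y)) := by
  have hb : ∀ x y j, ‖inner ℂ x (A j y)‖ ≤ ‖x‖ * ‖y‖ := fun x y j =>
    (norm_inner_le_norm _ _).trans (mul_le_mul_of_nonneg_left (hA j y) (norm_nonneg _))
  choose B hB using fun x y => exists_tendsto_ultrafilter U (hb x y)
  let B' : H →ₗ⋆[ℂ] H →ₗ[ℂ] ℂ := LinearMap.mk₂'ₛₗ (starRingEnd ℂ) (RingHom.id ℂ) B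
    (fun x x' y => tendsto_nhds_unique (hB _ _) (by
      simpa only [inner_add_left] using (hB x y).add (hB x' y)))
    (fun c x y => tendsto_nhds_unique (hB _ _) (by
      simpa only [inner_smul_left, smul_eq_mul] using (hB x y).const_mul (starRingEnd ℂ c)))
    (fun x y y' => tendsto_nhds_unique (hB _ _) (by
      simpa only [map_add, inner_add_right] using (hB x y).add (hB x y')))
    (fun c x y => tendsto_nhds_unique (hB _ _) (by
      simpa only [map_smul, inner_smul_right, RingHom.id_apply, smul_eq_mul] using
        (hB x y).const_mul c))
  let B'' : H →L⋆[ℂ] H →L[ℂ] ℂ := B'.mkContinuous₂ 1 fun x y => by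
    rw [one_mul]
    exact le_of_tendsto ((hB x y).norm) (Eventually.of_forall fun j => hb x y j)
  refine ⟨InnerProductSpace.continuousLinearMapOfBilin B'', fun x y => ?_⟩
  rw [InnerProductSpace.continuousLinearMapOfBilin_apply]
  exact hB x y

/-- The averaged operators lie in the algebra generated by $\pi(G)$, and the average over $K_j$
commutes with $\pi(K_j)$. Their weak limit is therefore central, hence scalar, and the value at
$x=1$ identifies the scalar as $\chi(g)$. -/
theorem isAsympMul_of_isFactor (hmono : Monotone K) (hexh : ∀ g, ∃ j, g ∈ K j)
    (hχ : IsCharacter χ) (h : IsGNS χ π ξ)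
    (hfac : IsFactor (generatedVN (Set.range fun g => (π g : H →L[ℂ] H)))) : IsAsympMul K χ := by
  intro g x
  rw [tendsto_iff_ultrafilter]
  intro U hU
  obtain ⟨S, hS⟩ := exists_ultralimit_operator U (norm_avgOp_apply_le (K := K) (π := π) g)
  obtain ⟨c, hc⟩ := hfac S
    (by
      rw [mem_generatedVN_iff]
      intro C hC
      have hC' := (mem_centralizer_range_iff π _).1 (star_mem hC)
      have hcomm : ∀ j, avgOp K π g j * star C = star C * avgOp K π g j := by
        intro j
        simp only [avgOp, mul_smul_comm, smul_mul_assoc, Finset.mul_sum, Finset.sum_mul, hC']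
      ext v
      refine ext_inner_right ℂ fun w => ?_
      change inner ℂ (C (S v)) w = inner ℂ (S (C v)) w
      rw [← ContinuousLinearMap.adjoint_inner_right]
      refine tendsto_nhds_unique (hS _ _) ((hS (C v) w).congr fun j => ?_)
      rw [← ContinuousLinearMap.adjoint_inner_right]
      exact congrArg (fun A : H →L[ℂ] H => inner ℂ v (A w)) (hcomm j).symm)
    (by
      rw [mem_generatedVN_commutant_iff, mem_centralizer_range_iff]
      intro s
      ext v
      refine ext_inner_right ℂ fun w => ?_
      change inner ℂ ((π s : H →L[ℂ] H) (S v)) w = inner ℂ (S ((π s : H →L[ℂ] H) v)) w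
      rw [← ContinuousLinearMap.adjoint_inner_right, ← ContinuousLinearMap.star_eq_adjoint,
        star_coe_map]
      refine tendsto_nhds_unique (hS _ _) ((hS ((π s : H →L[ℂ] H) v) w).congr' ?_)
      obtain ⟨j, hj⟩ := hexh s
      refine hU ((eventually_ge_atTop j).mono fun i hi => ?_)
      change inner ℂ ((π s : H →L[ℂ] H) v) (avgOp K π g i w) = _
      rw [← ContinuousLinearMap.adjoint_inner_right, ← ContinuousLinearMap.star_eq_adjoint,
        star_coe_map]
      exact congrArg (fun A : H →L[ℂ] H => inner ℂ v (A w))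
        (avgOp_commute g (inv_mem (hmono hi hj))))
  have hlim : ∀ y, Tendsto (conjAvg K χ g y) U (𝓝 (starRingEnd ℂ c * χ y)) := by
    intro y
    have := hS ξ ((π y : H →L[ℂ] H) ξ)
    simp only [h.inner_avgOp] at this
    rw [hc] at this
    simpa only [smul_apply, one_apply_eq_self, inner_smul_left, ← h.apply_eq] using this
  have h1 : starRingEnd ℂ c = χ g := by
    have := hlim 1
    rw [conjAvg_one' hχ, hχ.map_one, mul_one] at this
    exact tendsto_nhds_unique this tendsto_const_nhds
  rw [← h1]
  exact hlim x

end Factor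

theorem IsIndecomposable.isAsympMul {χ : G → ℂ} (hmono : Monotone K) (hexh : ∀ g, ∃ j, g ∈ K j)
    (h : IsIndecomposable χ) : IsAsympMul K χ := by
  obtain ⟨hχ, H, i1, i2, i3, π, ξ, h1, h2⟩ := h
  exact isAsympMul_of_isFactor hmono hexh hχ h1 h2

/-- Centrality and the substitution $s\mapsto t^{-1}s$ in the group make the inner sum independent
of $t$. -/
theorem conjGram_subgroup (hχ : IsCharacter χ) (g : G) (j : ℕ) :
    conjGram χ g (fun t : K j => (t : G)) = conjAvg K χ g g⁻¹ j := by
  rw [conjGram, conjAvg, mul_assoc]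
  congr 1
  have h : ∀ t : K j, ∑ s : K j, χ ((t * g * (t : G)⁻¹)⁻¹ * (s * g * (s : G)⁻¹)) =
      ∑ s : K j, χ (s * g * (s : G)⁻¹ * g⁻¹) := by
    intro t
    refine Fintype.sum_equiv (Equiv.mulLeft t⁻¹) _ _ fun s => ?_
    have e : (t * g * (t : G)⁻¹)⁻¹ * (s * g * (s : G)⁻¹) =
        (t * g⁻¹) * ((t : G)⁻¹ * s * g * (s : G)⁻¹) := by simp [mul_assoc]
    rw [e, hχ.central]
    congr 1
    simp [mul_assoc]
  simp only [h, Finset.sum_const, Finset.card_univ, nsmul_eq_mul]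
  rw [← mul_assoc, card_inv_mul_card, one_mul]

/-- Multiplicativity, up to a small error, on pairs of an element `g` and an element commuting
with a large finite subgroup. -/
theorem IsAsympMul.norm_mul_sub_le (h : IsAsympMul K χ) (hχ : IsCharacter χ) (g : G) {ε : ℝ}
    (hε : 0 < ε) : ∃ j, ∀ i, j ≤ i → ∀ x : G, (∀ t ∈ K i, t * x = x * t) →
      ‖χ (g * x) - χ g * χ x‖ ≤ ε := by
  obtain ⟨H, i1, i2, i3, π, ρ, ξ, hG⟩ := hχ.exists_biGNS
  -- At $x=g^{-1}$ the hypothesis says that the mean of the vectors $\pi(tgt^{-1})\xi$ over a stage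
  -- converges in norm to $\chi(g)\xi$. An $x$ commuting with that stage sees all these conjugates
  -- alike.
  have h1 := (Metric.tendsto_atTop.1 (h g g⁻¹)) (ε ^ 2) (by positivity)
  obtain ⟨j, hj⟩ := h1
  refine ⟨j, fun i hi x hx => ?_⟩
  have h2 := hj i hi
  rw [dist_eq_norm, ← conjGram_subgroup hχ, mul_comm (χ g)] at h2
  have h3 := (norm_conjMean_sub_le hG.toIsGNS hχ g (fun t : K i => (t : G))).trans h2.le
  have h4 := (sq_le_sq₀ (norm_nonneg _) hε.le).1 h3
  have h5 : χ (g * x) - χ g * χ x = inner ℂ ((π x⁻¹ : H →L[ℂ] H) ξ)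
      (conjMean π ξ g (fun t : K i => (t : G)) - χ g • ξ) := by
    have h6 : ∀ t : K i, χ (x * (t * g * (t : G)⁻¹)) = χ (g * x) := by
      intro t
      rw [hχ.central g x, ← hχ.conj_apply t (x * g)]
      congr 1
      rw [← mul_assoc t.1, hx t t.2]
      simp only [mul_assoc]
    have h7 : inner ℂ ((π x⁻¹ : H →L[ℂ] H) ξ) ξ = χ x := by
      have := hG.toIsGNS.inner_apply x⁻¹ 1
      simpa using this
    rw [inner_sub_right, inner_smul_right, h7, conjMean, inner_smul_right, inner_sum]
    simp only [hG.toIsGNS.inner_apply, inv_inv, h6, Finset.sum_const,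
      Finset.card_univ, nsmul_eq_mul]
    rw [← mul_assoc, card_inv_mul_card, one_mul]
  rw [h5]
  refine (norm_inner_le_norm _ _).trans ?_
  rw [hG.toIsGNS.norm_apply hχ, one_mul]
  exact h4

end Asymptotic

end SymLimit

namespace SymLimit

/-! ### The stages of the inductive limit -/

variable {n : ℕ → ℕ}

/-- The canonical homomorphism from the symmetric group of stage `j` to the inductive limit. -/
noncomputable def level (n : ℕ → ℕ) (j : ℕ) : Equiv.Perm (Fin (N n j)) →* LimitGroup n where
  toFun σ := ⟦⟨j, σ⟩⟧
  map_one' := (DirectLimit.one_def (f := embed n) j).symm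
  map_mul' σ τ := (DirectLimit.mul_def (f := embed n) j σ τ).symm

theorem level_apply (j : ℕ) (σ : Equiv.Perm (Fin (N n j))) : level n j σ = ⟦⟨j, σ⟩⟧ := rfl

theorem level_embed {k j : ℕ} (h : k ≤ j) (σ : Equiv.Perm (Fin (N n k))) :
    level n j (embed n k j h σ) = level n k σ := by
  rw [level_apply, level_apply]
  have := DirectLimit.eq_of_le (f := embed n) ⟨k, σ⟩ j h
  dsimp only at this
  rw [this]

theorem exists_level (s : LimitGroup n) : ∃ j₀, ∀ j, j₀ ≤ j → ∃ σ, level n j σ = s := by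
  obtain ⟨k, σ, rfl⟩ := DirectLimit.exists_eq_mk (f := embed n) s
  exact ⟨k, fun j hj => ⟨embed n k j hj σ, level_embed hj σ⟩⟩

theorem embed_injective (hn : ∀ k, 1 < n k) {k j : ℕ} (h : k ≤ j) :
    Function.Injective (embed n k j h) := by
  intro σ τ hστ
  have hpos : 0 < N n j / N n k :=
    Nat.div_pos (Nat.le_of_dvd (N_pos hn j) (N_dvd n h)) (N_pos hn k)
  ext x
  have h1 := embed_stageEquiv n h σ x ⟨0, hpos⟩
  have h2 := embed_stageEquiv n h τ x ⟨0, hpos⟩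
  rw [hστ, h2] at h1
  have := (stageEquiv n h).injective h1
  exact congrArg Fin.val (Prod.ext_iff.1 this).1.symm

theorem level_injective (hn : ∀ k, 1 < n k) (j : ℕ) : Function.Injective (level n j) :=
  DirectLimit.mk_injective (f := embed n) (fun _ _ h => embed_injective hn h) j

/-- The image of stage `j` in the inductive limit. -/
noncomputable def stage (n : ℕ → ℕ) (j : ℕ) : Subgroup (LimitGroup n) := (level n j).range

noncomputable instance (j : ℕ) : Fintype (stage n j) :=
  @Fintype.ofFinite _ (Set.finite_range (level n j))

theorem level_mem_stage (j : ℕ) (σ : Equiv.Perm (Fin (N n j))) : level n j σ ∈ stage n j :=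
  ⟨σ, rfl⟩

theorem stage_mono : Monotone (stage n) := by
  rintro k j h _ ⟨σ, rfl⟩
  exact ⟨embed n k j h σ, level_embed h σ⟩

theorem exists_mem_stage (s : LimitGroup n) : ∃ j, s ∈ stage n j := by
  obtain ⟨j, h⟩ := exists_level s
  exact ⟨j, h j le_rfl⟩

theorem exists_subset_stage (S : Finset (LimitGroup n)) : ∃ j, ∀ s ∈ S, s ∈ stage n j := by
  choose f hf using exists_mem_stage (n := n)
  exact ⟨S.sup f, fun s hs => stage_mono (Finset.le_sup hs) (hf s)⟩

theorem exists_level_pair (s t : LimitGroup n) :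
    ∃ j₀, ∀ j, j₀ ≤ j → (∃ σ, level n j σ = s) ∧ ∃ τ, level n j τ = t := by
  obtain ⟨i, hi⟩ := exists_level s
  obtain ⟨k, hk⟩ := exists_level t
  exact ⟨max i k, fun j hj => ⟨hi j (le_of_max_le_left hj), hk j (le_of_max_le_right hj)⟩⟩

theorem two_pow_le_N (hn : ∀ k, 1 < n k) (j : ℕ) : 2 ^ j ≤ N n j := by
  calc 2 ^ j ≤ 2 ^ (j + 1) := Nat.pow_le_pow_right (by norm_num) (by omega)
    _ = ∏ _i ∈ Finset.range (j + 1), 2 := by simp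
    _ ≤ N n j := Finset.prod_le_prod' fun i _ => hn i

theorem tendsto_N (hn : ∀ k, 1 < n k) : Tendsto (N n) atTop atTop :=
  tendsto_atTop_mono (fun j => (Nat.lt_two_pow_self (n := j)).le.trans (two_pow_le_N hn j))
    tendsto_id

theorem N_mul_div {k j : ℕ} (h : k ≤ j) : N n k * (N n j / N n k) = N n j :=
  Nat.mul_div_cancel' (N_dvd n h)

theorem tendsto_N_div (hn : ∀ k, 1 < n k) (k : ℕ) :
    Tendsto (fun j => N n j / N n k) atTop atTop :=
  (Nat.tendsto_div_const_atTop (N_pos hn k).ne').comp (tendsto_N hn)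

/-! ### The measure of the support -/

/-- The proportion of points moved by an element of the inductive limit. -/
noncomputable def moved (hn : ∀ k, 1 < n k) (s : LimitGroup n) : ℝ := 1 - (chiNat n hn s).re

variable (hn : ∀ k, 1 < n k)

theorem chiNat_level (j : ℕ) (σ : Equiv.Perm (Fin (N n j))) :
    chiNat n hn (level n j σ) = 1 - (σ.support.card : ℂ) / (N n j : ℂ) := rfl

theorem moved_level (j : ℕ) (σ : Equiv.Perm (Fin (N n j))) :
    moved hn (level n j σ) = (σ.support.card : ℝ) / (N n j : ℝ) := by
  rw [moved, chiNat_level]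
  have : (1 - (σ.support.card : ℂ) / (N n j : ℂ)) =
      ((1 - (σ.support.card : ℝ) / (N n j : ℝ) : ℝ) : ℂ) := by push_cast; rfl
  rw [this, Complex.ofReal_re]
  ring

theorem chiNat_eq (s : LimitGroup n) : chiNat n hn s = ((1 - moved hn s : ℝ) : ℂ) := by
  obtain ⟨j, σ, rfl⟩ := exists_mem_stage s
  rw [moved_level, chiNat_level]
  push_cast
  rfl

theorem N_real_pos (hn : ∀ k, 1 < n k) (j : ℕ) : (0 : ℝ) < N n j := by
  exact_mod_cast N_pos hn j

theorem moved_nonneg (s : LimitGroup n) : 0 ≤ moved hn s := by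
  obtain ⟨j, σ, rfl⟩ := exists_mem_stage s
  rw [moved_level]
  positivity

theorem moved_le_one (s : LimitGroup n) : moved hn s ≤ 1 := by
  obtain ⟨j, σ, rfl⟩ := exists_mem_stage s
  rw [moved_level, div_le_one (N_real_pos hn j)]
  exact_mod_cast (Finset.card_le_univ _).trans_eq (Fintype.card_fin _)

theorem moved_one : moved hn 1 = 0 := by
  rw [← _root_.map_one (level n 0), moved_level]; simp

theorem moved_eq_zero_iff (s : LimitGroup n) : moved hn s = 0 ↔ s = 1 := by
  obtain ⟨j, σ, rfl⟩ := exists_mem_stage s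
  constructor
  · intro h
    rw [moved_level, div_eq_zero_iff] at h
    have h1 := h.resolve_right (N_real_pos hn j).ne'
    have : σ = 1 := by
      rw [← Equiv.Perm.support_eq_empty_iff, ← Finset.card_eq_zero]
      exact_mod_cast h1
    rw [this, map_one]
  · intro h
    rw [h, moved_one]

theorem moved_inv (s : LimitGroup n) : moved hn s⁻¹ = moved hn s := by
  obtain ⟨j, σ, rfl⟩ := exists_mem_stage s
  rw [← map_inv, moved_level, moved_level, Equiv.Perm.support_inv]

theorem moved_conj (t s : LimitGroup n) : moved hn (t * s * t⁻¹) = moved hn s := by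
  obtain ⟨j, hj⟩ := exists_level_pair s t
  obtain ⟨⟨σ, rfl⟩, ⟨τ, rfl⟩⟩ := hj j le_rfl
  rw [← map_inv, ← map_mul, ← map_mul, moved_level, moved_level, Equiv.Perm.card_support_conj]

theorem moved_mul_le (s t : LimitGroup n) : moved hn (s * t) ≤ moved hn s + moved hn t := by
  obtain ⟨j, hj⟩ := exists_level_pair s t
  obtain ⟨⟨σ, rfl⟩, ⟨τ, rfl⟩⟩ := hj j le_rfl
  rw [← map_mul, moved_level, moved_level, moved_level, ← add_div]
  have h : (σ * τ).support.card ≤ σ.support.card + τ.support.card :=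
    (Finset.card_le_card (Equiv.Perm.support_mul_le σ τ)).trans (Finset.card_union_le _ _)
  have : ((σ * τ).support.card : ℝ) ≤ σ.support.card + τ.support.card := by exact_mod_cast h
  gcongr

/-- Involutions moving the same proportion of points are conjugate. -/
theorem IsCharacter.eq_of_moved_eq {χ : LimitGroup n → ℂ} (hχ : IsCharacter χ)
    {s t : LimitGroup n} (hs : s * s = 1) (ht : t * t = 1) (h : moved hn s = moved hn t) :
    χ s = χ t := by
  obtain ⟨j, hj⟩ := exists_level_pair s t
  obtain ⟨⟨σ, rfl⟩, ⟨τ, rfl⟩⟩ := hj j le_rfl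
  rw [← map_mul, ← _root_.map_one (level n j)] at hs ht
  have hσ := level_injective hn j hs
  have hτ := level_injective hn j ht
  rw [moved_level, moved_level, div_left_inj' (N_real_pos hn j).ne'] at h
  have h' : σ.support.card = τ.support.card := by exact_mod_cast h
  have hct : ∀ ρ : Equiv.Perm (Fin (N n j)), ρ * ρ = 1 →
      ρ.cycleType = Multiset.replicate (ρ.support.card / 2) 2 := by
    intro ρ hρ
    have h2 : ρ.cycleType = Multiset.replicate ρ.cycleType.card 2 := by
      rw [Multiset.eq_replicate]
      refine ⟨rfl, fun m hm => ?_⟩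
      have h1 := Equiv.Perm.dvd_of_mem_cycleType hm
      have h3 : orderOf ρ ∣ 2 := orderOf_dvd_of_pow_eq_one (by rw [sq, hρ])
      have h4 := Equiv.Perm.two_le_of_mem_cycleType hm
      exact le_antisymm (Nat.le_of_dvd (by norm_num) (h1.trans h3)) h4
    have h5 := Equiv.Perm.sum_cycleType ρ
    rw [h2, Multiset.sum_replicate, smul_eq_mul] at h5
    rw [← h5, Nat.mul_div_cancel _ (by norm_num)]
    exact h2
  have hc : IsConj σ τ := by
    rw [Equiv.Perm.isConj_iff_cycleType_eq, hct σ hσ, hct τ hτ, h']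
  obtain ⟨c, hc⟩ := isConj_iff.1 hc
  rw [← hc, map_mul, map_mul, _root_.map_inv, hχ.conj_apply]

/-! ### The sign at infinity -/

omit hn in
-- A convergent sequence with values in the discrete closed set $\{1,-1\}$ is eventually equal to
-- its limit.
theorem exists_signAt_eq (k : ℕ) (σ : Equiv.Perm (Fin (N n k))) :
    (sgnInf n (level n k σ) = 1 ∨ sgnInf n (level n k σ) = -1) ∧
      ∀ᶠ j in atTop, signAt n k σ j = sgnInf n (level n k σ) := by
  have h : Tendsto (signAt n k σ) atTop (𝓝 (sgnInf n (level n k σ))) := tendsto_signAt n k σ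
  have hval : ∀ j, signAt n k σ j = 1 ∨ signAt n k σ j = -1 := by
    intro j
    rw [signAt]
    split_ifs with hkj
    · rcases Int.units_eq_one_or (Equiv.Perm.sign (embed n k j hkj σ)) with h | h <;> simp [h]
    · simp
  have hev : ∀ᶠ j in atTop, dist (signAt n k σ j) (sgnInf n (level n k σ)) < 1 :=
    h.eventually (Metric.ball_mem_nhds _ one_pos)
  have hmem : sgnInf n (level n k σ) ∈ ({1, -1} : Set ℂ) := by
    refine IsClosed.mem_of_tendsto (Set.toFinite _).isClosed h (Eventually.of_forall fun j => ?_)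
    simpa using hval j
  have hmem' : sgnInf n (level n k σ) = 1 ∨ sgnInf n (level n k σ) = -1 := by simpa using hmem
  refine ⟨hmem', hev.mono fun j hj => ?_⟩
  rcases hmem' with h1 | h1 <;> rcases hval j with h2 | h2 <;> rw [h1, h2] at hj ⊢ <;>
    norm_num [dist_eq_norm] at hj

omit hn in
theorem sgnInf_eq_one_or (s : LimitGroup n) : sgnInf n s = 1 ∨ sgnInf n s = -1 := by
  obtain ⟨j, σ, rfl⟩ := exists_mem_stage s
  exact (exists_signAt_eq j σ).1

theorem eventually_sign_eq (hn : ∀ k, 1 < n k) (s : LimitGroup n) :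
    ∀ᶠ j in atTop, ∀ σ, level n j σ = s →
    (((Equiv.Perm.sign σ : ℤ)) : ℂ) = sgnInf n s := by
  obtain ⟨k, σ, rfl⟩ := exists_mem_stage s
  filter_upwards [(exists_signAt_eq k σ).2, eventually_ge_atTop k] with j hj hkj τ hτ
  rw [← hj, signAt, dif_pos hkj]
  rw [← level_embed hkj] at hτ
  rw [level_injective hn j hτ]

theorem sgnInf_mul (hn : ∀ k, 1 < n k) (s t : LimitGroup n) :
    sgnInf n (s * t) = sgnInf n s * sgnInf n t := by
  obtain ⟨k, hk⟩ := exists_level_pair s t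
  obtain ⟨j, hj⟩ := ((eventually_sign_eq hn s).and ((eventually_sign_eq hn t).and
    ((eventually_sign_eq hn (s * t)).and (eventually_ge_atTop k)))).exists
  obtain ⟨h1, h2, h3, hkj⟩ := hj
  obtain ⟨⟨σ, rfl⟩, ⟨τ, rfl⟩⟩ := hk j hkj
  rw [← h1 σ rfl, ← h2 τ rfl, ← h3 (σ * τ) (by rw [map_mul])]
  simp

theorem sgnInf_one (hn : ∀ k, 1 < n k) : sgnInf n 1 = 1 := by
  have h := sgnInf_mul hn (n := n) 1 1
  rcases sgnInf_eq_one_or (n := n) 1 with h1 | h1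
  · exact h1
  · rw [mul_one, h1] at h; norm_num at h

theorem sgnInf_mul_self (s : LimitGroup n) : sgnInf n s * sgnInf n s = 1 := by
  rcases sgnInf_eq_one_or s with h | h <;> rw [h] <;> norm_num

theorem sgnInf_inv (hn : ∀ k, 1 < n k) (s : LimitGroup n) : sgnInf n s⁻¹ = sgnInf n s := by
  have h := sgnInf_mul hn s⁻¹ s
  rw [inv_mul_cancel, sgnInf_one hn] at h
  linear_combination -(sgnInf n s) * h - (sgnInf n s⁻¹) * sgnInf_mul_self s

theorem sgnInf_conj (hn : ∀ k, 1 < n k) (t s : LimitGroup n) :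
    sgnInf n (t * s * t⁻¹) = sgnInf n s := by
  rw [sgnInf_mul hn, sgnInf_mul hn, sgnInf_inv hn]
  linear_combination (sgnInf n s) * sgnInf_mul_self t

theorem sgnInf_level_of_sign_eq_one (j : ℕ) {σ : Equiv.Perm (Fin (N n j))}
    (h : Equiv.Perm.sign σ = 1) : sgnInf n (level n j σ) = 1 := by
  obtain ⟨i, h1, h2⟩ := ((exists_signAt_eq j σ).2.and (eventually_ge_atTop j)).exists
  rw [← h1, signAt, dif_pos h2, sign_embed, h]
  simp

theorem starRingEnd_sgnInf (s : LimitGroup n) : starRingEnd ℂ (sgnInf n s) = sgnInf n s := by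
  rcases sgnInf_eq_one_or s with h | h <;> rw [h] <;> simp

end SymLimit

namespace SymLimit

variable {n : ℕ → ℕ}

/-! ### The functions in `exChar` are characters -/

theorem isPosDef_one (G : Type*) [Group G] : IsPosDef fun _ : G => (1 : ℂ) := by
  intro S c
  have : ∑ g ∈ S, ∑ h ∈ S, starRingEnd ℂ (c g) * c h * 1 =
      starRingEnd ℂ (∑ g ∈ S, c g) * ∑ g ∈ S, c g := by
    rw [map_sum, Finset.sum_mul_sum]
    simp
  rw [this]
  exact star_mul_self_nonneg _

theorem IsPosDef.sgnInf_mul (hn : ∀ k, 1 < n k) {φ : LimitGroup n → ℂ} (hφ : IsPosDef φ) :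
    IsPosDef fun s => sgnInf n s * φ s := by
  intro S c
  have h := hφ S fun s => sgnInf n s * c s
  refine h.trans_eq (Finset.sum_congr rfl fun g _ => Finset.sum_congr rfl fun k _ => ?_)
  beta_reduce
  rw [SymLimit.sgnInf_mul hn, sgnInf_inv hn, map_mul, starRingEnd_sgnInf]
  ring

/-- The number of fixed points of $\sigma^{-1}\tau$ is the Hilbert–Schmidt inner product of the
permutation matrices of $\sigma$ and $\tau$. -/
theorem card_support_inv_mul {α : Type*} [Fintype α] [DecidableEq α] (σ τ : Equiv.Perm α) :
    (Fintype.card α : ℂ) - ((σ⁻¹ * τ).support.card : ℂ) =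
      ∑ x, ∑ y, (if σ x = y then 1 else 0) * (if τ x = y then 1 else 0) := by
  have h1 : ∀ x, ∑ y, (if σ x = y then (1 : ℂ) else 0) * (if τ x = y then 1 else 0) =
      if (σ⁻¹ * τ) x ≠ x then 0 else 1 := by
    intro x
    simp only [ite_mul, one_mul, zero_mul, Finset.sum_ite_eq, Finset.mem_univ, if_true]
    have : (σ⁻¹ * τ) x ≠ x ↔ ¬ τ x = σ x := by
      rw [Equiv.Perm.mul_apply, Ne, Equiv.Perm.inv_eq_iff_eq]
    by_cases h : τ x = σ x
    · rw [if_neg (fun h' => this.1 h' h), if_pos h]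
    · rw [if_pos (this.2 h), if_neg h]
  simp only [h1]
  rw [Finset.sum_ite]
  have h2 := Finset.card_filter_add_card_filter_not (s := Finset.univ)
    (fun x => (σ⁻¹ * τ) x ≠ x)
  rw [Finset.card_univ] at h2
  have h3 : (σ⁻¹ * τ).support = Finset.univ.filter fun x => (σ⁻¹ * τ) x ≠ x := by
    
    ext x; rw [Equiv.Perm.mem_support, Finset.mem_filter]; simp only [Finset.mem_univ, true_and]
  rw [h3, ← h2]
  push_cast
  simp

/-- Schur's product theorem: at a stage containing all of $S$, $\chi_{\rm nat}$ is a normalized Gram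
kernel of permutation matrices, and each matrix entry can be absorbed into the coefficients of the
form of $\varphi$. -/
theorem IsPosDef.chiNat_mul (hn : ∀ k, 1 < n k) {φ : LimitGroup n → ℂ} (hφ : IsPosDef φ) :
    IsPosDef fun s => chiNat n hn s * φ s := by
  classical
  intro S c
  obtain ⟨j, hj⟩ := exists_subset_stage S
  choose f hf using hj
  let F : LimitGroup n → Equiv.Perm (Fin (N n j)) := fun s => if h : s ∈ S then f s h else 1
  have hF : ∀ s ∈ S, level n j (F s) = s := fun s hs => by simp only [F, dif_pos hs, hf]
  have hN : (N n j : ℂ) ≠ 0 := by exact_mod_cast (N_pos hn j).ne'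
  have key : ∀ g ∈ S, ∀ h ∈ S, chiNat n hn (g⁻¹ * h) = (N n j : ℂ)⁻¹ *
      ∑ x, ∑ y, (if F g x = y then 1 else 0) * (if F h x = y then 1 else 0) := by
    intro g hg h hh
    rw [← card_support_inv_mul, Fintype.card_fin]
    conv_lhs => rw [← hF g hg, ← hF h hh, ← _root_.map_inv, ← map_mul, chiNat_level]
    field_simp
  have tot : ∑ g ∈ S, ∑ h ∈ S, starRingEnd ℂ (c g) * c h * (chiNat n hn (g⁻¹ * h) * φ (g⁻¹ * h)) =
      (N n j : ℂ)⁻¹ * ∑ x, ∑ y, ∑ g ∈ S, ∑ h ∈ S,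
        starRingEnd ℂ ((if F g x = y then 1 else 0) * c g) *
          ((if F h x = y then 1 else 0) * c h) * φ (g⁻¹ * h) := by
    have e1 : ∀ g ∈ S, ∀ h ∈ S,
        starRingEnd ℂ (c g) * c h * (chiNat n hn (g⁻¹ * h) * φ (g⁻¹ * h)) =
        ∑ x, ∑ y, (N n j : ℂ)⁻¹ * (starRingEnd ℂ ((if F g x = y then 1 else 0) * c g) *
          ((if F h x = y then 1 else 0) * c h) * φ (g⁻¹ * h)) := by
      intro g hg h hh
      rw [key g hg h hh]
      simp only [Finset.mul_sum, Finset.sum_mul]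
      refine Finset.sum_congr rfl fun x _ => Finset.sum_congr rfl fun y _ => ?_
      split_ifs <;> simp
      ring
    rw [Finset.sum_congr rfl fun g hg => Finset.sum_congr rfl fun h hh => e1 g hg h hh]
    simp only [← Finset.mul_sum]
    congr 1
    rw [Finset.sum_congr rfl fun g _ => Finset.sum_comm, Finset.sum_comm]
    refine Finset.sum_congr rfl fun x _ => ?_
    rw [Finset.sum_congr rfl fun g _ => Finset.sum_comm, Finset.sum_comm]
  rw [tot]
  refine mul_nonneg ?_ (Finset.sum_nonneg fun x _ => Finset.sum_nonneg fun y _ => hφ S _)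
  rw [← Complex.ofReal_natCast, ← Complex.ofReal_inv, Complex.zero_le_real]
  positivity

theorem isPosDef_chiNat_pow (hn : ∀ k, 1 < n k) (p : ℕ) :
    IsPosDef fun s => chiNat n hn s ^ p := by
  induction p with
  | zero => simpa using isPosDef_one (LimitGroup n)
  | succ p ih =>
    simp only [pow_succ']
    exact ih.chiNat_mul hn

theorem central_of_conj {G : Type*} [Group G] {φ : G → ℂ} (h : ∀ t s, φ (t * s * t⁻¹) = φ s)
    (g k : G) : φ (g * k) = φ (k * g) := by
  rw [← h k (g * k)]
  congr 1
  group

theorem chiNat_conj (hn : ∀ k, 1 < n k) (t s : LimitGroup n) :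
    chiNat n hn (t * s * t⁻¹) = chiNat n hn s := by
  rw [chiNat_eq, chiNat_eq, moved_conj]

theorem chiNat_one (hn : ∀ k, 1 < n k) : chiNat n hn 1 = 1 := by
  rw [chiNat_eq, moved_one]; simp

theorem isCharacter_chiNat_pow (hn : ∀ k, 1 < n k) (p : ℕ) :
    IsCharacter fun s => chiNat n hn s ^ p :=
  ⟨isPosDef_chiNat_pow hn p, central_of_conj (φ := fun s => chiNat n hn s ^ p) fun t s => by
    simp only [chiNat_conj],
    by simp [chiNat_one]⟩

theorem IsCharacter.sgnInf_mul (hn : ∀ k, 1 < n k) {χ : LimitGroup n → ℂ} (hχ : IsCharacter χ) :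
    IsCharacter fun s => sgnInf n s * χ s :=
  ⟨IsPosDef.sgnInf_mul hn hχ.posDef,
    central_of_conj (φ := fun s => sgnInf n s * χ s) fun t s => by
      simp only [sgnInf_conj hn, hχ.conj_apply],
    by rw [sgnInf_one hn, hχ.map_one, one_mul]⟩

theorem isCharacter_chiReg : IsCharacter (chiReg n) := by
  classical
  refine ⟨fun S c => ?_, central_of_conj fun t s => ?_, by simp [chiReg]⟩
  · refine Finset.sum_nonneg fun g hg => ?_
    have h1 : ∀ h ∈ S, starRingEnd ℂ (c g) * c h * chiReg n (g⁻¹ * h) =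
        if g = h then starRingEnd ℂ (c g) * c h else 0 := by
      intro h _
      simp only [chiReg, inv_mul_eq_one]
      split_ifs <;> simp
    rw [Finset.sum_congr rfl h1, Finset.sum_ite_eq, if_pos hg]
    exact star_mul_self_nonneg _
  · simp only [chiReg, conj_eq_one_iff]

theorem isCharacter_of_mem_exChar (hn : ∀ k, 1 < n k) {χ : LimitGroup n → ℂ}
    (h : χ ∈ exChar n hn) : IsCharacter χ := by
  rcases h with (⟨p, rfl⟩ | ⟨p, rfl⟩) | h
  · exact isCharacter_chiNat_pow hn p
  · exact (isCharacter_chiNat_pow hn p).sgnInf_mul hn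
  · rw [Set.mem_singleton_iff.1 h]
    exact isCharacter_chiReg

/-! ### Block permutations -/

theorem viaEmbedding_support {α β : Type*} [Fintype α] [DecidableEq α] [Fintype β] [DecidableEq β]
    (σ : Equiv.Perm α) (f : α ↪ β) : (σ.viaEmbedding f).support = σ.support.map f := by
  ext y
  rw [Equiv.Perm.mem_support, Finset.mem_map]
  by_cases hy : y ∈ Set.range f
  · obtain ⟨x, rfl⟩ := hy
    rw [Equiv.Perm.viaEmbedding_apply]
    simp
  · rw [Equiv.Perm.viaEmbedding_apply_of_notMem _ _ _ hy]
    simp only [ne_eq, not_true_eq_false, false_iff]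
    rintro ⟨x, -, rfl⟩
    exact hy ⟨x, rfl⟩

theorem card_support_permCongr {α β : Type*} [Fintype α] [DecidableEq α] [Fintype β]
    [DecidableEq β] (e : α ≃ β) (σ : Equiv.Perm α) :
    (e.permCongr σ).support.card = σ.support.card := by
  have : (e.permCongr σ).support = σ.support.map e.toEmbedding := by
    ext y
    obtain ⟨x, rfl⟩ := e.surjective y
    simp [Equiv.permCongr_apply]
  rw [this, Finset.card_map]

/-- Permutations of `X_{N_k} × X_{N_j / N_k}` as elements of the inductive limit. -/
noncomputable def blockLevel (n : ℕ → ℕ) {k j : ℕ} (h : k ≤ j) :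
    Equiv.Perm (Fin (N n k) × Fin (N n j / N n k)) →* LimitGroup n :=
  (level n j).comp (stageEquiv n h).permCongrHom.toMonoidHom

theorem blockLevel_apply {k j : ℕ} (h : k ≤ j)
    (σ : Equiv.Perm (Fin (N n k) × Fin (N n j / N n k))) :
    blockLevel n h σ = level n j ((stageEquiv n h).permCongr σ) := rfl

theorem blockLevel_prodCongr {k j : ℕ} (h : k ≤ j) (σ : Equiv.Perm (Fin (N n k))) :
    blockLevel n h (Equiv.prodCongr σ (Equiv.refl _)) = level n k σ := by
  rw [← level_embed h]; rfl

theorem moved_blockLevel (hn : ∀ k, 1 < n k) {k j : ℕ} (h : k ≤ j)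
    (σ : Equiv.Perm (Fin (N n k) × Fin (N n j / N n k))) :
    moved hn (blockLevel n h σ) = (σ.support.card : ℝ) / N n j := by
  rw [blockLevel_apply, moved_level, card_support_permCongr]

/-! ### Mixing conjugates -/

/-- The exchange of the first coordinate with the `i`-th entry of the last one. -/
def swapAt {X B ι : Type*} [DecidableEq ι] (i : ι) : Equiv.Perm (X × (B × (ι → X))) where
  toFun p := (p.2.2 i, p.2.1, Function.update p.2.2 i p.1)
  invFun p := (p.2.2 i, p.2.1, Function.update p.2.2 i p.1)
  left_inv p := by simp
  right_inv p := by simp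

theorem card_filter_pair {X ι : Type*} [Fintype X] [Fintype ι] [DecidableEq ι] (P : X → Prop)
    [DecidablePred P] [Nonempty X] {i l : ι} (hil : i ≠ l) :
    ((Finset.univ.filter fun z : ι → X => P (z i) ∧ P (z l)).card : ℝ) =
      (((Finset.univ.filter P).card : ℝ) / Fintype.card X) ^ 2 *
        (Fintype.card X : ℝ) ^ Fintype.card ι := by
  have hX : (Fintype.card X : ℝ) ≠ 0 := by exact_mod_cast Fintype.card_ne_zero
  have h1 : (Finset.univ.filter fun z : ι → X => P (z i) ∧ P (z l)) =
      Fintype.piFinset fun m => if m = i ∨ m = l then Finset.univ.filter P else Finset.univ := by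
    ext z
    simp only [Finset.mem_filter, Finset.mem_univ, true_and, Fintype.mem_piFinset]
    constructor
    · rintro ⟨h1, h2⟩ m
      split_ifs with hm
      · rcases hm with rfl | rfl <;> simpa
      · simp
    · intro h
      have h1 := h i
      have h2 := h l
      simp at h1 h2
      exact ⟨h1, h2⟩
  rw [h1, Fintype.card_piFinset]
  push_cast
  have h2 : ∏ m : ι, (((if m = i ∨ m = l then Finset.univ.filter P else Finset.univ).card : ℝ) /
      Fintype.card X) = (((Finset.univ.filter P).card : ℝ) / Fintype.card X) ^ 2 := by
    rw [Finset.prod_eq_mul i l hil]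
    · simp [sq]
    · rintro m - ⟨hm1, hm2⟩
      rw [if_neg (by tauto), Finset.card_univ, div_self hX]
    · simp
    · simp
  rw [← h2, Finset.prod_div_distrib, Finset.prod_const, Finset.card_univ]
  field_simp

section Mixing

variable {X Y B ι : Type*} [DecidableEq ι] (e : B × (ι → X) ↪ Y) (g : Equiv.Perm X)

/-- The permutation `g` on the first coordinate, transported to the `i`-th coordinate of the
blocks given by `e`. -/
noncomputable def mixConj (i : ι) : Equiv.Perm (X × Y) :=
  (swapAt i).viaEmbedding ((Function.Embedding.refl X).prodMap e) *
    Equiv.prodCongr g (Equiv.refl Y) *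
      ((swapAt i).viaEmbedding ((Function.Embedding.refl X).prodMap e))⁻¹

theorem mixConj_apply_block (i : ι) (x : X) (b : B) (z : ι → X) :
    mixConj e g i (x, e (b, z)) = (x, e (b, Function.update z i (g (z i)))) := by
  set f := (Function.Embedding.refl X).prodMap e with hf
  have h1 : ((swapAt i).viaEmbedding f)⁻¹ (x, e (b, z)) =
      (z i, e (b, Function.update z i x)) := by
    have h0 : (x, e (b, z)) = (swapAt i).viaEmbedding f (f (z i, b, Function.update z i x)) := by
      rw [Equiv.Perm.viaEmbedding_apply]
      simp [hf, swapAt]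
    rw [Equiv.Perm.inv_eq_iff_eq]
    exact h0
  have h2 : (swapAt i).viaEmbedding f (g (z i), e (b, Function.update z i x)) =
      (x, e (b, Function.update z i (g (z i)))) := by
    have h0 : (g (z i), e (b, Function.update z i x)) = f (g (z i), b, Function.update z i x) := rfl
    rw [h0, Equiv.Perm.viaEmbedding_apply]
    simp [hf, swapAt]
  rw [mixConj, Equiv.Perm.mul_apply, Equiv.Perm.mul_apply, ← hf, h1, ← h2]
  rfl

theorem mixConj_apply_of_notMem (i : ι) (x : X) {y : Y} (hy : y ∉ Set.range e) :
    mixConj e g i (x, y) = (g x, y) := by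
  set f := (Function.Embedding.refl X).prodMap e with hf
  have h0 : ∀ x', (x', y) ∉ Set.range f := by
    rintro x' ⟨p, hp⟩
    exact hy ⟨p.2, congrArg Prod.snd hp⟩
  have h1 : ((swapAt i).viaEmbedding f)⁻¹ (x, y) = (x, y) := by
    rw [Equiv.Perm.inv_eq_iff_eq, Equiv.Perm.viaEmbedding_apply_of_notMem _ _ _ (h0 x)]
  rw [mixConj, Equiv.Perm.mul_apply, Equiv.Perm.mul_apply, ← hf, h1]
  exact Equiv.Perm.viaEmbedding_apply_of_notMem _ _ _ (h0 (g x))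

theorem update_eq_update_iff {i l : ι} (hil : i ≠ l) (z : ι → X) (a b : X) :
    Function.update z l b = Function.update z i a ↔ a = z i ∧ b = z l := by
  constructor
  · intro h
    have h1 := congrFun h i
    have h2 := congrFun h l
    simp [hil, hil.symm] at h1 h2
    exact ⟨h1.symm, h2⟩
  · rintro ⟨rfl, rfl⟩
    simp

/-- Outside the blocks both conjugates act as $g$ on the first coordinate and cancel. Inside, they
alter the different entries $z_i$ and $z_l$, so they agree exactly where $g$ fixes both, which are
independent events. -/
theorem card_support_mixConj [Fintype X] [DecidableEq X] [Nonempty X] [Fintype Y] [DecidableEq Y]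
    [Fintype B] [Fintype ι] {i l : ι} (hil : i ≠ l) :
    (((mixConj e g i)⁻¹ * mixConj e g l).support.card : ℝ) =
      Fintype.card X * (Fintype.card B * (Fintype.card X : ℝ) ^ Fintype.card ι *
        (1 - (1 - (g.support.card : ℝ) / Fintype.card X) ^ 2)) := by
  classical
  have hsupp : ((mixConj e g i)⁻¹ * mixConj e g l).support =
      ((Finset.univ : Finset X) ×ˢ ((Finset.univ : Finset B) ×ˢ
        Finset.univ.filter fun z : ι → X => ¬ (g (z i) = z i ∧ g (z l) = z l))).map
          ((Function.Embedding.refl X).prodMap e) := by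
    ext ⟨x, y⟩
    rw [Equiv.Perm.mem_support, Equiv.Perm.mul_apply, Ne, Equiv.Perm.inv_eq_iff_eq,
      Finset.mem_map]
    by_cases hy : y ∈ Set.range e
    · obtain ⟨⟨b, z⟩, rfl⟩ := hy
      rw [mixConj_apply_block, mixConj_apply_block]
      constructor
      · intro h
        refine ⟨(x, b, z), ?_, rfl⟩
        simp only [Finset.mem_product, Finset.mem_univ, Finset.mem_filter, true_and]
        intro h'
        refine h ?_
        rw [(update_eq_update_iff hil z _ _).2 h']
      · rintro ⟨⟨x', b', z'⟩, h1, h2⟩ h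
        have h3 : x' = x ∧ e (b', z') = e (b, z) := Prod.ext_iff.1 h2
        have h4 := e.injective h3.2
        have h5 : z' = z := (Prod.ext_iff.1 h4).2
        subst h5
        simp only [Finset.mem_product, Finset.mem_univ, Finset.mem_filter, true_and] at h1
        refine h1 ((update_eq_update_iff hil z' _ _).1 ?_)
        exact (Prod.ext_iff.1 (e.injective (Prod.ext_iff.1 h).2)).2
    · rw [mixConj_apply_of_notMem _ _ _ _ hy, mixConj_apply_of_notMem _ _ _ _ hy]
      simp only [not_true_eq_false, false_iff]
      rintro ⟨p, -, hp⟩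
      exact hy ⟨p.2, congrArg Prod.snd hp⟩
  rw [hsupp, Finset.card_map, Finset.card_product, Finset.card_product]
  push_cast
  rw [Finset.card_univ, Finset.card_univ]
  have h1 := Finset.card_filter_add_card_filter_not (s := (Finset.univ : Finset (ι → X)))
    (fun z : ι → X => g (z i) = z i ∧ g (z l) = z l)
  have h2 := card_filter_pair (fun x => g x = x) hil
  have h3 := Finset.card_filter_add_card_filter_not (s := (Finset.univ : Finset X))
    (fun x => g x = x)
  have h4 : g.support = Finset.univ.filter fun x => ¬ g x = x := by ext x; simp
  rw [← h4, Finset.card_univ] at h3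
  rw [Finset.card_univ, Fintype.card_fun] at h1
  have hX : (Fintype.card X : ℝ) ≠ 0 := by exact_mod_cast Fintype.card_ne_zero
  have h1' : ((Finset.univ.filter fun z : ι → X => ¬ (g (z i) = z i ∧ g (z l) = z l)).card : ℝ) =
      (Fintype.card X : ℝ) ^ Fintype.card ι -
        (Finset.univ.filter fun z : ι → X => g (z i) = z i ∧ g (z l) = z l).card := by
    rw [eq_sub_iff_add_eq, add_comm]
    exact_mod_cast h1
  have h3' : ((Finset.univ.filter fun x => g x = x).card : ℝ) =
      Fintype.card X - g.support.card := by
    rw [eq_sub_iff_add_eq]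
    exact_mod_cast h3
  rw [h1', h2, h3', sub_div, div_self hX]
  ring

end Mixing

/-- Conjugates of `g` that are asymptotically independent. -/
theorem exists_mixing (hn : ∀ k, 1 < n k) (g : LimitGroup n) (m : ℕ) {ε : ℝ} (hε : 0 < ε) :
    ∃ (t : Fin m → LimitGroup n) (r : ℝ), 0 < r ∧ r ≤ 1 ∧ 1 - r ≤ ε ∧ ∀ i l, i ≠ l →
      moved hn ((t i * g * (t i)⁻¹)⁻¹ * (t l * g * (t l)⁻¹)) =
        r * (1 - (1 - moved hn g) ^ 2) := by
  obtain ⟨k, σ, rfl⟩ := exists_mem_stage g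
  set M := N n k ^ m with hM
  have hMpos : 0 < M := pow_pos (N_pos hn k) m
  obtain ⟨L, hL⟩ := exists_nat_gt ((M : ℝ) / ε)
  obtain ⟨j, hj1, hj2⟩ := (((tendsto_N_div hn k).eventually_ge_atTop (max L M)).and
    (eventually_ge_atTop k)).exists
  set y := N n j / N n k with hy
  have hyM : M ≤ y := (le_max_right _ _).trans hj1
  have hyL : L ≤ y := (le_max_left _ _).trans hj1
  -- `Q` disjoint blocks, each indexed by all $M=N_k^m$ words of length $m$, are packed into the
  -- fibre of size `y`. They cover the proportion $r=QM/y$, and $y\ge L>M/\varepsilon$ makes the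
  -- remainder at most $\varepsilon$.
  set Q := y / M with hQ
  have hQpos : 0 < Q := Nat.div_pos hyM hMpos
  have hypos : 0 < y := hMpos.trans_le hyM
  have hcard : Fintype.card (Fin Q × (Fin m → Fin (N n k))) ≤ Fintype.card (Fin y) := by
    simp only [Fintype.card_prod, Fintype.card_fin, Fintype.card_fun]
    exact Nat.div_mul_le_self y M
  obtain ⟨e⟩ := Function.Embedding.nonempty_of_card_le hcard
  have : Nonempty (Fin (N n k)) := ⟨⟨0, N_pos hn k⟩⟩
  have hyr : (0 : ℝ) < y := by exact_mod_cast hypos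
  have hMr : (0 : ℝ) < M := by exact_mod_cast hMpos
  have hQr : (0 : ℝ) < Q := by exact_mod_cast hQpos
  have hNk := N_real_pos hn k
  refine ⟨fun i => blockLevel n hj2
    ((swapAt i).viaEmbedding ((Function.Embedding.refl _).prodMap e)), (Q * M : ℝ) / y,
    by positivity,
    ?_, ?_, fun i l hil => ?_⟩
  · rw [div_le_one hyr]
    exact_mod_cast Nat.div_mul_le_self y M
  · have h1 : (y : ℝ) ≤ Q * M + M := by
      have := Nat.lt_div_mul_add hMpos (a := y)
      exact_mod_cast this.le
    have h2 : (M : ℝ) / ε ≤ y := hL.le.trans (by exact_mod_cast hyL)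
    rw [div_le_iff₀ hε] at h2
    rw [sub_le_comm, le_div_iff₀ hyr]
    nlinarith
  · rw [← blockLevel_prodCongr hj2]
    have : ∀ i, blockLevel n hj2
        ((swapAt i).viaEmbedding ((Function.Embedding.refl _).prodMap e)) *
        blockLevel n hj2 (Equiv.prodCongr σ (Equiv.refl _)) * (blockLevel n hj2
        ((swapAt i).viaEmbedding ((Function.Embedding.refl _).prodMap e)))⁻¹ =
        blockLevel n hj2 (mixConj e σ i) := by
      intro i
      rw [mixConj, map_mul, map_mul, map_inv]
    rw [this, this, ← map_inv, ← map_mul, moved_blockLevel, card_support_mixConj e σ hil,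
      blockLevel_prodCongr, moved_level, Fintype.card_fin, Fintype.card_fin, Fintype.card_fin,
      ← N_mul_div (n := n) hj2, ← hy]
    push_cast
    rw [hM]
    push_cast
    field_simp

/-! ### The functions in `exChar` are extreme and indecomposable -/

/-- Only the $m$ diagonal terms of the $m^2$ in the double mean are uncontrolled, and each deviates
from $\chi(g^{-1})\chi(g)$ by at most 2. For $m>4/\varepsilon$ they contribute less than
$\varepsilon/2$. -/
theorem hasScalarMeans_of_pairs {G : Type*} [Group G] {χ : G → ℂ} (hχ : IsCharacter χ)
    (h : ∀ (g : G) (m : ℕ) (ε : ℝ), 0 < ε → ∃ t : Fin m → G, ∀ i l, i ≠ l →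
      ‖χ ((t i * g * (t i)⁻¹)⁻¹ * (t l * g * (t l)⁻¹)) - χ g⁻¹ * χ g‖ ≤ ε) :
    HasScalarMeans χ := by
  intro g ε hε
  obtain ⟨m, hm⟩ := exists_nat_gt (4 / ε)
  have hmr : (0 : ℝ) < m := (by positivity : 0 < 4 / ε).trans hm
  have hmpos : 0 < m := by exact_mod_cast hmr
  obtain ⟨t, ht⟩ := h g m (ε / 2) (by positivity)
  refine ⟨m, t, hmpos, ?_⟩
  have hm0 : (m : ℂ) ≠ 0 := by exact_mod_cast hmpos.ne'
  have e : conjGram χ g t - χ g⁻¹ * χ g = (m : ℂ)⁻¹ * (m : ℂ)⁻¹ *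
      ∑ i, ∑ l, (χ ((t i * g * (t i)⁻¹)⁻¹ * (t l * g * (t l)⁻¹)) - χ g⁻¹ * χ g) := by
    simp only [conjGram, Finset.sum_sub_distrib, Finset.sum_const, Finset.card_univ,
      Fintype.card_fin, nsmul_eq_mul]
    field_simp
  have hb : ∀ i l, ‖χ ((t i * g * (t i)⁻¹)⁻¹ * (t l * g * (t l)⁻¹)) - χ g⁻¹ * χ g‖ ≤
      (if i = l then 2 else 0) + ε / 2 := by
    intro i l
    split_ifs with hil
    · have h1 := norm_sub_le (χ ((t i * g * (t i)⁻¹)⁻¹ * (t l * g * (t l)⁻¹))) (χ g⁻¹ * χ g)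
      have h2 := hχ.norm_le_one ((t i * g * (t i)⁻¹)⁻¹ * (t l * g * (t l)⁻¹))
      have h3 : ‖χ g⁻¹ * χ g‖ ≤ 1 := by
        rw [norm_mul]
        exact mul_le_one₀ (hχ.norm_le_one _) (norm_nonneg _) (hχ.norm_le_one _)
      linarith
    · rw [zero_add]
      exact ht i l hil
  have hsum : ‖∑ i, ∑ l, (χ ((t i * g * (t i)⁻¹)⁻¹ * (t l * g * (t l)⁻¹)) - χ g⁻¹ * χ g)‖ ≤
      m * 2 + m * (m * (ε / 2)) := by
    refine (norm_sum_le_of_le _ fun i _ => norm_sum_le_of_le _ fun l _ => hb i l).trans_eq ?_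
    simp [Finset.sum_add_distrib]
  rw [e, norm_mul, norm_mul, norm_inv, Complex.norm_natCast]
  calc (m : ℝ)⁻¹ * (m : ℝ)⁻¹ * _ ≤ (m : ℝ)⁻¹ * (m : ℝ)⁻¹ * (m * 2 + m * (m * (ε / 2))) :=
        mul_le_mul_of_nonneg_left hsum (by positivity)
    _ = 2 / m + ε / 2 := by field_simp
    _ ≤ ε := by
        have : 2 / (m : ℝ) ≤ ε / 2 := by
          rw [div_lt_iff₀ hε] at hm
          rw [div_le_iff₀ hmr]
          linarith
        linarith

theorem hasScalarMeans_chiNat_pow (hn : ∀ k, 1 < n k) (p : ℕ) :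
    HasScalarMeans fun s => chiNat n hn s ^ p := by
  refine hasScalarMeans_of_pairs (isCharacter_chiNat_pow hn p) fun g m ε hε => ?_
  set a := (1 - moved hn g) ^ 2 with ha
  have hcont : ContinuousAt (fun r : ℝ => (1 - r * (1 - a)) ^ p) 1 := by fun_prop
  obtain ⟨δ, hδ, hd⟩ := Metric.continuousAt_iff.1 hcont ε hε
  obtain ⟨t, r, hr0, hr1, hr, ht⟩ := exists_mixing hn g m (half_pos hδ)
  refine ⟨t, fun i l hil => ?_⟩
  have h1 := hd (x := r) (by rw [Real.dist_eq, abs_sub_comm, abs_of_nonneg (by linarith)]; linarith)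
  simp only [chiNat_eq, ht i l hil, moved_inv, ← ha]
  rw [Real.dist_eq] at h1
  rw [← Complex.ofReal_pow, ← Complex.ofReal_pow, ← Complex.ofReal_mul, ← Complex.ofReal_sub,
    Complex.norm_real, Real.norm_eq_abs]
  refine le_trans (le_of_eq ?_) h1.le
  congr 2
  rw [← mul_pow, one_mul, ha]
  ring

theorem HasScalarMeans.sgnInf_mul (hn : ∀ k, 1 < n k) {χ : LimitGroup n → ℂ}
    (h : HasScalarMeans χ) : HasScalarMeans fun s => sgnInf n s * χ s := by
  intro g ε hε
  obtain ⟨m, t, hm, ht⟩ := h g ε hε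
  refine ⟨m, t, hm, ?_⟩
  have e1 : conjGram (fun s => sgnInf n s * χ s) g t = conjGram χ g t := by
    simp only [conjGram, SymLimit.sgnInf_mul hn ((_ : LimitGroup n)⁻¹), sgnInf_inv hn,
      sgnInf_conj hn, sgnInf_mul_self, one_mul]
  have e2 : sgnInf n g⁻¹ * χ g⁻¹ * (sgnInf n g * χ g) = χ g⁻¹ * χ g := by
    rw [sgnInf_inv hn]
    linear_combination (χ g⁻¹ * χ g) * sgnInf_mul_self g
  rw [e1, e2]
  exact ht

theorem hasScalarMeans_chiReg (hn : ∀ k, 1 < n k) : HasScalarMeans (chiReg n) := by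
  refine hasScalarMeans_of_pairs isCharacter_chiReg fun g m ε hε => ?_
  -- Only $r>0$ matters: it makes the conjugates of a nontrivial element pairwise distinct, so the
  -- regular character vanishes exactly on their quotients.
  obtain ⟨t, r, hr0, hr1, -, ht⟩ := exists_mixing hn g m one_pos
  refine ⟨t, fun i l hil => ?_⟩
  rcases eq_or_ne g 1 with rfl | hg
  · simp [chiReg, hε.le]
  · have h1 : (t i * g * (t i)⁻¹)⁻¹ * (t l * g * (t l)⁻¹) ≠ 1 := by
      rw [Ne, ← moved_eq_zero_iff hn, ht i l hil]
      have h2 : 0 < moved hn g :=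
        lt_of_le_of_ne (moved_nonneg hn g) fun h => hg ((moved_eq_zero_iff hn g).1 h.symm)
      have h3 := moved_le_one hn g
      have : 0 < 1 - (1 - moved hn g) ^ 2 := by nlinarith
      positivity
    simp only [chiReg, if_neg h1, if_neg hg]
    simpa using hε.le

theorem hasScalarMeans_of_mem_exChar (hn : ∀ k, 1 < n k) {χ : LimitGroup n → ℂ}
    (h : χ ∈ exChar n hn) : HasScalarMeans χ := by
  rcases h with (⟨p, rfl⟩ | ⟨p, rfl⟩) | h
  · exact hasScalarMeans_chiNat_pow hn p
  · exact (hasScalarMeans_chiNat_pow hn p).sgnInf_mul hn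
  · rw [Set.mem_singleton_iff.1 h]
    exact hasScalarMeans_chiReg hn

end SymLimit

namespace SymLimit

variable {n : ℕ → ℕ}

/-! ### Shears -/

section Shear

variable {X Y F : Type*}

/-- Translation by `a` of all the copies of `F` in the image of `e`. -/
noncomputable def blockTranslate [AddCommGroup F] {B : Type*} (e : B × F ↪ Y) (a : F) :
    Equiv.Perm Y :=
  Equiv.Perm.viaEmbedding ((Equiv.refl B).prodCongr (Equiv.addLeft a)) e

theorem blockTranslate_add [AddCommGroup F] {B : Type*} (e : B × F ↪ Y) (a b : F) :
    blockTranslate e (a + b) = blockTranslate e a * blockTranslate e b := by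
  have h : ((Equiv.refl B).prodCongr (Equiv.addLeft (a + b)) : Equiv.Perm (B × F)) =
      ((Equiv.refl B).prodCongr (Equiv.addLeft a) : Equiv.Perm (B × F)) *
        ((Equiv.refl B).prodCongr (Equiv.addLeft b) : Equiv.Perm (B × F)) := by
    ext x <;> simp [add_assoc]
  rw [blockTranslate, h]
  exact map_mul (Equiv.Perm.viaEmbeddingHom e) _ _

theorem blockTranslate_support [AddCommGroup F] [Fintype F] [DecidableEq F] [Fintype Y]
    [DecidableEq Y] {B : Type*} [Fintype B] [DecidableEq B] (e : B × F ↪ Y) {a : F} (ha : a ≠ 0) :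
    (blockTranslate e a).support = Finset.univ.map e := by
  rw [blockTranslate, viaEmbedding_support]
  congr 1
  ext x
  simp [Prod.ext_iff, ha]

theorem blockTranslate_zero [AddCommGroup F] {B : Type*} (e : B × F ↪ Y) :
    blockTranslate e (0 : F) = 1 := by
  have h := blockTranslate_add e (0 : F) 0
  rw [add_zero] at h
  exact left_eq_mul.1 h

/-- The permutation of `X × Y` that acts by `ρ (v x)` on the fibre over `x`. -/
def shear (ρ : F → Equiv.Perm Y) (v : X → F) : Equiv.Perm (X × Y) :=
  Equiv.prodCongrRight fun x => ρ (v x)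

theorem shear_add [AddCommGroup F] {ρ : F → Equiv.Perm Y}
    (hρ : ∀ a b, ρ (a + b) = ρ a * ρ b) (v w : X → F) :
    shear ρ (v + w) = shear ρ v * shear ρ w := by
  ext x <;> simp [shear, hρ]

theorem shear_conj (ρ : F → Equiv.Perm Y) (v : X → F) (σ : Equiv.Perm X) :
    (Equiv.prodCongr σ (Equiv.refl Y) : Equiv.Perm (X × Y)) * shear ρ v *
      (Equiv.prodCongr σ (Equiv.refl Y) : Equiv.Perm (X × Y))⁻¹ = shear ρ (v ∘ σ.symm) := by
  rw [mul_inv_eq_iff_eq_mul]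
  ext x <;> simp [shear]

theorem shear_support [Fintype X] [DecidableEq X] [Fintype Y] [DecidableEq Y] [Zero F]
    [DecidableEq F] {ρ : F → Equiv.Perm Y} {T : Finset Y} (h0 : ρ 0 = 1)
    (hT : ∀ a, a ≠ 0 → (ρ a).support = T) (v : X → F) :
    (shear ρ v).support = (Finset.univ.filter fun x => v x ≠ 0) ×ˢ T := by
  ext ⟨x, y⟩
  rw [Equiv.Perm.mem_support, Finset.mem_product, Finset.mem_filter]
  simp only [shear, Equiv.prodCongrRight_apply, ne_eq, Prod.mk.injEq, true_and, Finset.mem_univ]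
  by_cases hx : v x = 0
  · simp [hx, h0]
  · rw [← hT _ hx, Equiv.Perm.mem_support]
    simp [hx]

end Shear

/-- $C(v)$ translates by $v(x)$ the $Q$ copies of $F$ placed in the fibre over each point $x$ of
stage $k$. All nonzero translations of a fibre have the same support, so only the number of nonzero
coordinates of $v$ counts. -/
theorem exists_translations (hn : ∀ k, 1 < n k) {k j : ℕ} (h : k ≤ j) (F : Type*)
    [AddCommGroup F] [Fintype F] [DecidableEq F] {Q : ℕ}
    (hQ : Q * Fintype.card F ≤ N n j / N n k) :
    ∃ C : (Fin (N n k) → F) → LimitGroup n, (∀ v w, C (v + w) = C v * C w) ∧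
      (∀ σ v, level n k σ * C v * (level n k σ)⁻¹ = C (v ∘ σ.symm)) ∧
      (∀ v, moved hn (C v) = ((Finset.univ.filter fun x => v x ≠ 0).card : ℝ) *
        (Q * Fintype.card F) / N n j) ∧
      ∀ (A : Finset (Fin (N n k))) (σ : Equiv.Perm (Fin (N n k))) (v : Fin (N n k) → F),
        (∀ x, x ∉ A → σ x = x) → (∀ x, x ∉ A → v x = 0) →
          moved hn (level n k σ * C v) ≤ (A.card : ℝ) / N n k := by
  obtain ⟨e⟩ : Nonempty (Fin Q × F ↪ Fin (N n j / N n k)) :=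
    Function.Embedding.nonempty_of_card_le (by simpa using hQ)
  refine ⟨fun v => blockLevel n h (shear (blockTranslate e) v), fun v w => ?_, fun σ v => ?_,
    fun v => ?_, fun A σ v hσ hv => ?_⟩
  · beta_reduce
    rw [shear_add (blockTranslate_add e), map_mul]
  · rw [← blockLevel_prodCongr h, ← map_inv, ← map_mul, ← map_mul, shear_conj]
  · rw [moved_blockLevel, shear_support (blockTranslate_zero e)
      (fun a ha => blockTranslate_support e ha), Finset.card_product, Finset.card_map]
    simp
  · rw [← blockLevel_prodCongr h, ← map_mul, moved_blockLevel,
      div_le_div_iff₀ (N_real_pos hn j) (N_real_pos hn k)]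
    have h1 : Equiv.Perm.support
        ((Equiv.prodCongr σ (Equiv.refl _) : Equiv.Perm (Fin (N n k) × Fin (N n j / N n k))) *
          shear (blockTranslate e) v) ⊆ A ×ˢ Finset.univ := by
      rintro ⟨x, y⟩ hxy
      rw [Equiv.Perm.mem_support] at hxy
      simp only [Finset.mem_product, Finset.mem_univ, and_true]
      by_contra hx
      exact hxy (by simp [shear, hσ x hx, hv x hx, blockTranslate_zero])
    have h2 := Finset.card_le_card h1
    rw [Finset.card_product, Finset.card_univ, Fintype.card_fin] at h2
    have h3 := Nat.mul_le_mul_right (N n k) h2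
    rw [mul_assoc, Nat.div_mul_cancel (N_dvd n h)] at h3
    exact_mod_cast h3

/-! ### Involutions of prescribed size -/

/-- The group $(\mathbb Z/2)^r$ acts through $r$ disjoint transpositions, one for each coordinate.
-/
theorem exists_flips {α : Type*} [Fintype α] [DecidableEq α] {r : ℕ}
    (hr : 2 * r ≤ Fintype.card α) :
    ∃ τ : (Fin r → ZMod 2) → Equiv.Perm α, (∀ v w, τ (v + w) = τ v * τ w) ∧
      (∀ v, (τ v).support.card = 2 * (Finset.univ.filter fun i => v i ≠ 0).card) := by
  obtain ⟨e⟩ : Nonempty (Fin r × ZMod 2 ↪ α) :=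
    Function.Embedding.nonempty_of_card_le (by simpa [ZMod.card, mul_comm] using hr)
  obtain ⟨e'⟩ : Nonempty (Fin 1 × ZMod 2 ↪ ZMod 2) :=
    Function.Embedding.nonempty_of_card_le (by simp)
  refine ⟨fun v => (shear (blockTranslate e') v).viaEmbedding e, fun v w => ?_, fun v => ?_⟩
  · beta_reduce
    rw [shear_add (blockTranslate_add e')]
    exact map_mul (Equiv.Perm.viaEmbeddingHom e) _ _
  · rw [viaEmbedding_support, Finset.card_map, shear_support (blockTranslate_zero e')
      (fun a ha => blockTranslate_support e' ha), Finset.card_product, Finset.card_map]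
    simp [ZMod.card, mul_comm]

theorem zmod_two_add_self {ι : Type*} (v : ι → ZMod 2) : v + v = 0 := by
  ext i
  exact CharTwo.add_self_eq_zero _

theorem exists_involution {α : Type*} [Fintype α] [DecidableEq α] {r : ℕ}
    (hr : 2 * r ≤ Fintype.card α) :
    ∃ τ : Equiv.Perm α, τ * τ = 1 ∧ τ.support.card = 2 * r := by
  obtain ⟨τ, h1, h2⟩ := exists_flips hr
  refine ⟨τ fun _ => 1, ?_, by rw [h2]; simp⟩
  have h0 := h1 0 0
  rw [add_zero] at h0
  rw [← h1, zmod_two_add_self]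
  exact left_eq_mul.1 h0

/-- The sign and the size of the support of an involution. -/
theorem involution_card_support {α : Type*} [Fintype α] [DecidableEq α] {τ : Equiv.Perm α}
    (h : τ * τ = 1) : ∃ r, τ.support.card = 2 * r ∧ Equiv.Perm.sign τ = (-1) ^ r := by
  have h2 : ∀ m ∈ τ.cycleType, m = 2 := by
    intro m hm
    have h3 : m ∣ 2 := (Equiv.Perm.dvd_of_mem_cycleType hm).trans
      (orderOf_dvd_of_pow_eq_one (by rw [sq, h]))
    exact le_antisymm (Nat.le_of_dvd two_pos h3) (Equiv.Perm.two_le_of_mem_cycleType hm)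
  have h4 := Multiset.eq_replicate_of_mem h2
  refine ⟨τ.cycleType.card, ?_, ?_⟩
  · rw [← Equiv.Perm.sum_cycleType]
    conv_lhs => rw [h4]
    simp [mul_comm]
  · rw [Equiv.Perm.sign_of_cycleType]
    conv_lhs => rw [h4]
    simp [pow_add, pow_mul, mul_comm]

/-! ### Tail permutations -/

/-- Permutations of the second factor of `X_{N_k} × X_{N_j / N_k}`. -/
noncomputable def tailLevel (n : ℕ → ℕ) {k j : ℕ} (h : k ≤ j) :
    Equiv.Perm (Fin (N n j / N n k)) →* LimitGroup n :=
  (blockLevel n h).comp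
    { toFun := fun τ => Equiv.prodCongr (Equiv.refl _) τ
      map_one' := by ext x <;> simp
      map_mul' := fun σ τ => by ext x <;> simp }

theorem tailLevel_apply {k j : ℕ} (h : k ≤ j) (τ : Equiv.Perm (Fin (N n j / N n k))) :
    tailLevel n h τ = blockLevel n h (Equiv.prodCongr (Equiv.refl _) τ) := rfl

theorem tailLevel_commute {k j : ℕ} (h : k ≤ j) (τ : Equiv.Perm (Fin (N n j / N n k)))
    {s : LimitGroup n} (hs : s ∈ stage n k) : s * tailLevel n h τ = tailLevel n h τ * s := by
  obtain ⟨σ, rfl⟩ := hs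
  rw [tailLevel_apply, ← blockLevel_prodCongr h, ← map_mul, ← map_mul]
  congr 1

theorem card_support_prodCongr {X Y : Type*} [Fintype X] [DecidableEq X] [Fintype Y]
    [DecidableEq Y] (σ : Equiv.Perm X) (τ : Equiv.Perm Y) :
    ((Equiv.Perm.support (Equiv.prodCongr σ τ)).card : ℝ) =
      Fintype.card X * Fintype.card Y - (Fintype.card X - σ.support.card) *
        (Fintype.card Y - τ.support.card) := by
  have h1 : (Equiv.Perm.support (Equiv.prodCongr σ τ))ᶜ = σ.supportᶜ ×ˢ τ.supportᶜ := by
    ext ⟨x, y⟩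
    simp
  have h2 := Finset.card_compl_add_card (Equiv.Perm.support (Equiv.prodCongr σ τ))
  rw [h1, Finset.card_product, Fintype.card_prod] at h2
  have h3 : ((σ.supportᶜ.card : ℕ) : ℝ) = Fintype.card X - σ.support.card := by
    rw [Finset.card_compl, Nat.cast_sub (Finset.card_le_univ _)]
  have h4 : ((τ.supportᶜ.card : ℕ) : ℝ) = Fintype.card Y - τ.support.card := by
    rw [Finset.card_compl, Nat.cast_sub (Finset.card_le_univ _)]
  rw [← h3, ← h4]
  have h5 : (((σ.supportᶜ.card * τ.supportᶜ.card +
    (Equiv.Perm.support (Equiv.prodCongr σ τ)).card : ℕ)) : ℝ) =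
      ((Fintype.card X * Fintype.card Y : ℕ) : ℝ) := by rw [h2]
  push_cast at h5
  linarith

theorem div_real (hn : ∀ k, 1 < n k) {k j : ℕ} (h : k ≤ j) :
    ((N n j / N n k : ℕ) : ℝ) = N n j / N n k := by
  rw [eq_div_iff (N_real_pos hn k).ne', mul_comm]
  exact_mod_cast N_mul_div h

/-- The two factors act on independent coordinates, so the proportions of fixed points multiply. -/
theorem moved_mul_tailLevel (hn : ∀ k, 1 < n k) {k j : ℕ} (h : k ≤ j) {s : LimitGroup n}
    (hs : s ∈ stage n k) (τ : Equiv.Perm (Fin (N n j / N n k))) :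
    1 - moved hn (s * tailLevel n h τ) =
      (1 - moved hn s) * (1 - (τ.support.card : ℝ) / (N n j / N n k : ℕ)) := by
  obtain ⟨σ, rfl⟩ := hs
  have h1 : (Equiv.prodCongr σ (Equiv.refl (Fin (N n j / N n k))) :
      Equiv.Perm (Fin (N n k) × Fin (N n j / N n k))) * Equiv.prodCongr (Equiv.refl _) τ =
      Equiv.prodCongr σ τ := by
    ext x <;> simp
  rw [tailLevel_apply, ← blockLevel_prodCongr h, ← map_mul, h1, moved_blockLevel,
    blockLevel_prodCongr, moved_level, card_support_prodCongr, Fintype.card_fin, Fintype.card_fin,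
    div_real hn h]
  have := N_real_pos hn k
  have := N_real_pos hn j
  field_simp
  ring

theorem moved_tailLevel (hn : ∀ k, 1 < n k) {k j : ℕ} (h : k ≤ j)
    (τ : Equiv.Perm (Fin (N n j / N n k))) :
    moved hn (tailLevel n h τ) = (τ.support.card : ℝ) / (N n j / N n k : ℕ) := by
  have := moved_mul_tailLevel hn h (one_mem (stage n k)) τ
  rw [one_mul, moved_one] at this
  linarith

theorem sgnInf_tailLevel {k j : ℕ} (h : k ≤ j) {τ : Equiv.Perm (Fin (N n j / N n k))}
    (hτ : Equiv.Perm.sign τ = 1) : sgnInf n (tailLevel n h τ) = 1 := by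
  rw [tailLevel_apply, blockLevel_apply]
  apply sgnInf_level_of_sign_eq_one
  have : (Equiv.prodCongr (Equiv.refl (Fin (N n k))) τ) =
      Equiv.prodCongrRight (fun _ => τ) := by ext x <;> rfl
  rw [Equiv.Perm.sign_permCongr, this, Equiv.Perm.sign_prodCongrRight]
  simp [hτ]

end SymLimit

namespace SymLimit

/-! ### Means over families of group elements -/

section Means

variable {G : Type*} [Group G] {χ : G → ℂ} {H : Type*} [NormedAddCommGroup H]
  [InnerProductSpace ℂ H] [CompleteSpace H] {π : G →* unitary (H →L[ℂ] H)} {ξ : H} {F : Type*}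
  [Fintype F]

/-- The mean of the vectors `π (f w) ξ`. -/
noncomputable def orbitMean (π : G →* unitary (H →L[ℂ] H)) (ξ : H) (f : F → G) : H :=
  (Fintype.card F : ℂ)⁻¹ • ∑ w, (π (f w) : H →L[ℂ] H) ξ

theorem map_orbitMean (g : G) (f : F → G) :
    (π g : H →L[ℂ] H) (orbitMean π ξ f) = orbitMean π ξ fun w => g * f w := by
  rw [orbitMean, orbitMean, map_smul, map_sum]
  simp only [IsGNS.mul_apply]

theorem IsGNS.inner_orbitMean (h : IsGNS χ π ξ) (f f' : F → G) :
    inner ℂ (orbitMean π ξ f) (orbitMean π ξ f') =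
      (Fintype.card F : ℂ)⁻¹ * ((Fintype.card F : ℂ)⁻¹ * ∑ w, ∑ s, χ ((f w)⁻¹ * f' s)) := by
  rw [orbitMean, orbitMean, inner_smul_right, inner_smul_left, sum_inner]
  simp only [inner_sum, h.inner_apply]
  simp

theorem IsGNS.inner_orbitMean_eq [Nonempty F] (h : IsGNS χ π ξ) {f f' : F → G} {z : ℂ}
    (hz : ∀ w s, χ ((f w)⁻¹ * f' s) = z) :
    inner ℂ (orbitMean π ξ f) (orbitMean π ξ f') = z := by
  rw [h.inner_orbitMean]
  simp only [hz]
  simp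

theorem IsGNS.inner_orbitMean_self [AddCommGroup F] (h : IsGNS χ π ξ) {f : F → G}
    (hf : ∀ w s, f (w + s) = f w * f s) :
    inner ℂ (orbitMean π ξ f) (orbitMean π ξ f) = (Fintype.card F : ℂ)⁻¹ * ∑ w, χ (f w) := by
  rw [h.inner_orbitMean]
  have : ∀ w, ∑ s, χ ((f w)⁻¹ * f s) = ∑ s, χ (f s) := by
    intro w
    rw [← Equiv.sum_comp (Equiv.addLeft w) fun s => χ ((f w)⁻¹ * f s)]
    refine Finset.sum_congr rfl fun s _ => ?_
    rw [Equiv.coe_addLeft, hf, inv_mul_cancel_left]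
  simp [this]

theorem mean_eq_of_ne_zero [AddCommGroup F] [DecidableEq F] {φ : F → ℂ} {z : ℂ} (h0 : φ 0 = 1)
    (hz : ∀ w, w ≠ 0 → φ w = z) :
    (Fintype.card F : ℂ)⁻¹ * ∑ w, φ w =
      (Fintype.card F : ℂ)⁻¹ + (1 - (Fintype.card F : ℂ)⁻¹) * z := by
  have hF : (Fintype.card F : ℂ) ≠ 0 := by exact_mod_cast Fintype.card_ne_zero
  rw [Fintype.sum_eq_add_sum_compl 0, h0,
    Finset.sum_congr rfl fun w hw => hz w (by simpa using hw), Finset.sum_const,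
    Finset.card_compl, Finset.card_singleton, nsmul_eq_mul,
    Nat.cast_sub (Nat.one_le_iff_ne_zero.2 Fintype.card_ne_zero)]
  field_simp
  push_cast
  ring

theorem IsGNS.norm_orbitMean_sq [AddCommGroup F] [DecidableEq F] (h : IsGNS χ π ξ)
    (hχ : IsCharacter χ) {f : F → G} (hf : ∀ w s, f (w + s) = f w * f s) {z : ℂ}
    (hz : ∀ w, w ≠ 0 → χ (f w) = z) :
    ‖orbitMean π ξ f‖ ^ 2 = (Fintype.card F : ℝ)⁻¹ + (1 - (Fintype.card F : ℝ)⁻¹) * z.re := by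
  have h0 : f 0 = 1 := by
    have := hf 0 0
    rw [add_zero] at this
    exact left_eq_mul.1 this
  rw [← inner_self_eq_norm_sq (𝕜 := ℂ), h.inner_orbitMean_self hf,
    mean_eq_of_ne_zero (φ := fun w => χ (f w)) (by simp only [h0, hχ.map_one]) hz]
  have : ((Fintype.card F : ℂ)⁻¹ + (1 - (Fintype.card F : ℂ)⁻¹) * z) =
      (((Fintype.card F : ℝ)⁻¹ : ℝ) : ℂ) + ((1 - (Fintype.card F : ℝ)⁻¹ : ℝ) : ℂ) * z := by
    push_cast; rfl
  rw [this]
  simp [-Complex.ofReal_inv, -Complex.ofReal_sub]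

end Means

variable {n : ℕ → ℕ} {χ : LimitGroup n → ℂ}

/-! ### Values at arbitrary elements are controlled by values at involutions -/

/-- For $\sigma x\ne x$, the element $f(w)$ with value $w$ at $x$ and at $\sigma x$ is the
commutator of $C(w\delta_x)$ and $\sigma$, so $f(w)\sigma$ is conjugate to $\sigma$. Hence
$\chi(\sigma)=\langle a,\pi(\sigma)a\rangle$ for the mean $a$ of the vectors $\pi(f(w))\xi$, and
$\|a\|^2$ is the right-hand side because every $f(w)$ with $w\ne0$ is an involution with the
proportion of moved points of $u$. -/
theorem IsCharacter.norm_le_of_involution (hn : ∀ k, 1 < n k) (hχ : IsCharacter χ) {k j : ℕ}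
    (hkj : k ≤ j) {σ : Equiv.Perm (Fin (N n k))} (hσ : σ ≠ 1) {F : Type*} [AddCommGroup F]
    [Fintype F] (h2 : ∀ a : F, a + a = 0) {Q : ℕ} (hQ : Q * Fintype.card F ≤ N n j / N n k)
    {u : LimitGroup n} (hu : u * u = 1)
    (hmu : moved hn u = 2 * (Q * Fintype.card F : ℝ) / N n j) :
    ‖χ (level n k σ)‖ ≤ (Fintype.card F : ℝ)⁻¹ + (1 - (Fintype.card F : ℝ)⁻¹) * (χ u).re := by
  classical
  obtain ⟨C, hadd, hconj, hmoved, -⟩ := exists_translations hn hkj F hQ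
  obtain ⟨H, i1, i2, i3, π, ρ, ξ, hG⟩ := hχ.exists_biGNS
  obtain ⟨x, hx⟩ : ∃ x, σ x ≠ x := by
    by_contra! h
    exact hσ (Equiv.ext h)
  have hC0 : C 0 = 1 := by
    have := hadd 0 0
    rw [add_zero] at this
    exact left_eq_mul.1 this
  have hself : ∀ v, C v * C v = 1 := by
    intro v
    rw [← hadd, ← hC0]
    congr 1
    ext y
    exact h2 _
  set f : F → LimitGroup n := fun w => C (Pi.single x w + Pi.single (σ x) w) with hf
  have hfadd : ∀ w s, f (w + s) = f w * f s := by
    intro w s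
    simp only [hf]
    rw [← hadd, Pi.single_add, Pi.single_add]
    congr 1
    abel
  have hfg : ∀ w, χ (f w * level n k σ) = χ (level n k σ) := by
    intro w
    have e1 : level n k σ * C (Pi.single x w) * (level n k σ)⁻¹ = C (Pi.single (σ x) w) := by
      rw [hconj]
      congr 1
      ext y
      simp [Pi.single_apply, Equiv.symm_apply_eq]
    have e2 : (C (Pi.single x w))⁻¹ = C (Pi.single x w) := inv_eq_of_mul_eq_one_left (hself _)
    have e3 : f w * level n k σ = C (Pi.single x w) * level n k σ * (C (Pi.single x w))⁻¹ := by
      rw [e2]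
      simp only [hf]
      rw [hadd, ← e1]
      group
    rw [e3, hχ.conj_apply]
  have h3 : inner ℂ (orbitMean π ξ f) ((π (level n k σ) : H →L[ℂ] H) (orbitMean π ξ f)) =
      χ (level n k σ) := by
    rw [map_orbitMean]
    refine hG.toIsGNS.inner_orbitMean_eq fun w s => ?_
    have e2 : (f w)⁻¹ = f w := inv_eq_of_mul_eq_one_left (hself _)
    rw [e2, ← mul_assoc, hχ.central, ← mul_assoc, ← hfadd, hfg]
  have h4 : ∀ w, w ≠ 0 → χ (f w) = χ u := by
    intro w hw
    refine hχ.eq_of_moved_eq hn (hself _) hu ?_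
    rw [hmu, hmoved]
    have : (Finset.univ.filter fun y => (Pi.single x w + Pi.single (σ x) w : _ → F) y ≠ 0) =
        {x, σ x} := by
      ext y
      simp only [Finset.mem_filter, Finset.mem_univ, true_and, Finset.mem_insert,
        Finset.mem_singleton, Pi.add_apply]
      rcases eq_or_ne y x with rfl | h5
      · simp [hx.symm, hw]
      · rcases eq_or_ne y (σ x) with rfl | h6
        · simp [hx, hw]
        · simp [h5, h6]
    rw [this, Finset.card_pair hx.symm]
    norm_num
  have h5 := norm_inner_le_norm (𝕜 := ℂ) (orbitMean π ξ f)
    ((π (level n k σ) : H →L[ℂ] H) (orbitMean π ξ f))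
  rw [h3, Unitary.norm_map, ← sq, hG.toIsGNS.norm_orbitMean_sq hχ hfadd h4] at h5
  exact h5

theorem exists_pow_two_inv_le {ε : ℝ} (hε : 0 < ε) : ∃ m : ℕ, ((2 : ℝ) ^ m)⁻¹ ≤ ε := by
  obtain ⟨m, hm⟩ := exists_pow_lt_of_lt_one hε (by norm_num : (1 / 2 : ℝ) < 1)
  exact ⟨m, by rw [one_div, inv_pow] at hm; exact hm.le⟩

theorem card_fin_fun_zmod_two (m : ℕ) : Fintype.card (Fin m → ZMod 2) = 2 ^ m := by
  simp [ZMod.card]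

/-- A uniform bound on the values of an asymptotically multiplicative character off the identity
can be squared. -/
theorem IsAsympMul.norm_le_sq (hn : ∀ k, 1 < n k) (h : IsAsympMul (stage n) χ)
    (hχ : IsCharacter χ) {K : ℝ} (hK0 : 0 ≤ K) (hK : ∀ g, g ≠ 1 → ‖χ g‖ ≤ K) {g : LimitGroup n}
    (hg : g ≠ 1) : ‖χ g‖ ≤ K ^ 2 := by
  refine le_of_forall_pos_le_add fun ε hε => ?_
  obtain ⟨k, σ, rfl⟩ := exists_mem_stage g
  have hσ : σ ≠ 1 := fun h' => hg (by rw [h', _root_.map_one])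
  obtain ⟨m, hm⟩ := exists_pow_two_inv_le (half_pos hε)
  set q := 2 ^ m with hq
  have hqpos : 0 < q := by positivity
  obtain ⟨i, hi, hki⟩ := (((tendsto_N_div hn k).eventually_ge_atTop (2 * q)).and
    (eventually_ge_atTop k)).exists
  set s := N n i / N n k with hs
  have hNi : N n k * s = N n i := N_mul_div hki
  have hsi : s ≤ N n i := Nat.div_le_self _ _
  obtain ⟨τ, hτ1, hτ2⟩ := exists_involution (α := Fin (N n i)) (r := q)
    (by rw [Fintype.card_fin]; exact hi.trans hsi)
  have hmτ : moved hn (level n i τ) = 2 * q / N n i := by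
    rw [moved_level, hτ2]; push_cast; ring
  obtain ⟨j₀, hj₀⟩ := h.norm_mul_sub_le hχ (level n i τ) (half_pos hε)
  set j := max j₀ i with hj
  have hij : i ≤ j := le_max_right _ _
  set r := N n j / N n i with hr
  have hNj : N n i * r = N n j := N_mul_div hij
  -- The test involution is $\tau y$, with $\tau$ at stage $i$ and $y$ in the tail beyond $j$, so
  -- $\chi(\tau y)\approx\chi(\tau)\chi(y)$. The two bounds $N_i/N_k\ge 2q$ and $N_l/N_j\ge 2qN_k$
  -- each pay for half of the room $Qq\le N_l/N_k$.
  obtain ⟨l, hl, hjl⟩ := (((tendsto_N_div hn j).eventually_ge_atTop (2 * q * N n k)).and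
    (eventually_ge_atTop j)).exists
  set Z := N n l / N n j with hZ
  have hNl : N n j * Z = N n l := N_mul_div hjl
  have hNkpos := N_pos hn k
  have hZq : 2 * q ≤ Z := (Nat.le_mul_of_pos_right _ hNkpos).trans hl
  obtain ⟨τ', hτ'1, hτ'2⟩ := exists_involution (α := Fin (N n l / N n j)) (r := q)
    (by rw [Fintype.card_fin]; exact hZq)
  set y := tailLevel n hjl τ' with hy
  have hmy : moved hn y = 2 * q / Z := by
    rw [hy, moved_tailLevel, hτ'2]; push_cast; ring
  have hτj : level n i τ ∈ stage n j := stage_mono hij (level_mem_stage i τ)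
  have hcomm := tailLevel_commute hjl τ' hτj
  have hyy : y * y = 1 := by rw [hy, ← map_mul, hτ'1, _root_.map_one]
  have hττ : level n i τ * level n i τ = 1 := by rw [← map_mul, hτ1, _root_.map_one]
  have hu : (level n i τ * y) * (level n i τ * y) = 1 := by
    rw [mul_assoc, ← mul_assoc y, ← hcomm, mul_assoc, hyy, mul_one, hττ]
  have hNkr := N_real_pos hn k
  have hNir := N_real_pos hn i
  have hNjr := N_real_pos hn j
  have hNlr := N_real_pos hn l
  have hqr : (0 : ℝ) < q := by exact_mod_cast hqpos
  have hZr : (0 : ℝ) < Z := by exact_mod_cast (by omega : 0 < Z)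
  have hsub : 2 * q * r ≤ N n j := by
    rw [← hNj]
    exact Nat.mul_le_mul_right r (hi.trans hsi)
  -- At stage $l$ the product moves $2qr\cdot Z+(N_j-2qr)\cdot2q=2qQ$ points, the size of an
  -- involution $f(w)$ built from $Q$ copies of $F$.
  set Q := Z * r + (N n j - 2 * q * r) with hQdef
  have hQr : (Q : ℝ) = Z * r + (N n j - 2 * q * r) := by
    rw [hQdef]; push_cast [Nat.cast_sub hsub]; ring
  have hrj : (N n i : ℝ) * r = N n j := by exact_mod_cast hNj
  have hlr : (N n j : ℝ) * Z = N n l := by exact_mod_cast hNl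
  have hrr : (0 : ℝ) < r := by
    rw [← hrj] at hNjr
    exact pos_of_mul_pos_right hNjr hNir.le
  have hmu : moved hn (level n i τ * y) =
      2 * (Q * Fintype.card (Fin m → ZMod 2) : ℝ) / N n l := by
    have e := moved_mul_tailLevel hn hjl hτj τ'
    rw [← hy, hmτ, hτ'2, ← hZ] at e
    rw [card_fin_fun_zmod_two, ← hq, hQr, ← hlr, ← hrj]
    push_cast at e
    have e' : moved hn (level n i τ * y) = 1 - (1 - 2 * q / N n i) * (1 - 2 * q / Z) := by
      linarith
    rw [e']
    field_simp
    ring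
  have hdiv : N n l / N n k = s * r * Z := by
    apply Nat.div_eq_of_eq_mul_right hNkpos
    rw [← hNl, ← hNj, ← hNi]
    ring
  have hQ : Q * Fintype.card (Fin m → ZMod 2) ≤ N n l / N n k := by
    rw [card_fin_fun_zmod_two, ← hq, hdiv]
    have e1 : Q ≤ Z * r + N n k * s * r := by
      rw [hQdef, hNi, hNj]
      omega
    have e2 : 2 * q * (Z * r) ≤ s * (Z * r) := Nat.mul_le_mul_right _ hi
    have e3 : 2 * q * N n k * (s * r) ≤ Z * (s * r) := Nat.mul_le_mul_right _ hl
    have e4 := Nat.mul_le_mul_right q e1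
    have e5 : 2 * ((Z * r + N n k * s * r) * q) ≤ 2 * (s * r * Z) := by
      calc 2 * ((Z * r + N n k * s * r) * q) = 2 * q * (Z * r) + 2 * q * N n k * (s * r) := by ring
        _ ≤ s * (Z * r) + Z * (s * r) := add_le_add e2 e3
        _ = 2 * (s * r * Z) := by ring
    exact e4.trans (Nat.le_of_mul_le_mul_left e5 two_pos)
  have h1 := hχ.norm_le_of_involution hn (hki.trans (hij.trans hjl)) hσ
    (F := Fin m → ZMod 2) (fun a => zmod_two_add_self a) hQ hu hmu
  rw [card_fin_fun_zmod_two] at h1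
  push_cast at h1
  have h2 := hj₀ j (le_max_left _ _) y fun t ht => tailLevel_commute hjl τ' ht
  have h3 : ‖χ (level n i τ)‖ ≤ K := by
    refine hK _ ?_
    rw [Ne, ← moved_eq_zero_iff hn, hmτ]
    positivity
  have h4 : ‖χ y‖ ≤ K := by
    refine hK _ ?_
    rw [Ne, ← moved_eq_zero_iff hn, hmy]
    positivity
  have h5 : ‖χ (level n i τ * y)‖ ≤ K ^ 2 + ε / 2 := by
    have e1 := norm_sub_norm_le (χ (level n i τ * y)) (χ (level n i τ) * χ y)
    rw [norm_mul] at e1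
    have e2 := mul_le_mul h3 h4 (norm_nonneg _) hK0
    rw [sq]
    linarith
  have h6 := Complex.re_le_norm (χ (level n i τ * y))
  have h7 : (1 - ((2 : ℝ) ^ m)⁻¹) * (χ (level n i τ * y)).re ≤ ‖χ (level n i τ * y)‖ := by
    have e1 : 0 < ((2 : ℝ) ^ m)⁻¹ := by positivity
    have e2 : ((2 : ℝ) ^ m)⁻¹ ≤ 1 := inv_le_one_of_one_le₀ (one_le_pow₀ (by norm_num))
    exact (mul_le_mul_of_nonneg_left h6 (by linarith)).trans
      (mul_le_of_le_one_left (norm_nonneg _) (by linarith))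
  linarith

/-- The supremum of $|\chi|$ off the identity is at most its own square, so it cannot lie strictly
between 0 and 1. -/
theorem IsAsympMul.eq_zero_or_exists (hn : ∀ k, 1 < n k) (h : IsAsympMul (stage n) χ)
    (hχ : IsCharacter χ) :
    (∀ g, g ≠ 1 → χ g = 0) ∨ ∀ ε : ℝ, 0 < ε → ∃ g, g ≠ 1 ∧ 1 - ε ≤ ‖χ g‖ := by
  by_contra! hcon
  obtain ⟨⟨g, hg, hg0⟩, ε, hε, hlt⟩ := hcon
  set A := (fun g => ‖χ g‖) '' {g : LimitGroup n | g ≠ 1} with hA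
  have hne : A.Nonempty := ⟨_, g, hg, rfl⟩
  have hb : BddAbove A := ⟨1, by rintro _ ⟨x, -, rfl⟩; exact hχ.norm_le_one x⟩
  have hle : ∀ x, x ≠ 1 → ‖χ x‖ ≤ sSup A := fun x hx => le_csSup hb ⟨x, hx, rfl⟩
  have h0 : 0 < sSup A := (norm_pos_iff.2 hg0).trans_le (hle g hg)
  have h1 : sSup A ≤ 1 - ε := csSup_le hne (by rintro _ ⟨x, hx, rfl⟩; exact (hlt x hx).le)
  have h2 : sSup A ≤ sSup A ^ 2 :=
    csSup_le hne (by rintro _ ⟨x, hx, rfl⟩; exact h.norm_le_sq hn hχ h0.le hle hx)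
  nlinarith

end SymLimit

namespace SymLimit

/-! ### Inequalities from the GNS vectors $\pi(a)\xi$. -/

section

variable {G : Type*} [Group G] {χ : G → ℂ}

theorem IsGNS.norm_apply_sub_sq {H : Type*} [NormedAddCommGroup H] [InnerProductSpace ℂ H]
    [CompleteSpace H] {π : G →* unitary (H →L[ℂ] H)} {ξ : H} (h : IsGNS χ π ξ)
    (hχ : IsCharacter χ) (a : G) : ‖(π a : H →L[ℂ] H) ξ - ξ‖ ^ 2 = 2 * (1 - (χ a).re) := by
  have h1 : ‖ξ‖ = 1 := by simpa using h.norm_apply hχ 1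
  have h2 : RCLike.re (inner ℂ ((π a : H →L[ℂ] H) ξ) ξ) = (χ a).re := by
    rw [inner_re_symm, ← h.apply_eq]; rfl
  rw [_root_.norm_sub_sq (𝕜 := ℂ), h.norm_apply hχ, h1, h2]
  ring

theorem IsCharacter.re_le_one (hχ : IsCharacter χ) (a : G) : (χ a).re ≤ 1 :=
  (Complex.re_le_norm _).trans (hχ.norm_le_one a)

/-- Triangle inequality for $\|\pi(a)\xi-\xi\|$, squared through $(x+y)^2\le2x^2+2y^2$. -/
theorem IsCharacter.one_sub_re_mul_le (hχ : IsCharacter χ) (a b : G) :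
    1 - (χ (a * b)).re ≤ 2 * (1 - (χ a).re) + 2 * (1 - (χ b).re) := by
  obtain ⟨H, i1, i2, i3, π, ρ, ξ, h⟩ := hχ.exists_biGNS
  have h1 := h.toIsGNS.norm_apply_sub_sq hχ a
  have h2 := h.toIsGNS.norm_apply_sub_sq hχ b
  have h3 := h.toIsGNS.norm_apply_sub_sq hχ (a * b)
  have h4 : ‖(π (a * b) : H →L[ℂ] H) ξ - ξ‖ ≤
      ‖(π b : H →L[ℂ] H) ξ - ξ‖ + ‖(π a : H →L[ℂ] H) ξ - ξ‖ := by
    have : (π (a * b) : H →L[ℂ] H) ξ - ξ =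
        (π a : H →L[ℂ] H) ((π b : H →L[ℂ] H) ξ - ξ) + ((π a : H →L[ℂ] H) ξ - ξ) := by
      rw [IsGNS.mul_apply, map_sub]; abel
    rw [this]
    refine (norm_add_le _ _).trans_eq ?_
    rw [Unitary.norm_map]
  nlinarith [norm_nonneg ((π (a * b) : H →L[ℂ] H) ξ - ξ),
    sq_nonneg (‖(π b : H →L[ℂ] H) ξ - ξ‖ - ‖(π a : H →L[ℂ] H) ξ - ξ‖)]

theorem IsCharacter.norm_sub_mul_sq_le (hχ : IsCharacter χ) (a b : G) :
    ‖χ a - χ (a * b)‖ ^ 2 ≤ 2 * (1 - (χ b).re) := by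
  obtain ⟨H, i1, i2, i3, π, ρ, ξ, h⟩ := hχ.exists_biGNS
  rw [← h.toIsGNS.norm_apply_sub_sq hχ b]
  have h1 := norm_inner_le_norm (𝕜 := ℂ) ((π a⁻¹ : H →L[ℂ] H) ξ) ((π b : H →L[ℂ] H) ξ - ξ)
  have h2 := h.toIsGNS.inner_apply a⁻¹ 1
  rw [_root_.map_one, mul_one, inv_inv] at h2
  rw [inner_sub_right, h.toIsGNS.inner_apply, inv_inv, h.toIsGNS.norm_apply hχ, one_mul] at h1
  have h3 : inner ℂ ((π a⁻¹ : H →L[ℂ] H) ξ) ξ = χ a := h2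
  rw [h3, norm_sub_rev] at h1
  exact pow_le_pow_left₀ (norm_nonneg _) h1 2

theorem IsCharacter.eq_re_of_mul_self (hχ : IsCharacter χ) {t : G} (ht : t * t = 1) :
    χ t = ((χ t).re : ℂ) := by
  have h := hχ.map_inv t
  rw [inv_eq_of_mul_eq_one_left ht] at h
  exact (Complex.conj_eq_iff_re.1 h.symm).symm

end

variable {n : ℕ → ℕ} {χ : LimitGroup n → ℂ}

/-! ### Even involutions -/

/-- Involutions that are even at all large stages. -/
def IsEvenInvolution (t : LimitGroup n) : Prop := t * t = 1 ∧ sgnInf n t = 1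

theorem IsEvenInvolution.eventually (hn : ∀ k, 1 < n k) {t : LimitGroup n}
    (ht : IsEvenInvolution t) :
    ∀ᶠ j in atTop, ∃ s, 4 * s ≤ N n j ∧ moved hn t = 4 * s / N n j := by
  obtain ⟨j₀, hj₀⟩ := exists_level t
  filter_upwards [eventually_sign_eq hn t, eventually_ge_atTop j₀] with j hj hj'
  obtain ⟨τ, rfl⟩ := hj₀ j hj'
  have h1 : τ * τ = 1 := level_injective hn j (by rw [map_mul, ht.1, _root_.map_one])
  obtain ⟨r, h2, h3⟩ := involution_card_support h1
  have h4 := hj τ rfl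
  rw [h3, ht.2] at h4
  have h5 : Even r := by
    by_contra h
    rw [Nat.not_even_iff_odd] at h
    rw [h.neg_one_pow] at h4
    norm_num at h4
  obtain ⟨s, rfl⟩ := h5
  refine ⟨s, ?_, ?_⟩
  · have := Finset.card_le_univ τ.support
    rw [Fintype.card_fin] at this
    omega
  · rw [moved_level, h2]
    push_cast
    ring

theorem exists_level_flips (hn : ∀ k, 1 < n k) {j R : ℕ} (hR : 2 * R ≤ N n j) :
    ∃ τ : (Fin R → ZMod 2) → LimitGroup n, (∀ v w, τ (v + w) = τ v * τ w) ∧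
      (∀ v, τ v * τ v = 1) ∧
      (∀ v, moved hn (τ v) = 2 * (Finset.univ.filter fun i => v i ≠ 0).card / N n j) ∧
      ∀ v, Even (Finset.univ.filter fun i => v i ≠ 0).card → sgnInf n (τ v) = 1 := by
  obtain ⟨τ, h1, h2⟩ := exists_flips (α := Fin (N n j)) (r := R) (by simpa using hR)
  have h0 : τ 0 = 1 := by
    have := h1 0 0
    rw [add_zero] at this
    exact left_eq_mul.1 this
  have h3 : ∀ v, τ v * τ v = 1 := fun v => by rw [← h1, zmod_two_add_self, h0]
  refine ⟨fun v => level n j (τ v), fun v w => by simp only [h1, map_mul], fun v => ?_, fun v => ?_,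
    fun v hv => sgnInf_level_of_sign_eq_one j ?_⟩
  · rw [← map_mul, h3, _root_.map_one]
  · rw [moved_level, h2]
    push_cast
    rfl
  · obtain ⟨r, h4, h5⟩ := involution_card_support (h3 v)
    rw [h2] at h4
    rw [h5, ← Nat.eq_of_mul_eq_mul_left two_pos h4]
    exact hv.neg_one_pow

theorem exists_evenInvolution (hn : ∀ k, 1 < n k) {j s : ℕ} (h : 4 * s ≤ N n j) :
    ∃ t : LimitGroup n, IsEvenInvolution t ∧ moved hn t = 4 * s / N n j := by
  obtain ⟨τ, -, h1, h2, h3⟩ := exists_level_flips hn (j := j) (R := 2 * s) (by omega)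
  refine ⟨τ fun _ => 1, ⟨h1 _, h3 _ (by simp)⟩, ?_⟩
  rw [h2]
  simp
  ring

theorem card_filter_fin_lt {R a : ℕ} (h : a ≤ R) :
    (Finset.univ.filter fun i : Fin R => (i : ℕ) < a).card = a := by
  rw [Fin.card_filter_val_lt]
  exact min_eq_right h

theorem card_filter_fin_ge (R a : ℕ) :
    (Finset.univ.filter fun i : Fin R => a ≤ (i : ℕ)).card = R - a := by
  have h1 := Finset.card_filter_add_card_filter_not (s := (Finset.univ : Finset (Fin R)))
    fun i => (i : ℕ) < a
  simp only [not_lt, Finset.card_univ, Fintype.card_fin, Fin.card_filter_val_lt] at h1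
  omega

/-- An element with $|\chi|$ close to 1 forces, by `norm_le_of_involution`, values close to 1 at
involutions of special sizes. Every small even involution is conjugate to a product of two commuting
involutions of one such size that overlap. -/
theorem IsAsympMul.exists_near_one (hn : ∀ k, 1 < n k) (h : IsAsympMul (stage n) χ)
    (hχ : IsCharacter χ) (hne : ∃ g, g ≠ 1 ∧ χ g ≠ 0) {ε : ℝ} (hε : 0 < ε) :
    ∃ δ : ℝ, 0 < δ ∧ ∀ t, IsEvenInvolution t → moved hn t < δ → 1 - ε ≤ (χ t).re := by
  have hbig := (h.eq_zero_or_exists hn hχ).resolve_left fun h' =>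
    hne.elim fun g hg => hg.2 (h' g hg.1)
  set η := min (ε / 8) (1 / 4) with hη
  have hηpos : 0 < η := lt_min (by positivity) (by norm_num)
  have hη1 : η ≤ ε / 8 := min_le_left _ _
  have hη2 : η ≤ 1 / 4 := min_le_right _ _
  obtain ⟨g, hg, hgη⟩ := hbig η hηpos
  obtain ⟨k, σ, rfl⟩ := exists_mem_stage g
  have hσ : σ ≠ 1 := fun h' => hg (by rw [h', _root_.map_one])
  obtain ⟨m, hm⟩ := exists_pow_two_inv_le hηpos
  set q := 2 ^ m with hq
  have hqpos : 0 < q := by positivity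
  have hNk := N_real_pos hn k
  refine ⟨1 / N n k, by positivity, fun t ht htm => ?_⟩
  obtain ⟨l, ⟨s, hs, hms⟩, hl, hkl⟩ := ((ht.eventually hn).and
    (((tendsto_N_div hn k).eventually_ge_atTop (4 * q)).and (eventually_ge_atTop k))).exists
  set y := N n l / N n k with hy
  have hyl : N n k * y = N n l := N_mul_div hkl
  have hNl := N_real_pos hn l
  have hsy : 4 * s < y := by
    rw [hms, div_lt_div_iff₀ hNl hNk, one_mul] at htm
    have h1 : 4 * s * N n k < N n l := by exact_mod_cast htm
    rw [← hyl, mul_comm (N n k)] at h1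
    exact lt_of_mul_lt_mul_right h1 (Nat.zero_le _)
  have h2y : 2 * y ≤ N n l := by
    rw [← hyl]
    exact Nat.mul_le_mul_right y ((hn 0).trans_le (Nat.le_of_dvd (N_pos hn k)
      (by simpa [N] using N_dvd n (Nat.zero_le k))))
  -- $Qq$ is the first multiple of $q$ above $s$. Flipping the first and the last $Qq$ of $s+Qq$
  -- pairs cancels on the overlap and leaves $2s$ transpositions, as many as in $t$.
  set Q := s / q + 1 with hQ
  have hQ1 : s ≤ Q * q := by
    have := Nat.lt_div_mul_add hqpos (a := s)
    rw [hQ, add_mul, one_mul]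
    exact this.le
  have hQ2 : Q * q ≤ s + q := by
    have := Nat.div_mul_le_self s q
    rw [hQ, add_mul, one_mul]
    omega
  obtain ⟨τ, hτ1, hτ2, hτ3, -⟩ := exists_level_flips hn (j := l) (R := s + Q * q) (by omega)
  set v₁ : Fin (s + Q * q) → ZMod 2 := fun i => if (i : ℕ) < Q * q then 1 else 0 with hv₁
  set v₂ : Fin (s + Q * q) → ZMod 2 := fun i => if s ≤ (i : ℕ) then 1 else 0 with hv₂
  have c₁ : (Finset.univ.filter fun i => v₁ i ≠ 0).card = Q * q := by
    simp only [hv₁, ne_eq, ite_eq_right_iff, one_ne_zero, imp_false, not_not]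
    exact card_filter_fin_lt (by omega)
  have c₂ : (Finset.univ.filter fun i => v₂ i ≠ 0).card = Q * q := by
    simp only [hv₂, ne_eq, ite_eq_right_iff, one_ne_zero, imp_false, not_not]
    rw [card_filter_fin_ge]
    omega
  have c₃ : (Finset.univ.filter fun i => (v₁ + v₂) i ≠ 0).card = 2 * s := by
    have e : (Finset.univ.filter fun i => (v₁ + v₂) i ≠ 0) =
        (Finset.univ.filter fun i : Fin (s + Q * q) => (i : ℕ) < s) ∪
          (Finset.univ.filter fun i : Fin (s + Q * q) => Q * q ≤ (i : ℕ)) := by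
      ext i
      simp only [hv₁, hv₂, Finset.mem_filter, Finset.mem_univ, true_and, Finset.mem_union,
        Pi.add_apply]
      by_cases h1 : (i : ℕ) < Q * q <;> by_cases h2 : s ≤ (i : ℕ)
      · simp [h1, h2, CharTwo.add_self_eq_zero]
      · simp [h1, h2]; omega
      · simp [h1, h2]; omega
      · omega
    rw [e, Finset.card_union_of_disjoint, card_filter_fin_lt (by omega), card_filter_fin_ge]
    · omega
    · rw [Finset.disjoint_filter]
      intro i _ h1
      omega
  have hre : ∀ v, (Finset.univ.filter fun i => v i ≠ 0).card = Q * q →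
      1 - 2 * η ≤ (χ (τ v)).re := by
    intro v hv
    have h1 := hχ.norm_le_of_involution hn hkl hσ (F := Fin m → ZMod 2)
      (fun a => zmod_two_add_self a) (Q := Q) (by rw [card_fin_fun_zmod_two, ← hq, ← hy]; omega)
      (hτ2 v) (by rw [hτ3, hv, card_fin_fun_zmod_two, hq]; push_cast; rfl)
    rw [card_fin_fun_zmod_two] at h1
    push_cast at h1
    have h2 : 0 < ((2 : ℝ) ^ m)⁻¹ := by positivity
    nlinarith
  have h1 := hχ.one_sub_re_mul_le (τ v₁) (τ v₂)
  have h2 : χ t = χ (τ v₁ * τ v₂) := by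
    rw [← hτ1]
    refine hχ.eq_of_moved_eq hn ht.1 (hτ2 _) ?_
    rw [hτ3, c₃, hms]
    push_cast
    ring
  have h3 := hre v₁ c₁
  have h4 := hre v₂ c₂
  rw [h2]
  linarith

/-- Up to conjugacy, the larger of the two is the smaller times a disjoint small even involution,
whose value is close to 1. -/
theorem IsAsympMul.exists_modulus (hn : ∀ k, 1 < n k) (h : IsAsympMul (stage n) χ)
    (hχ : IsCharacter χ) (hne : ∃ g, g ≠ 1 ∧ χ g ≠ 0) {ε : ℝ} (hε : 0 < ε) :
    ∃ δ : ℝ, 0 < δ ∧ ∀ t t', IsEvenInvolution t → IsEvenInvolution t' →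
      |moved hn t - moved hn t'| < δ → ‖χ t - χ t'‖ ≤ ε := by
  obtain ⟨δ, hδ, hd⟩ := h.exists_near_one hn hχ hne (by positivity : 0 < ε ^ 2 / 2)
  have key : ∀ t t', IsEvenInvolution t → IsEvenInvolution t' → moved hn t ≤ moved hn t' →
      moved hn t' - moved hn t < δ → ‖χ t - χ t'‖ ≤ ε := by
    intro t t' ht ht' hle hlt
    obtain ⟨j, ⟨s, hs, hms⟩, s', hs', hms'⟩ := ((ht.eventually hn).and (ht'.eventually hn)).exists
    have hNj := N_real_pos hn j
    have hss : s ≤ s' := by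
      rw [hms, hms', div_le_div_iff_of_pos_right hNj] at hle
      have : (s : ℝ) ≤ s' := by linarith
      exact_mod_cast this
    obtain ⟨τ, hτ1, hτ2, hτ3, hτ4⟩ := exists_level_flips hn (j := j) (R := 2 * s') (by omega)
    set v : Fin (2 * s') → ZMod 2 := fun i => if (i : ℕ) < 2 * s then 1 else 0 with hv
    set w : Fin (2 * s') → ZMod 2 := fun i => if 2 * s ≤ (i : ℕ) then 1 else 0 with hw
    have c₁ : (Finset.univ.filter fun i => v i ≠ 0).card = 2 * s := by
      simp only [hv, ne_eq, ite_eq_right_iff, one_ne_zero, imp_false, not_not]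
      exact card_filter_fin_lt (by omega)
    have c₂ : (Finset.univ.filter fun i => w i ≠ 0).card = 2 * (s' - s) := by
      simp only [hw, ne_eq, ite_eq_right_iff, one_ne_zero, imp_false, not_not]
      rw [card_filter_fin_ge]
      omega
    have c₃ : (Finset.univ.filter fun i => (v + w) i ≠ 0).card = 2 * s' := by
      have e : v + w = fun _ => 1 := by
        ext i
        simp only [hv, hw, Pi.add_apply]
        by_cases h1 : (i : ℕ) < 2 * s
        · rw [if_pos h1, if_neg (by omega), add_zero]
        · rw [if_neg h1, if_pos (by omega), zero_add]
      rw [e]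
      simp
    have e1 : χ t = χ (τ v) := hχ.eq_of_moved_eq hn ht.1 (hτ2 v) (by
      rw [hτ3, c₁, hms]; push_cast; ring)
    have e2 : χ t' = χ (τ v * τ w) := by
      rw [← hτ1]
      exact hχ.eq_of_moved_eq hn ht'.1 (hτ2 _) (by rw [hτ3, c₃, hms']; push_cast; ring)
    have e3 := hχ.norm_sub_mul_sq_le (τ v) (τ w)
    rw [← e1, ← e2] at e3
    have e4 := hd (τ w) ⟨hτ2 w, hτ4 w (by rw [c₂]; simp)⟩ (by
      refine lt_of_eq_of_lt ?_ hlt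
      rw [hτ3, c₂, hms, hms']
      push_cast [Nat.cast_sub hss]
      ring)
    refine abs_le_of_sq_le_sq' ?_ hε.le |>.2
    linarith
  refine ⟨δ, hδ, fun t t' ht ht' hlt => ?_⟩
  rcases le_total (moved hn t) (moved hn t') with hle | hle
  · exact key t t' ht ht' hle (by rw [abs_sub_comm] at hlt; exact (le_abs_self _).trans_lt hlt)
  · rw [norm_sub_rev]
    exact key t' t ht' ht hle ((le_abs_self _).trans_lt hlt)

theorem floor_quarter {x : ℝ} (h0 : 0 ≤ x) (h1 : x ≤ 1) (M : ℕ) (hM : 0 < M) :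
    4 * ⌊x * M / 4⌋₊ ≤ M ∧ |x - 4 * (⌊x * M / 4⌋₊ : ℝ) / M| ≤ 4 / M := by
  have hMr : (0 : ℝ) < M := by exact_mod_cast hM
  have h2 := Nat.floor_le (by positivity : 0 ≤ x * M / 4)
  have h3 := Nat.lt_floor_add_one (x * M / 4)
  constructor
  · have : (4 * ⌊x * M / 4⌋₊ : ℝ) ≤ M := by nlinarith
    exact_mod_cast this
  · have : x - 4 * (⌊x * M / 4⌋₊ : ℝ) / M = (x * M - 4 * ⌊x * M / 4⌋₊) / M := by
      field_simp
    rw [this, abs_div, abs_of_pos hMr, div_le_div_iff_of_pos_right hMr, abs_le]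
    constructor <;> linarith

end SymLimit

namespace SymLimit

/-! ### Multiplicative functions on the unit interval -/

/-- In the coordinate $x=e^{-y}$, $\log f$ is continuous and additive on the half-line, hence
linear. It is defined because a zero at $y$ would propagate to $y/2^m\to0$, against $f(1)=1$. -/
theorem exists_rpow_of_multiplicative {f : ℝ → ℝ} (hc : ContinuousOn f (Set.Icc 0 1))
    (hmul : ∀ x ∈ Set.Icc (0 : ℝ) 1, ∀ y ∈ Set.Icc (0 : ℝ) 1, f (x * y) = f x * f y)
    (h1 : f 1 = 1) (hle : ∀ x ∈ Set.Icc (0 : ℝ) 1, f x ≤ 1) :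
    ∃ p : ℝ, 0 ≤ p ∧ ∀ x ∈ Set.Icc (0 : ℝ) 1, f x = x ^ p := by
  have hexp : ∀ y : ℝ, 0 ≤ y → Real.exp (-y) ∈ Set.Icc (0 : ℝ) 1 := fun y hy =>
    ⟨(Real.exp_pos _).le, Real.exp_le_one_iff.2 (by linarith)⟩
  have hadd : ∀ a b : ℝ, 0 ≤ a → 0 ≤ b →
      f (Real.exp (-(a + b))) = f (Real.exp (-a)) * f (Real.exp (-b)) := by
    intro a b ha hb
    rw [← hmul _ (hexp a ha) _ (hexp b hb), ← Real.exp_add]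
    congr 2
    ring
  have hcexp : ContinuousOn (fun y : ℝ => f (Real.exp (-y))) (Set.Ici 0) :=
    hc.comp (by fun_prop) fun y hy => hexp y hy
  have hne : ∀ y : ℝ, 0 ≤ y → f (Real.exp (-y)) ≠ 0 := by
    have hpow : ∀ (m : ℕ) (y : ℝ), 0 ≤ y → f (Real.exp (-y)) = 0 →
        f (Real.exp (-(y / 2 ^ m))) = 0 := by
      intro m
      induction m with
      | zero => intro y _ h; simpa using h
      | succ m ih =>
        intro y hy h
        have h2 := ih y hy h
        have h3 := hadd (y / 2 ^ (m + 1)) (y / 2 ^ (m + 1)) (by positivity) (by positivity)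
        have h4 : y / 2 ^ (m + 1) + y / 2 ^ (m + 1) = y / 2 ^ m := by
          field_simp
          ring
        rw [h4, h2] at h3
        exact mul_self_eq_zero.1 h3.symm
    intro y hy h
    have ht : Tendsto (fun m : ℕ => y / 2 ^ m) atTop (𝓝[Set.Ici 0] 0) := by
      rw [tendsto_nhdsWithin_iff]
      refine ⟨?_, Eventually.of_forall fun m => Set.mem_Ici.2 (by positivity)⟩
      have h5 := (tendsto_pow_atTop_nhds_zero_of_lt_one (by norm_num : (0 : ℝ) ≤ 1 / 2)
        (by norm_num)).const_mul y
      rw [mul_zero] at h5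
      refine h5.congr fun m => ?_
      rw [one_div, inv_pow]
      rfl
    have h6 := (hcexp 0 Set.self_mem_Ici).tendsto.comp ht
    have h7 : (fun y : ℝ => f (Real.exp (-y))) ∘ (fun m : ℕ => y / 2 ^ m) = fun _ => 0 :=
      funext fun m => hpow m y hy h
    rw [h7] at h6
    have h8 := tendsto_nhds_unique h6 tendsto_const_nhds
    simp [h1] at h8
  have hpos : ∀ y : ℝ, 0 ≤ y → 0 < f (Real.exp (-y)) := by
    intro y hy
    have h2 := hadd (y / 2) (y / 2) (by positivity) (by positivity)
    rw [add_halves] at h2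
    rw [h2]
    exact mul_self_pos.2 (hne _ (by positivity))
  set ℓ : ℝ → ℝ := fun y => Real.log (f (Real.exp (-(max y 0)))) with hℓ
  have hℓc : Continuous ℓ := by
    have h2 : Continuous fun y : ℝ => f (Real.exp (-(max y 0))) :=
      hcexp.comp_continuous (by fun_prop : Continuous fun y : ℝ => max y 0)
        fun y => Set.mem_Ici.2 (le_max_right _ _)
    exact h2.log fun y => hne _ (le_max_right _ _)
  have hℓadd : ∀ a b, 0 ≤ a → 0 ≤ b → ℓ (a + b) = ℓ a + ℓ b := by
    intro a b ha hb
    simp only [hℓ, max_eq_left ha, max_eq_left hb, max_eq_left (add_nonneg ha hb)]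
    rw [hadd a b ha hb, Real.log_mul (hne a ha) (hne b hb)]
  have hℓmax : ∀ y, ℓ y = ℓ (max y 0) := fun y => by simp [hℓ]
  have hℓ0 : ℓ 0 = 0 := by simp [hℓ, h1]
  -- Since `ℓ` depends only on the positive part of its argument, $\ell(y)-\ell(-y)$ is the odd
  -- extension of the additive function from the half-line.
  let L : ℝ →+ ℝ :=
    { toFun := fun y => ℓ y - ℓ (-y)
      map_zero' := by simp
      map_add' := by
        intro x y
        have hp : ∀ z : ℝ, max z 0 - max (-z) 0 = z := fun z => by
          rcases le_total 0 z with h | h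
          · rw [max_eq_left h, max_eq_right (by linarith)]; ring
          · rw [max_eq_right h, max_eq_left (by linarith)]; ring
        have e : max (x + y) 0 + (max (-x) 0 + max (-y) 0) =
            max (-(x + y)) 0 + (max x 0 + max y 0) := by
          linarith [hp x, hp y, hp (x + y)]
        have e' := congrArg ℓ e
        have n1 := fun z : ℝ => le_max_right z 0
        rw [hℓadd _ _ (n1 _) (add_nonneg (n1 _) (n1 _)), hℓadd _ _ (n1 _) (n1 _),
          hℓadd _ _ (n1 _) (add_nonneg (n1 _) (n1 _)), hℓadd _ _ (n1 _) (n1 _),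
          ← hℓmax, ← hℓmax, ← hℓmax, ← hℓmax, ← hℓmax, ← hℓmax] at e'
        linarith }
  have hL : ∀ y, L y = ℓ y - ℓ (-y) := fun _ => rfl
  have hLc : Continuous L := hℓc.sub (hℓc.comp continuous_neg)
  have hLlin : ∀ y : ℝ, L y = y * L 1 := fun y => by
    have := (L.toRealLinearMap hLc).map_smul y 1
    simpa using this
  have hℓlin : ∀ y : ℝ, 0 ≤ y → ℓ y = y * ℓ 1 := by
    have h2 : ∀ y : ℝ, 0 ≤ y → ℓ (-y) = 0 := fun y hy => by
      rw [hℓmax, max_eq_right (by linarith), hℓ0]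
    intro y hy
    have h3 := hLlin y
    rw [hL, hL, h2 y hy, h2 1 zero_le_one, sub_zero, sub_zero] at h3
    exact h3
  have hp : 0 ≤ -ℓ 1 := by
    have h2 : ℓ 1 ≤ 0 := by
      simp only [hℓ]
      exact Real.log_nonpos (hpos _ (le_max_right _ _)).le (hle _ (hexp _ (le_max_right _ _)))
    linarith
  have hIoc : ∀ x ∈ Set.Ioc (0 : ℝ) 1, f x = x ^ (-ℓ 1) := by
    intro x hx
    have hy : 0 ≤ -Real.log x := by linarith [Real.log_nonpos hx.1.le hx.2]
    have h2 := hℓlin _ hy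
    have h3 : Real.exp (-(-Real.log x)) = x := by rw [neg_neg, Real.exp_log hx.1]
    have h4 := hpos _ hy
    rw [h3] at h4
    have h5 : ℓ (-Real.log x) = Real.log (f x) := by
      simp only [hℓ]
      rw [max_eq_left hy, h3]
    rw [h5] at h2
    rw [Real.rpow_def_of_pos hx.1, ← Real.exp_log h4, h2]
    congr 1
    ring
  refine ⟨-ℓ 1, hp, fun x hx => ?_⟩
  -- At $x=0$ the logarithm is unavailable; continuity of both sides settles it, including $p=0$
  -- with $0^0=1$.
  rcases hx.1.eq_or_lt with rfl | h0
  · have hnb : (𝓝[Set.Ioc (0 : ℝ) 1] 0).NeBot := by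
      rw [nhdsWithin_Ioc_eq_nhdsGT zero_lt_one]; infer_instance
    have h2 : Tendsto f (𝓝[Set.Ioc (0 : ℝ) 1] 0) (𝓝 (f 0)) :=
      (hc 0 ⟨le_rfl, zero_le_one⟩).mono Set.Ioc_subset_Icc_self
    have h3 : Tendsto (fun x : ℝ => x ^ (-ℓ 1)) (𝓝[Set.Ioc (0 : ℝ) 1] 0) (𝓝 (0 ^ (-ℓ 1))) :=
      ((Real.continuous_rpow_const hp).tendsto 0).mono_left nhdsWithin_le_nhds
    refine tendsto_nhds_unique h2 (h3.congr' ?_)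
    filter_upwards [self_mem_nhdsWithin] with y hy
    exact (hIoc y hy).symm
  · exact hIoc x ⟨h0, hx.2⟩

variable {n : ℕ → ℕ} {χ : LimitGroup n → ℂ}

/-! ### Values at involutions -/

theorem exists_evenInvolution_near (hn : ∀ k, 1 < n k) {x : ℝ} (h0 : 0 ≤ x) (h1 : x ≤ 1) :
    ∃ e : ℕ → LimitGroup n, (∀ j, IsEvenInvolution (e j)) ∧
      Tendsto (fun j => moved hn (e j)) atTop (𝓝 x) := by
  choose e he1 he2 using fun j => exists_evenInvolution hn
    (floor_quarter h0 h1 (N n j) (N_pos hn j)).1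
  refine ⟨e, he1, ?_⟩
  have h2 : Tendsto (fun j => 4 / (N n j : ℝ)) atTop (𝓝 0) :=
    tendsto_const_nhds.div_atTop (tendsto_natCast_atTop_atTop.comp (tendsto_N hn))
  refine tendsto_iff_dist_tendsto_zero.2 (squeeze_zero (fun _ => dist_nonneg) (fun j => ?_) h2)
  rw [he2, dist_comm, Real.dist_eq]
  exact (floor_quarter h0 h1 (N n j) (N_pos hn j)).2

theorem exists_tailInvolution_near (hn : ∀ k, 1 < n k) {x : ℝ} (h0 : 0 ≤ x) (h1 : x ≤ 1) (j : ℕ)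
    {δ : ℝ} (hδ : 0 < δ) :
    ∃ y : LimitGroup n, IsEvenInvolution y ∧ |x - moved hn y| ≤ δ ∧
      (∀ s ∈ stage n j, s * y = y * s) ∧
      ∀ s ∈ stage n j, 1 - moved hn (s * y) = (1 - moved hn s) * (1 - moved hn y) := by
  obtain ⟨L, hL⟩ := exists_nat_gt (4 / δ)
  obtain ⟨l, hl, hjl⟩ := (((tendsto_N_div hn j).eventually_ge_atTop (max L 1)).and
    (eventually_ge_atTop j)).exists
  have hZ : 0 < N n l / N n j := (le_max_right L 1).trans hl
  obtain ⟨h2, h3⟩ := floor_quarter h0 h1 _ hZ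
  obtain ⟨τ, hτ1, hτ2⟩ := exists_involution (α := Fin (N n l / N n j))
    (r := 2 * ⌊x * (N n l / N n j : ℕ) / 4⌋₊) (by rw [Fintype.card_fin]; omega)
  have hm : moved hn (tailLevel n hjl τ) =
      4 * ⌊x * (N n l / N n j : ℕ) / 4⌋₊ / (N n l / N n j : ℕ) := by
    rw [moved_tailLevel, hτ2]
    push_cast
    ring
  refine ⟨tailLevel n hjl τ, ⟨by rw [← map_mul, hτ1, _root_.map_one], sgnInf_tailLevel hjl ?_⟩, ?_,
    fun s hs => tailLevel_commute hjl τ hs, fun s hs => ?_⟩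
  · obtain ⟨r, h4, h5⟩ := involution_card_support hτ1
    rw [hτ2] at h4
    rw [h5, ← Nat.eq_of_mul_eq_mul_left two_pos h4, pow_mul]
    simp
  · rw [hm]
    refine h3.trans ?_
    have hZr : (0 : ℝ) < (N n l / N n j : ℕ) := by exact_mod_cast hZ
    have h6 : (L : ℝ) ≤ (N n l / N n j : ℕ) := by exact_mod_cast (le_max_left L 1).trans hl
    rw [div_lt_iff₀ hδ] at hL
    rw [div_le_iff₀ hZr]
    nlinarith
  · rw [moved_mul_tailLevel hn hjl hs, moved_tailLevel]

theorem IsEvenInvolution.mul (hn : ∀ k, 1 < n k) {s t : LimitGroup n} (hs : IsEvenInvolution s)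
    (ht : IsEvenInvolution t) (hst : s * t = t * s) : IsEvenInvolution (s * t) := by
  refine ⟨?_, by rw [sgnInf_mul hn, hs.2, ht.2, one_mul]⟩
  rw [mul_assoc, ← mul_assoc t, ← hst, mul_assoc, ht.1, mul_one, hs.1]

/-- The proportions moved by even involutions are dense in $[0,1]$, so the modulus of continuity
extends $\chi$ to a continuous profile `F`. Pairing an involution with one deep in the tail makes
both $\chi$ and the proportion of fixed points multiplicative, giving the functional equation of
`F`. -/
theorem IsAsympMul.exists_rpow_even (hn : ∀ k, 1 < n k) (h : IsAsympMul (stage n) χ)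
    (hχ : IsCharacter χ) (hne : ∃ g, g ≠ 1 ∧ χ g ≠ 0) :
    ∃ p : ℝ, 0 ≤ p ∧ ∀ t, IsEvenInvolution t → χ t = (((1 - moved hn t) ^ p : ℝ) : ℂ) := by
  -- The approximation property is quantified over all moduli $(\varepsilon,\delta)$, so that one
  -- choice of `z` serves every $\varepsilon$.
  have hlim : ∀ x : ℝ, ∃ z : ℝ, x ∈ Set.Icc (0 : ℝ) 1 → ∀ ε : ℝ, 0 < ε → ∀ δ : ℝ,
      (∀ t t', IsEvenInvolution t → IsEvenInvolution t' →
        |moved hn t - moved hn t'| < δ → ‖χ t - χ t'‖ ≤ ε) →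
      ∀ t, IsEvenInvolution t → |x - moved hn t| < δ → ‖(z : ℂ) - χ t‖ ≤ ε := by
    intro x
    by_cases hx : x ∈ Set.Icc (0 : ℝ) 1
    · obtain ⟨e, he, hm⟩ := exists_evenInvolution_near hn hx.1 hx.2
      obtain ⟨z, hz⟩ := exists_tendsto_ultrafilter (hyperfilter ℕ) fun j => hχ.norm_le_one (e j)
      have hzr : z = (z.re : ℂ) := by
        refine tendsto_nhds_unique hz ?_
        refine ((Complex.continuous_ofReal.comp Complex.continuous_re).tendsto z).comp hz |>.congr
          fun j => ?_
        exact (hχ.eq_re_of_mul_self (he j).1).symm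
      refine ⟨z.re, fun _ ε hε δ hδ t ht hxt => ?_⟩
      rw [← hzr]
      have h2 : Tendsto (fun j => ‖χ (e j) - χ t‖) (hyperfilter ℕ : Filter ℕ) (𝓝 ‖z - χ t‖) :=
        (hz.sub_const _).norm
      refine le_of_tendsto h2 ?_
      have h3 : Tendsto (fun j => |moved hn (e j) - moved hn t|) (hyperfilter ℕ : Filter ℕ)
          (𝓝 |x - moved hn t|) :=
        ((hm.mono_left Nat.hyperfilter_le_atTop).sub_const _).abs
      filter_upwards [h3.eventually_lt_const hxt] with j hj
      exact hδ _ _ (he j) ht hj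
    · exact ⟨0, fun h' => absurd h' hx⟩
  choose F hF using hlim
  have hprof : ∀ ε : ℝ, 0 < ε → ∃ δ : ℝ, 0 < δ ∧ ∀ x ∈ Set.Icc (0 : ℝ) 1, ∀ t,
      IsEvenInvolution t → |x - moved hn t| < δ → ‖(F x : ℂ) - χ t‖ ≤ ε := by
    intro ε hε
    obtain ⟨δ, hδ, hd⟩ := h.exists_modulus hn hχ hne hε
    exact ⟨δ, hδ, fun x hx t ht hxt => hF x hx ε hε δ hd t ht hxt⟩
  have hval : ∀ t, IsEvenInvolution t → (F (moved hn t) : ℂ) = χ t := by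
    intro t ht
    rw [← sub_eq_zero, ← norm_le_zero_iff]
    refine le_of_forall_pos_le_add fun ε hε => ?_
    obtain ⟨δ, hδ, hd⟩ := hprof ε hε
    rw [zero_add]
    exact hd _ ⟨moved_nonneg hn t, moved_le_one hn t⟩ t ht (by simpa using hδ)
  have hcont : ContinuousOn F (Set.Icc 0 1) := by
    rw [Metric.continuousOn_iff]
    intro x hx ε hε
    obtain ⟨δ, hδ, hd⟩ := hprof (ε / 3) (by positivity)
    refine ⟨δ / 2, by positivity, fun y hy hyx => ?_⟩
    obtain ⟨t, ht, htx, -⟩ := exists_tailInvolution_near hn hx.1 hx.2 0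
      (by positivity : 0 < δ / 4)
    have h2 := hd x hx t ht (by linarith)
    have h3 := hd y hy t ht (by
      rw [Real.dist_eq] at hyx
      have := abs_sub_le y x (moved hn t)
      linarith)
    rw [Real.dist_eq, ← Real.norm_eq_abs, ← Complex.norm_real, Complex.ofReal_sub]
    have h4 := norm_sub_le_norm_sub_add_norm_sub (F y : ℂ) (χ t) (F x : ℂ)
    rw [norm_sub_rev (χ t)] at h4
    linarith
  have hmul : ∀ x ∈ Set.Icc (0 : ℝ) 1, ∀ y ∈ Set.Icc (0 : ℝ) 1,
      F (1 - (1 - x) * (1 - y)) = F x * F y := by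
    intro x hx y hy
    have hxy : 1 - (1 - x) * (1 - y) ∈ Set.Icc (0 : ℝ) 1 := by
      obtain ⟨hx0, hx1⟩ := hx
      obtain ⟨hy0, hy1⟩ := hy
      constructor <;> nlinarith
    rw [← Complex.ofReal_inj, ← sub_eq_zero, ← norm_le_zero_iff]
    refine le_of_forall_pos_le_add fun ε hε => ?_
    rw [zero_add]
    obtain ⟨δ, hδ, hd⟩ := hprof (ε / 4) (by positivity)
    obtain ⟨s, hs, hsx, -⟩ := exists_tailInvolution_near hn hx.1 hx.2 0
      (by positivity : 0 < δ / 4)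
    obtain ⟨j₀, hj₀⟩ := h.norm_mul_sub_le hχ s (by positivity : 0 < ε / 4)
    obtain ⟨i, hi⟩ := exists_mem_stage s
    have hsj : s ∈ stage n (max j₀ i) := stage_mono (le_max_right _ _) hi
    obtain ⟨t, ht, hty, htc, htm⟩ := exists_tailInvolution_near hn hy.1 hy.2 (max j₀ i)
      (by positivity : 0 < δ / 4)
    have h2 := hd x hx s hs (by linarith)
    have h3 := hd y hy t ht (by linarith)
    have h4 := hj₀ _ (le_max_left _ _) t htc
    have h5 := hd _ hxy (s * t) (hs.mul hn ht (htc s hsj)) (by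
      have e1 : 1 - (1 - x) * (1 - y) - moved hn (s * t) =
          (1 - y) * (x - moved hn s) + (1 - moved hn s) * (y - moved hn t) := by
        linear_combination htm s hsj
      have e2 := moved_nonneg hn s
      have e3 := moved_le_one hn s
      have e4 : |(1 - y) * (x - moved hn s)| ≤ δ / 4 := by
        rw [abs_mul, abs_of_nonneg (by linarith [hy.2])]
        nlinarith [abs_nonneg (x - moved hn s), hy.1, hy.2]
      have e5 : |(1 - moved hn s) * (y - moved hn t)| ≤ δ / 4 := by
        rw [abs_mul, abs_of_nonneg (by linarith)]
        nlinarith [abs_nonneg (y - moved hn t)]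
      rw [e1]
      have := abs_add_le ((1 - y) * (x - moved hn s)) ((1 - moved hn s) * (y - moved hn t))
      linarith)
    have hFy : ‖(F y : ℂ)‖ ≤ 1 := by
      refine le_of_forall_pos_le_add fun ε' hε' => ?_
      obtain ⟨δ', hδ', hd'⟩ := hprof ε' hε'
      obtain ⟨t', ht', hty', -⟩ := exists_tailInvolution_near hn hy.1 hy.2 0 (half_pos hδ')
      have e1 := hd' y hy t' ht' (by linarith)
      have e2 := norm_sub_norm_le (F y : ℂ) (χ t')
      linarith [hχ.norm_le_one t']
    have h6 : ((F (1 - (1 - x) * (1 - y)) : ℝ) : ℂ) - ((F x * F y : ℝ) : ℂ) =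
        ((F (1 - (1 - x) * (1 - y)) : ℂ) - χ (s * t)) + (χ (s * t) - χ s * χ t) -
          χ s * (F y - χ t) - (F x - χ s) * F y := by
      push_cast; ring
    rw [h6]
    refine (norm_sub_le _ _).trans ?_
    have h7 := norm_sub_le ((F (1 - (1 - x) * (1 - y)) : ℂ) - χ (s * t) +
      (χ (s * t) - χ s * χ t)) (χ s * (F y - χ t))
    have h8 := norm_add_le ((F (1 - (1 - x) * (1 - y)) : ℂ) - χ (s * t)) (χ (s * t) - χ s * χ t)
    have h9 : ‖χ s * ((F y : ℂ) - χ t)‖ ≤ ε / 4 := by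
      rw [norm_mul]
      exact (mul_le_of_le_one_left (norm_nonneg _) (hχ.norm_le_one s)).trans h3
    have h10 : ‖((F x : ℂ) - χ s) * F y‖ ≤ ε / 4 := by
      rw [norm_mul]
      exact (mul_le_of_le_one_right (norm_nonneg _) hFy).trans h2
    linarith
  have hflip : ∀ x ∈ Set.Icc (0 : ℝ) 1, 1 - x ∈ Set.Icc (0 : ℝ) 1 := fun x hx =>
    ⟨by linarith [hx.2], by linarith [hx.1]⟩
  have hle : ∀ x ∈ Set.Icc (0 : ℝ) 1, F x ≤ 1 := by
    intro x hx
    refine le_of_forall_pos_le_add fun ε' hε' => ?_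
    obtain ⟨δ', hδ', hd'⟩ := hprof ε' hε'
    obtain ⟨t', ht', hty', -⟩ := exists_tailInvolution_near hn hx.1 hx.2 0 (half_pos hδ')
    have e1 := hd' x hx t' ht' (by linarith)
    have e2 := norm_sub_norm_le (F x : ℂ) (χ t')
    rw [Complex.norm_real] at e2
    linarith [hχ.norm_le_one t', Real.le_norm_self (F x)]
  obtain ⟨p, hp, hpow⟩ := exists_rpow_of_multiplicative (f := fun x => F (1 - x))
    (hcont.comp (by fun_prop) hflip)
    (fun x hx y hy => by
      have := hmul _ (hflip x hx) _ (hflip y hy)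
      rw [sub_sub_cancel, sub_sub_cancel] at this
      exact this)
    (by
      have h2 := hval 1 ⟨one_mul 1, sgnInf_one hn⟩
      rw [moved_one, hχ.map_one] at h2
      rw [sub_self]
      exact_mod_cast h2)
    (fun x hx => hle _ (hflip x hx))
  refine ⟨p, hp, fun t ht => ?_⟩
  have h2 := hpow _ (hflip _ ⟨moved_nonneg hn t, moved_le_one hn t⟩)
  simp only [sub_sub_cancel] at h2
  rw [← hval t ht, h2]

end SymLimit

namespace SymLimit

/-- $\chi(b)\xi$ is the projection of $\pi(b)\xi$ to the line of $\xi$, at squared distance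
$1-|\chi(b)|^2$. Thus $\chi$ is nearly multiplicative at any $b$ with $|\chi(b)|$ near 1. -/
theorem IsCharacter.norm_mul_sub_sq_le {G : Type*} [Group G] {χ : G → ℂ} (hχ : IsCharacter χ)
    (a b : G) : ‖χ (a * b) - χ a * χ b‖ ^ 2 ≤ 1 - ‖χ b‖ ^ 2 := by
  obtain ⟨H, i1, i2, i3, π, ρ, ξ, h⟩ := hχ.exists_biGNS
  have h0 : ‖ξ‖ = 1 := by simpa using h.toIsGNS.norm_apply hχ 1
  have h1 := norm_inner_le_norm (𝕜 := ℂ) ((π a⁻¹ : H →L[ℂ] H) ξ)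
    ((π b : H →L[ℂ] H) ξ - χ b • ξ)
  have h2 := h.toIsGNS.inner_apply a⁻¹ 1
  rw [_root_.map_one, mul_one, inv_inv] at h2
  have h3 : inner ℂ ((π a⁻¹ : H →L[ℂ] H) ξ) ξ = χ a := h2
  rw [inner_sub_right, inner_smul_right, h.toIsGNS.inner_apply, inv_inv, h3,
    h.toIsGNS.norm_apply hχ, one_mul, mul_comm (χ b)] at h1
  have h4 : ‖(π b : H →L[ℂ] H) ξ - χ b • ξ‖ ^ 2 = 1 - ‖χ b‖ ^ 2 := by
    have e1 : inner ℂ ((π b : H →L[ℂ] H) ξ) ξ = starRingEnd ℂ (χ b) := by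
      rw [← inner_conj_symm, ← h.apply_eq]
    have e2 : RCLike.re (inner ℂ ((π b : H →L[ℂ] H) ξ) (χ b • ξ)) = ‖χ b‖ ^ 2 := by
      rw [inner_smul_right, e1, Complex.mul_conj, Complex.normSq_eq_norm_sq]
      exact Complex.ofReal_re _
    rw [_root_.norm_sub_sq (𝕜 := ℂ), h.toIsGNS.norm_apply hχ, e2, norm_smul, h0]
    ring
  rw [← h4]
  exact pow_le_pow_left₀ (norm_nonneg _) h1 2

variable {n : ℕ → ℕ} {χ : LimitGroup n → ℂ}

/-! ### Odd involutions -/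

theorem one_lt_N (hn : ∀ k, 1 < n k) (l : ℕ) : 1 < N n l :=
  (hn 0).trans_le (Nat.le_of_dvd (N_pos hn l) (by simpa [N] using N_dvd n (Nat.zero_le l)))

/-- An element that stays odd forces all later quotients $N_j/N_l$ to be odd, and then embeddings
preserve signs. -/
theorem sgnInf_level_eq_sign (hn : ∀ k, 1 < n k) {g : LimitGroup n} (hg : sgnInf n g = -1) :
    ∀ᶠ l in atTop, ∀ τ : Equiv.Perm (Fin (N n l)),
      sgnInf n (level n l τ) = ((Equiv.Perm.sign τ : ℤ) : ℂ) := by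
  obtain ⟨i, hi⟩ := exists_level g
  obtain ⟨i', hi'⟩ := eventually_atTop.1 (eventually_sign_eq hn g)
  filter_upwards [eventually_ge_atTop (max i i')] with l hl τ
  obtain ⟨σ, rfl⟩ := hi l (le_of_max_le_left hl)
  obtain ⟨j, hj, hlj⟩ := ((eventually_sign_eq hn (level n l τ)).and
    (eventually_ge_atTop l)).exists
  have h1 := hi' l (le_of_max_le_right hl) σ rfl
  have h2 := hi' j ((le_of_max_le_right hl).trans hlj) _ (level_embed hlj σ)
  have h3 := hj _ (level_embed hlj τ)
  rw [hg] at h1 h2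
  rw [sign_embed] at h2 h3
  have h4 : Equiv.Perm.sign σ = -1 := by
    rcases Int.units_eq_one_or (Equiv.Perm.sign σ) with h | h
    · rw [h] at h1; norm_num at h1
    · exact h
  have h5 : Odd (N n j / N n l) := by
    by_contra h
    rw [Nat.not_odd_iff_even] at h
    rw [h4, h.neg_one_pow] at h2
    norm_num at h2
  rw [← h3]
  rcases Int.units_eq_one_or (Equiv.Perm.sign τ) with h | h
  · rw [h, one_pow]
  · rw [h, h5.neg_one_pow]

theorem moved_level_swap (hn : ∀ k, 1 < n k) {l : ℕ} {a b : Fin (N n l)} (hab : a ≠ b) :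
    moved hn (level n l (Equiv.swap a b)) = 2 / N n l := by
  rw [moved_level, Equiv.Perm.card_support_swap hab]
  norm_num

theorem level_swap_mul_self {l : ℕ} (a b : Fin (N n l)) :
    level n l (Equiv.swap a b) * level n l (Equiv.swap a b) = 1 := by
  rw [← map_mul, Equiv.swap_mul_self, _root_.map_one]

theorem tendsto_two_div_N (hn : ∀ k, 1 < n k) :
    Tendsto (fun l => 2 / (N n l : ℝ)) atTop (𝓝 0) :=
  tendsto_const_nhds.div_atTop (tendsto_natCast_atTop_atTop.comp (tendsto_N hn))

theorem mul_mul_self_of_commute {G : Type*} [Group G] {a b : G} (ha : a * a = 1) (hb : b * b = 1)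
    (hab : a * b = b * a) : (a * b) * (a * b) = 1 := by
  rw [mul_assoc, ← mul_assoc b, ← hab, mul_assoc, hb, mul_one, ha]

/-- A small odd involution becomes even when multiplied by a suitable transposition. -/
theorem exists_swap_disjoint (hn : ∀ k, 1 < n k) {g t : LimitGroup n} (hg : sgnInf n g = -1)
    (hgg : g * g = 1) {δ : ℝ} (hδ : moved hn g < δ) (hlt : moved hn g < 1 / 4) :
    ∃ r, r * r = 1 ∧ IsEvenInvolution (t * g * t⁻¹ * r) ∧ IsEvenInvolution (r * g) ∧
      moved hn (t * g * t⁻¹ * r) < δ ∧ moved hn (r * g) < δ := by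
  obtain ⟨j₀, hj₀⟩ := exists_level_pair g t
  obtain ⟨l, hl, h1, h2, h3⟩ := ((sgnInf_level_eq_sign hn hg).and ((eventually_ge_atTop j₀).and
    (((tendsto_two_div_N hn).eventually_lt_const (sub_pos.2 hδ)).and
      ((tendsto_two_div_N hn).eventually_lt_const (by norm_num : (0 : ℝ) < 1 / 2))))).exists
  obtain ⟨⟨σ, rfl⟩, τ, rfl⟩ := hj₀ l h1
  have hNl := N_real_pos hn l
  set S := σ.support ∪ (τ * σ * τ⁻¹).support with hS
  have hcard : 1 < Sᶜ.card := by
    have e1 : S.card ≤ σ.support.card + σ.support.card := by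
      refine (Finset.card_union_le _ _).trans_eq ?_
      rw [Equiv.Perm.card_support_conj]
    have e2 : (S.card : ℝ) ≤ σ.support.card + σ.support.card := by exact_mod_cast e1
    rw [moved_level, div_lt_iff₀ hNl] at hlt
    rw [div_lt_iff₀ hNl] at h3
    have e3 : (Sᶜ.card : ℝ) = N n l - S.card := by
      rw [Finset.card_compl, Nat.cast_sub (Finset.card_le_univ _), Fintype.card_fin]
    have e4 : (1 : ℝ) < Sᶜ.card := by linarith
    exact_mod_cast e4
  obtain ⟨a, ha, b, hb, hab⟩ := Finset.one_lt_card.1 hcard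
  simp only [hS, Finset.mem_compl, Finset.mem_union, not_or] at ha hb
  have hc1 : σ * Equiv.swap a b = Equiv.swap a b * σ := by
    rw [Equiv.mul_swap_eq_swap_mul, Equiv.Perm.notMem_support.1 ha.1,
      Equiv.Perm.notMem_support.1 hb.1]
  have hc2 : (τ * σ * τ⁻¹) * Equiv.swap a b = Equiv.swap a b * (τ * σ * τ⁻¹) := by
    rw [Equiv.mul_swap_eq_swap_mul, Equiv.Perm.notMem_support.1 ha.2,
      Equiv.Perm.notMem_support.1 hb.2]
  have hsr : sgnInf n (level n l (Equiv.swap a b)) = -1 := by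
    rw [hl, Equiv.Perm.sign_swap hab]; norm_num
  have hr := level_swap_mul_self (n := n) a b
  have hmr := moved_level_swap hn hab
  have hcc : level n l τ * level n l σ * (level n l τ)⁻¹ = level n l (τ * σ * τ⁻¹) := by
    rw [map_mul, map_mul, map_inv]
  refine ⟨level n l (Equiv.swap a b), hr, ⟨?_, ?_⟩, ⟨?_, ?_⟩, ?_, ?_⟩
  · refine mul_mul_self_of_commute ?_ hr ?_
    · have : level n l τ * level n l σ * (level n l τ)⁻¹ *
          (level n l τ * level n l σ * (level n l τ)⁻¹) =
          level n l τ * (level n l σ * level n l σ) * (level n l τ)⁻¹ := by group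
      rw [this, hgg]
      group
    · rw [hcc, ← map_mul, hc2, map_mul]
  · rw [sgnInf_mul hn, sgnInf_conj hn, hsr, hg]; norm_num
  · exact mul_mul_self_of_commute hr hgg (by rw [← map_mul, ← hc1, map_mul])
  · rw [sgnInf_mul hn, hsr, hg]; norm_num
  · have := moved_mul_le hn (level n l τ * level n l σ * (level n l τ)⁻¹)
      (level n l (Equiv.swap a b))
    rw [moved_conj, hmr] at this
    linarith
  · have := moved_mul_le hn (level n l (Equiv.swap a b)) (level n l σ)
    rw [hmr] at this
    linarith

/-- Each $tgt^{-1}g$ equals $(tgt^{-1}r)(rg)$ with $r$ a transposition disjoint from both, a product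
of two small even involutions. The mean over $t$ tends to $\chi(g)^2$. -/
theorem IsAsympMul.le_norm_sq_of_odd (hn : ∀ k, 1 < n k) (h : IsAsympMul (stage n) χ)
    (hχ : IsCharacter χ) {ε δ : ℝ}
    (hd : ∀ t, IsEvenInvolution t → moved hn t < δ → 1 - ε ≤ (χ t).re) {g : LimitGroup n}
    (hg : sgnInf n g = -1) (hgg : g * g = 1) (hδ : moved hn g < δ) (hlt : moved hn g < 1 / 4) :
    1 - 4 * ε ≤ ‖χ g‖ ^ 2 := by
  have h1 : ∀ t : LimitGroup n, 1 - 4 * ε ≤ (χ (t * g * t⁻¹ * g)).re := by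
    intro t
    obtain ⟨r, hr, e1, e2, m1, m2⟩ := exists_swap_disjoint hn (t := t) hg hgg hδ hlt
    have e3 := hχ.one_sub_re_mul_le (t * g * t⁻¹ * r) (r * g)
    have e4 : t * g * t⁻¹ * r * (r * g) = t * g * t⁻¹ * g := by
      rw [mul_assoc _ r, ← mul_assoc r, hr, one_mul]
    rw [e4] at e3
    linarith [hd _ e1 m1, hd _ e2 m2]
  have h2 : ∀ j, 1 - 4 * ε ≤ (conjAvg (stage n) χ g g j).re := by
    intro j
    have hc : (0 : ℝ) < Fintype.card (stage n j) := by exact_mod_cast Fintype.card_pos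
    have e1 : (conjAvg (stage n) χ g g j).re = (Fintype.card (stage n j) : ℝ)⁻¹ *
        ∑ t : stage n j, (χ (t * g * (t : LimitGroup n)⁻¹ * g)).re := by
      rw [conjAvg, ← Complex.re_sum, ← Complex.re_ofReal_mul]
      push_cast
      rfl
    have e2 : ∑ _t : stage n j, (1 - 4 * ε) ≤
        ∑ t : stage n j, (χ (t * g * (t : LimitGroup n)⁻¹ * g)).re :=
      Finset.sum_le_sum fun t _ => h1 t
    rw [Finset.sum_const, Finset.card_univ, nsmul_eq_mul] at e2
    rw [e1, inv_mul_eq_div, le_div_iff₀ hc]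
    linarith
  have h3 := ge_of_tendsto' ((Complex.continuous_re.tendsto _).comp (h g g)) h2
  refine h3.trans ((Complex.re_le_norm _).trans_eq ?_)
  rw [norm_mul, sq]

/-- Transpositions $r_l$ of stage $l$ satisfy $|\chi(r_l)|\to1$, so multiplying by one multiplies
$\chi$ asymptotically while turning an odd involution into an even one of almost the same size. The
sign $c$ is an ultrafilter limit of $\chi(r_l)$. -/
theorem IsAsympMul.exists_odd_sign (hn : ∀ k, 1 < n k) (h : IsAsympMul (stage n) χ)
    (hχ : IsCharacter χ) (hne : ∃ g, g ≠ 1 ∧ χ g ≠ 0) {p : ℝ} (hp : 0 ≤ p)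
    (heven : ∀ t, IsEvenInvolution t → χ t = (((1 - moved hn t) ^ p : ℝ) : ℂ)) :
    ∃ c : ℂ, (c = 1 ∨ c = -1) ∧ ∀ t, t * t = 1 → sgnInf n t = -1 →
      χ t = c * (((1 - moved hn t) ^ p : ℝ) : ℂ) := by
  by_cases hodd : ∃ g : LimitGroup n, sgnInf n g = -1
  swap
  · push Not at hodd
    exact ⟨1, Or.inl rfl, fun t _ ht => absurd ht (hodd t)⟩
  obtain ⟨g₀, hg₀⟩ := hodd
  have hsign := sgnInf_level_eq_sign hn hg₀
  let a : ∀ l, Fin (N n l) := fun l => ⟨0, N_pos hn l⟩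
  let b : ∀ l, Fin (N n l) := fun l => ⟨1, one_lt_N hn l⟩
  have hab : ∀ l, a l ≠ b l := fun l h => by simp [a, b] at h
  set r : ℕ → LimitGroup n := fun l => level n l (Equiv.swap (a l) (b l)) with hr
  have hrr : ∀ l, r l * r l = 1 := fun l => level_swap_mul_self _ _
  have hmr : ∀ l, moved hn (r l) = 2 / N n l := fun l => moved_level_swap hn (hab l)
  have hsr : ∀ᶠ l in atTop, sgnInf n (r l) = -1 := by
    filter_upwards [hsign] with l hl
    rw [hr, hl, Equiv.Perm.sign_swap (hab l)]
    norm_num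
  have hnorm : Tendsto (fun l => Real.sqrt (1 - ‖χ (r l)‖ ^ 2)) atTop (𝓝 0) := by
    rw [← Real.sqrt_zero]
    refine (Real.continuous_sqrt.tendsto 0).comp ?_
    refine Metric.tendsto_atTop'.2 fun ε hε => ?_
    obtain ⟨δ, hδ, hd⟩ := h.exists_near_one hn hχ hne (by positivity : 0 < ε / 8)
    obtain ⟨L, hL⟩ := eventually_atTop.1 (hsr.and
      (((tendsto_two_div_N hn).eventually_lt_const hδ).and
        ((tendsto_two_div_N hn).eventually_lt_const (by norm_num : (0 : ℝ) < 1 / 4))))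
    refine ⟨L, fun l hl => ?_⟩
    obtain ⟨h1, h2, h3⟩ := hL l hl.le
    have h4 := h.le_norm_sq_of_odd hn hχ hd h1 (hrr l) (by rw [hmr]; exact h2)
      (by rw [hmr]; exact h3)
    have h5 : ‖χ (r l)‖ ^ 2 ≤ 1 := pow_le_one₀ (norm_nonneg _) (hχ.norm_le_one _)
    rw [Real.dist_eq, sub_zero, abs_of_nonneg (by linarith)]
    linarith
  have hlim : ∀ g, g * g = 1 → sgnInf n g = -1 →
      Tendsto (fun l => χ g * χ (r l)) atTop (𝓝 (((1 - moved hn g) ^ p : ℝ) : ℂ)) := by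
    intro g hgg hg
    obtain ⟨j₀, hj₀⟩ := exists_level g
    have hex : ∀ᶠ l in atTop, ∃ s : LimitGroup n, χ s = χ (r l) ∧ IsEvenInvolution (g * s) ∧
        |moved hn (g * s) - moved hn g| ≤ 2 / N n l := by
      filter_upwards [hsign, eventually_ge_atTop j₀] with l hl hjl
      obtain ⟨σ, rfl⟩ := hj₀ l hjl
      have hσ : σ * σ = 1 := level_injective hn l (by rw [map_mul, hgg, _root_.map_one])
      -- The transposition is taken from a 2-cycle of $\sigma$ itself: it commutes with $\sigma$ and
      -- exists even if $\sigma$ has no fixed points.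
      obtain ⟨x, hx⟩ : ∃ x, σ x ≠ x := by
        by_contra! h'
        rw [show σ = 1 from Equiv.ext h', _root_.map_one, sgnInf_one hn] at hg
        norm_num at hg
      have hxx : σ (σ x) = x := by
        rw [← Equiv.Perm.mul_apply, hσ]; rfl
      have hms := moved_level_swap hn hx.symm
      have hss := level_swap_mul_self (n := n) x (σ x)
      refine ⟨level n l (Equiv.swap x (σ x)), ?_, ⟨?_, ?_⟩, ?_⟩
      · exact hχ.eq_of_moved_eq hn hss (hrr l) (by rw [hms, hmr])
      · refine mul_mul_self_of_commute hgg hss ?_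
        rw [← map_mul, ← map_mul, Equiv.mul_swap_eq_swap_mul, hxx, Equiv.swap_comm]
      · rw [sgnInf_mul hn, hg, hl, Equiv.Perm.sign_swap hx.symm]
        norm_num
      · have e1 := moved_mul_le hn (level n l σ) (level n l (Equiv.swap x (σ x)))
        have e2 := moved_mul_le hn (level n l σ * level n l (Equiv.swap x (σ x)))
          (level n l (Equiv.swap x (σ x)))
        rw [mul_assoc, hss, mul_one] at e2
        rw [hms] at e1 e2
        rw [abs_le]
        constructor <;> linarith
    obtain ⟨L, hL⟩ := eventually_atTop.1 hex
    choose! s hs1 hs2 hs3 using hL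
    have hm : Tendsto (fun l => moved hn (g * s l)) atTop (𝓝 (moved hn g)) := by
      refine tendsto_iff_dist_tendsto_zero.2 (squeeze_zero' (Eventually.of_forall fun _ =>
        dist_nonneg) ?_ (tendsto_two_div_N hn))
      filter_upwards [eventually_ge_atTop L] with l hl
      exact hs3 l hl
    have h1 : Tendsto (fun l => χ (g * s l)) atTop (𝓝 (((1 - moved hn g) ^ p : ℝ) : ℂ)) := by
      have h2 : Tendsto (fun l => (((1 - moved hn (g * s l)) ^ p : ℝ) : ℂ)) atTop
          (𝓝 (((1 - moved hn g) ^ p : ℝ) : ℂ)) :=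
        (Complex.continuous_ofReal.tendsto _).comp
          (((Real.continuous_rpow_const hp).tendsto _).comp (hm.const_sub 1))
      refine h2.congr' ?_
      filter_upwards [eventually_ge_atTop L] with l hl
      exact (heven _ (hs2 l hl)).symm
    have h2 : Tendsto (fun l => χ (g * s l) - χ g * χ (r l)) atTop (𝓝 0) := by
      refine squeeze_zero_norm' ?_ hnorm
      filter_upwards [eventually_ge_atTop L] with l hl
      have e := hχ.norm_mul_sub_sq_le g (s l)
      rw [hs1 l hl] at e
      exact Real.le_sqrt_of_sq_le e
    simpa using h1.sub h2
  obtain ⟨c, hc⟩ := exists_tendsto_ultrafilter (hyperfilter ℕ) fun l => hχ.norm_le_one (r l)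
  have hcg : ∀ g, g * g = 1 → sgnInf n g = -1 →
      χ g * c = (((1 - moved hn g) ^ p : ℝ) : ℂ) := fun g hgg hg =>
    tendsto_nhds_unique (hc.const_mul (χ g)) ((hlim g hgg hg).mono_left Nat.hyperfilter_le_atTop)
  have hcc : c * c = 1 := by
    have h1 : Tendsto (fun l => χ (r l) * c) (hyperfilter ℕ : Filter ℕ) (𝓝 1) := by
      have h2 : Tendsto (fun l => (((1 - 2 / (N n l : ℝ)) ^ p : ℝ) : ℂ)) atTop (𝓝 1) := by
        have h3 := ((Real.continuous_rpow_const hp).tendsto _).comp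
          ((tendsto_two_div_N hn).const_sub 1)
        have h4 := (Complex.continuous_ofReal.tendsto _).comp h3
        simpa [Function.comp_def, -Complex.ofReal_sub] using h4
      refine (h2.congr' ?_).mono_left Nat.hyperfilter_le_atTop
      filter_upwards [hsr] with l hl
      rw [hcg _ (hrr l) hl, hmr]
    exact tendsto_nhds_unique (hc.mul_const c) h1
  refine ⟨c, mul_self_eq_one_iff.1 hcc, fun t htt ht => ?_⟩
  rw [← hcg t htt ht]
  linear_combination (-χ t) * hcc

/-- On involutions, an asymptotically multiplicative character that does not vanish identically
off the identity is a real power of `1 - moved`, up to the factor `sgnInf`. -/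
theorem IsAsympMul.exists_rpow_involution (hn : ∀ k, 1 < n k) (h : IsAsympMul (stage n) χ)
    (hχ : IsCharacter χ) (hne : ∃ g, g ≠ 1 ∧ χ g ≠ 0) :
    ∃ p : ℝ, 0 ≤ p ∧
      ((∀ t, t * t = 1 → χ t = (((1 - moved hn t) ^ p : ℝ) : ℂ)) ∨
        ∀ t, t * t = 1 → sgnInf n t * χ t = (((1 - moved hn t) ^ p : ℝ) : ℂ)) := by
  obtain ⟨p, hp, heven⟩ := h.exists_rpow_even hn hχ hne
  obtain ⟨c, hc, hodd⟩ := h.exists_odd_sign hn hχ hne hp heven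
  refine ⟨p, hp, ?_⟩
  rcases hc with rfl | rfl
  · refine Or.inl fun t ht => ?_
    rcases sgnInf_eq_one_or t with h1 | h1
    · exact heven t ⟨ht, h1⟩
    · rw [hodd t ht h1, one_mul]
  · refine Or.inr fun t ht => ?_
    rcases sgnInf_eq_one_or t with h1 | h1
    · rw [heven t ⟨ht, h1⟩, h1, one_mul]
    · rw [hodd t ht h1, h1]
      ring

end SymLimit

namespace SymLimit

/-! ### Means of orbit vectors and word length in transpositions. -/

section

variable {G : Type*} [Group G] {χ : G → ℂ} {H : Type*} [NormedAddCommGroup H]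
  [InnerProductSpace ℂ H] [CompleteSpace H] {π : G →* unitary (H →L[ℂ] H)} {ξ : H} {F : Type*}
  [Fintype F]

theorem IsGNS.inner_orbitMean_apply (h : IsGNS χ π ξ) (f : F → G) (g : G) :
    inner ℂ (orbitMean π ξ f) ((π g : H →L[ℂ] H) ξ) =
      (Fintype.card F : ℂ)⁻¹ * ∑ w, χ ((f w)⁻¹ * g) := by
  rw [orbitMean, inner_smul_left, sum_inner]
  simp only [h.inner_apply]
  simp

theorem IsGNS.le_re_inner_orbitMean [Nonempty F] (h : IsGNS χ π ξ) (f f' : F → G) {r : ℝ}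
    (hr : ∀ w s, r ≤ (χ ((f w)⁻¹ * f' s)).re) :
    r ≤ (inner ℂ (orbitMean π ξ f) (orbitMean π ξ f')).re := by
  have hF : (0 : ℝ) < Fintype.card F := by exact_mod_cast Fintype.card_pos
  have e : (inner ℂ (orbitMean π ξ f) (orbitMean π ξ f')).re = (Fintype.card F : ℝ)⁻¹ *
      ((Fintype.card F : ℝ)⁻¹ * ∑ w, ∑ s, (χ ((f w)⁻¹ * f' s)).re) := by
    rw [h.inner_orbitMean]
    simp only [← Complex.re_sum]
    rw [← Complex.re_ofReal_mul, ← Complex.re_ofReal_mul]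
    push_cast
    rfl
  have h1 : ∑ _w : F, ∑ _s : F, r ≤ ∑ w, ∑ s, (χ ((f w)⁻¹ * f' s)).re :=
    Finset.sum_le_sum fun w _ => Finset.sum_le_sum fun s _ => hr w s
  simp only [Finset.sum_const, Finset.card_univ, nsmul_eq_mul] at h1
  rw [e, inv_mul_eq_div, inv_mul_eq_div, le_div_iff₀ hF, le_div_iff₀ hF]
  linarith

end

/-- A length function on permutations is bounded by its values on transpositions inside the
support. -/
theorem exists_word_bound {X : Type*} [Fintype X] [DecidableEq X] (σ : Equiv.Perm X) :
    ∃ M : ℕ, ∀ (d : Equiv.Perm X → ℝ) (η : ℝ), d 1 = 0 →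
      (∀ σ τ, d (σ * τ) ≤ d σ + d τ) →
      (∀ x ∈ σ.support, ∀ y ∈ σ.support, x ≠ y → d (Equiv.swap x y) ≤ η) → d σ ≤ M * η := by
  -- Factoring inside the permutations of the support keeps the transpositions there; the word
  -- length `M` depends on neither `d` nor `η`.
  have key : ∀ τ : Equiv.Perm {x // x ∈ σ.support}, ∃ M : ℕ, ∀ (d : Equiv.Perm X → ℝ) (η : ℝ),
      d 1 = 0 → (∀ σ τ, d (σ * τ) ≤ d σ + d τ) →
      (∀ x ∈ σ.support, ∀ y ∈ σ.support, x ≠ y → d (Equiv.swap x y) ≤ η) →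
        d (Equiv.Perm.ofSubtype τ) ≤ M * η := by
    intro τ
    induction τ using Equiv.Perm.swap_induction_on with
    | one =>
      refine ⟨0, fun d η h1 _ _ => ?_⟩
      rw [_root_.map_one, h1]
      simp
    | swap_mul τ x y hxy ih =>
      obtain ⟨M, hM⟩ := ih
      refine ⟨M + 1, fun d η h1 h2 h3 => ?_⟩
      rw [map_mul, Equiv.Perm.ofSubtype_swap_eq]
      refine (h2 _ _).trans ?_
      have h4 := hM d η h1 h2 h3
      have h5 := h3 x x.2 y y.2 fun h => hxy (Subtype.ext h)
      push_cast
      linarith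
  obtain ⟨M, hM⟩ := key (σ.subtypePerm fun x => by simp)
  refine ⟨M, fun d η h1 h2 h3 => ?_⟩
  have := hM d η h1 h2 h3
  rwa [Equiv.Perm.ofSubtype_subtypePerm _ fun x hx => Equiv.Perm.mem_support.2 hx] at this

variable {n : ℕ → ℕ} {χ : LimitGroup n → ℂ}

/-! ### From involutions to arbitrary elements -/

/-- For an injective $c$ into $F$, the coboundary $d=c-c\circ\sigma^{-1}$ is nonzero exactly on the
support $A$ of $\sigma$, and each $C(wd)\sigma$ is conjugate to $\sigma$. So $\chi(\sigma)=\langle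
a,\pi(\sigma)\xi\rangle$ for the mean $a$ of the vectors $\pi(C(wd))\xi$. This $a$ is close to the
analogous mean $b$ for the indicator $o$ of $A$, which is almost fixed by transpositions inside $A$,
hence by $\sigma$; therefore $\chi(\sigma)\approx\langle b,\xi\rangle\approx P$. A field is needed
so that $wd$ keeps its support for $w\ne0$, and characteristic 2 so that the $C(v)$ are involutions.
-/
theorem norm_sub_rpow_le (hn : ∀ k, 1 < n k) (hχ : IsCharacter χ) {p : ℝ} (hp : 0 ≤ p)
    (hinv : ∀ t, t * t = 1 → χ t = (((1 - moved hn t) ^ p : ℝ) : ℂ)) {k : ℕ}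
    (σ : Equiv.Perm (Fin (N n k))) {M : ℕ}
    (hM : ∀ (d : Equiv.Perm (Fin (N n k)) → ℝ) (η : ℝ), d 1 = 0 →
      (∀ σ τ, d (σ * τ) ≤ d σ + d τ) →
      (∀ x ∈ σ.support, ∀ y ∈ σ.support, x ≠ y → d (Equiv.swap x y) ≤ η) → d σ ≤ M * η)
    {F : Type*} [Field F] [Fintype F] [CharP F 2] (hF : N n k ≤ Fintype.card F) {j : ℕ}
    (hkj : k ≤ j) {Q : ℕ} (hQ : Q * Fintype.card F ≤ N n j / N n k) {P P₀ : ℝ}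
    (hP : P = (1 - σ.support.card * (Q * Fintype.card F : ℝ) / N n j) ^ p)
    (hP₀ : P₀ = (1 - (σ.support.card : ℝ) / N n k) ^ p) :
    ‖χ (level n k σ) - P‖ ≤ Real.sqrt (2 / Fintype.card F) +
      M * Real.sqrt (2 / Fintype.card F + 2 * (P - P₀)) + 1 / Fintype.card F := by
  classical
  obtain ⟨C, hadd, hconj, hmoved, hmovedle⟩ := exists_translations hn hkj F hQ
  obtain ⟨H, i1, i2, i3, π, ρ, ξ, hG⟩ := hχ.exists_biGNS
  obtain ⟨c⟩ : Nonempty (Fin (N n k) ↪ F) :=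
    Function.Embedding.nonempty_of_card_le (by rwa [Fintype.card_fin])
  have hself : ∀ v, C v * C v = 1 := by
    intro v
    have h0 := hadd 0 0
    rw [add_zero] at h0
    rw [← hadd, show v + v = 0 from funext fun x => CharTwo.add_self_eq_zero _]
    exact left_eq_mul.1 h0
  have hCinv : ∀ v, (C v)⁻¹ = C v := fun v => inv_eq_of_mul_eq_one_left (hself v)
  set A := σ.support with hA
  set q := (Fintype.card F : ℝ) with hq
  have hqpos : 0 < q := by rw [hq]; exact_mod_cast Fintype.card_pos
  have hq1 : q⁻¹ ≤ 1 :=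
    inv_le_one_of_one_le₀ (by rw [hq]; exact_mod_cast Fintype.card_pos (α := F))
  have hqinv : 0 < q⁻¹ := inv_pos.2 hqpos
  have hNj := N_real_pos hn j
  have hNk := N_real_pos hn k
  have h2 : (A.card : ℝ) * (Q * q) / N n j ≤ 1 := by
    rw [div_le_one hNj, hq]
    have h3 : A.card ≤ N n k := (Finset.card_le_univ _).trans_eq (Fintype.card_fin _)
    have h4 := Nat.mul_le_mul h3 hQ
    rw [N_mul_div hkj] at h4
    exact_mod_cast h4
  -- the values at involutions inside `A`
  have hCle : ∀ v : Fin (N n k) → F, (∀ x, x ∉ A → v x = 0) → P ≤ (χ (C v)).re := by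
    intro v hv
    rw [hinv _ (hself v), Complex.ofReal_re, hP]
    have h1 : moved hn (C v) ≤ A.card * (Q * q) / N n j := by
      rw [hmoved]
      have : (Finset.univ.filter fun x => v x ≠ 0).card ≤ A.card :=
        Finset.card_le_card fun x hx => by
          by_contra h
          exact (Finset.mem_filter.1 hx).2 (hv x h)
      gcongr
    refine Real.rpow_le_rpow ?_ (by linarith) hp
    linarith
  have hCeq : ∀ v : Fin (N n k) → F, (∀ x, v x ≠ 0 ↔ x ∈ A) → χ (C v) = P := by
    intro v hv
    have h1 : (Finset.univ.filter fun x => v x ≠ 0) = A := by ext x; simp [hv x]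
    rw [hinv _ (hself v), hmoved, hP, h1]
  set d : Fin (N n k) → F := fun x => c x - c (σ.symm x) with hd
  have hdA : ∀ x, d x ≠ 0 ↔ x ∈ A := by
    intro x
    rw [hd, hA, Equiv.Perm.mem_support]
    simp only [ne_eq, sub_eq_zero, c.injective.eq_iff, Equiv.eq_symm_apply]
  set o : Fin (N n k) → F := fun x => if x ∈ A then 1 else 0 with ho
  have hoA : ∀ x, o x ≠ 0 ↔ x ∈ A := fun x => by simp [ho]
  have hsmul : ∀ {v : Fin (N n k) → F}, (∀ x, v x ≠ 0 ↔ x ∈ A) → ∀ w : F, w ≠ 0 →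
      χ (C (w • v)) = P := fun {v} hv w hw => hCeq _ fun x => by
    rw [Pi.smul_apply, smul_eq_mul, mul_ne_zero_iff, hv x]
    exact and_iff_right hw
  have hzero : ∀ {v : Fin (N n k) → F}, (∀ x, v x ≠ 0 ↔ x ∈ A) → ∀ (w : F) x, x ∉ A →
      (w • v) x = 0 := fun {v} hv w x hx => by
    rw [Pi.smul_apply, not_not.1 fun h => hx ((hv x).1 h), smul_zero]
  have haddsmul : ∀ (v : Fin (N n k) → F) (w s : F), C ((w + s) • v) = C (w • v) * C (s • v) :=
    fun v w s => by rw [add_smul, hadd]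
  set a := orbitMean π ξ fun w : F => C (w • d) with ha
  set b := orbitMean π ξ fun w : F => C (w • o) with hb
  have hna : ‖a‖ ^ 2 = q⁻¹ + (1 - q⁻¹) * P :=
    hG.toIsGNS.norm_orbitMean_sq hχ (haddsmul d) (hsmul hdA)
  have hnb : ‖b‖ ^ 2 = q⁻¹ + (1 - q⁻¹) * P :=
    hG.toIsGNS.norm_orbitMean_sq hχ (haddsmul o) (hsmul hoA)
  have hP0 : 0 ≤ P := by
    rw [hP]
    refine Real.rpow_nonneg ?_ _
    linarith
  have hP1 : P ≤ 1 := by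
    have := hCle d fun x hx => not_not.1 fun h => hx ((hdA x).1 h)
    exact this.trans (hχ.re_le_one _)
  have hab : ‖a - b‖ ≤ Real.sqrt (2 / q) := by
    refine Real.le_sqrt_of_sq_le ?_
    have h1 : P ≤ (inner ℂ a b).re := by
      refine hG.toIsGNS.le_re_inner_orbitMean _ _ fun w s => ?_
      rw [hCinv, ← hadd]
      refine hCle _ fun x hx => ?_
      rw [Pi.add_apply, hzero hdA w x hx, hzero hoA s x hx, add_zero]
    have h3 : RCLike.re (inner ℂ a b) = (inner ℂ a b).re := rfl
    rw [_root_.norm_sub_sq (𝕜 := ℂ), hna, hnb, h3, div_eq_mul_inv]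
    nlinarith
  -- transpositions inside `A` almost fix `b`
  have hswap : ∀ x ∈ A, ∀ y ∈ A, x ≠ y →
      ‖(π (level n k (Equiv.swap x y)) : H →L[ℂ] H) b - b‖ ≤ Real.sqrt (2 / q + 2 * (P - P₀)) := by
    intro x hx y hy hxy
    refine Real.le_sqrt_of_sq_le ?_
    have hfix : ∀ z, z ∉ A → Equiv.swap x y z = z := fun z hz =>
      Equiv.swap_apply_of_ne_of_ne (fun h => hz (h ▸ hx)) (fun h => hz (h ▸ hy))
    have hcomm : ∀ w : F, level n k (Equiv.swap x y) * C (w • o) =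
        C (w • o) * level n k (Equiv.swap x y) := by
      intro w
      rw [← mul_inv_eq_iff_eq_mul, hconj]
      congr 1
      ext z
      have hz : o (Equiv.swap x y z) = o z := by
        by_cases h : z ∈ A
        · have h' : Equiv.swap x y z ∈ A := by
            rcases eq_or_ne z x with rfl | h1
            · rwa [Equiv.swap_apply_left]
            · rcases eq_or_ne z y with rfl | h2
              · rwa [Equiv.swap_apply_right]
              · rwa [Equiv.swap_apply_of_ne_of_ne h1 h2]
          simp [ho, h, h']
        · rw [hfix z h]
      rw [Function.comp_apply, Equiv.symm_swap, Pi.smul_apply, Pi.smul_apply, hz]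
    have h1 : P₀ ≤ (inner ℂ b ((π (level n k (Equiv.swap x y)) : H →L[ℂ] H) b)).re := by
      rw [hb, map_orbitMean]
      refine hG.toIsGNS.le_re_inner_orbitMean _ _ fun w s => ?_
      have e1 : (C (w • o))⁻¹ * (level n k (Equiv.swap x y) * C (s • o)) =
          level n k (Equiv.swap x y) * C ((w + s) • o) := by
        rw [hCinv, ← mul_assoc, ← hcomm, mul_assoc, haddsmul]
      have e2 := mul_mul_self_of_commute (level_swap_mul_self (n := n) x y) (hself ((w + s) • o))
        (hcomm _)
      -- A transposition in $A$ times $C((w+s)o)$ is an involution living over $A$; it moves at most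
      -- the proportion $|A|/N_k$, whence the bound by $P_0$.
      rw [e1, hinv _ e2, Complex.ofReal_re, hP₀]
      have e3 := hmovedle A (Equiv.swap x y) ((w + s) • o) hfix (hzero hoA _)
      refine Real.rpow_le_rpow ?_ (by linarith) hp
      rw [sub_nonneg, div_le_one hNk]
      exact_mod_cast (Finset.card_le_univ A).trans_eq (Fintype.card_fin _)
    have h3 : RCLike.re (inner ℂ ((π (level n k (Equiv.swap x y)) : H →L[ℂ] H) b) b) =
        (inner ℂ b ((π (level n k (Equiv.swap x y)) : H →L[ℂ] H) b)).re := by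
      rw [inner_re_symm]; rfl
    rw [_root_.norm_sub_sq (𝕜 := ℂ), Unitary.norm_map, hnb, h3, div_eq_mul_inv]
    nlinarith
  have hgb : ‖(π (level n k σ) : H →L[ℂ] H) b - b‖ ≤ M * Real.sqrt (2 / q + 2 * (P - P₀)) := by
    refine hM (fun τ => ‖(π (level n k τ) : H →L[ℂ] H) b - b‖) _ (by simp) (fun τ τ' => ?_) hswap
    have e1 : (π (level n k (τ * τ')) : H →L[ℂ] H) b - b =
        ((π (level n k τ) : H →L[ℂ] H) b - b) +
          (π (level n k τ) : H →L[ℂ] H) ((π (level n k τ') : H →L[ℂ] H) b - b) := by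
      rw [map_mul, IsGNS.mul_apply, map_sub]
      abel
    beta_reduce
    rw [e1]
    refine (norm_add_le _ _).trans_eq ?_
    rw [Unitary.norm_map]
  -- conclusion
  have hag : inner ℂ a ((π (level n k σ) : H →L[ℂ] H) ξ) = χ (level n k σ) := by
    rw [hG.toIsGNS.inner_orbitMean_apply]
    have h1 : ∀ w : F, χ ((C (w • d))⁻¹ * level n k σ) = χ (level n k σ) := by
      intro w
      have e1 : w • d = w • (c : Fin (N n k) → F) + (w • (c : Fin (N n k) → F)) ∘ σ.symm := by
        ext x
        simp only [hd, Pi.add_apply, Pi.smul_apply, Function.comp_apply, smul_eq_mul]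
        rw [CharTwo.sub_eq_add, mul_add]
      have e2 : C (w • d) * level n k σ = C (w • (c : Fin (N n k) → F)) * level n k σ *
          (C (w • (c : Fin (N n k) → F)))⁻¹ := by
        rw [e1, hadd, ← hconj, hCinv]
        group
      rw [hCinv, e2, hχ.conj_apply]
    simp [h1]
  have hbξ : inner ℂ b ξ = ((q⁻¹ + (1 - q⁻¹) * P : ℝ) : ℂ) := by
    have h1 := hG.toIsGNS.inner_orbitMean_apply (fun w : F => C (w • o)) 1
    simp only [mul_one, hCinv] at h1
    rw [mean_eq_of_ne_zero (φ := fun w : F => χ (C (w • o))) (z := P) ?_ (hsmul hoA)] at h1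
    · rw [_root_.map_one] at h1
      have h2 : inner ℂ b ξ = (Fintype.card F : ℂ)⁻¹ + (1 - (Fintype.card F : ℂ)⁻¹) * P := h1
      rw [h2, hq]
      push_cast
      rfl
    · have h0 := hadd 0 0
      rw [add_zero] at h0
      rw [zero_smul, left_eq_mul.1 h0, hχ.map_one]
  have hξ : ‖ξ‖ = 1 := by simpa using hG.toIsGNS.norm_apply hχ 1
  have h1 : ‖χ (level n k σ) - inner ℂ b ((π (level n k σ) : H →L[ℂ] H) ξ)‖ ≤
      Real.sqrt (2 / q) := by
    rw [← hag, ← inner_sub_left]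
    refine (norm_inner_le_norm _ _).trans ?_
    rwa [hG.toIsGNS.norm_apply hχ, mul_one]
  have h2 : ‖inner ℂ b ((π (level n k σ) : H →L[ℂ] H) ξ) - inner ℂ b ξ‖ ≤
      M * Real.sqrt (2 / q + 2 * (P - P₀)) := by
    have e1 : inner ℂ b ξ = inner ℂ ((π (level n k σ) : H →L[ℂ] H) b)
        ((π (level n k σ) : H →L[ℂ] H) ξ) := (Unitary.inner_map_map _ _ _).symm
    rw [e1, ← inner_sub_left]
    refine (norm_inner_le_norm _ _).trans ?_
    rwa [hG.toIsGNS.norm_apply hχ, mul_one, norm_sub_rev]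
  have h3 : ‖inner ℂ b ξ - (P : ℂ)‖ ≤ 1 / q := by
    rw [hbξ, ← Complex.ofReal_sub, Complex.norm_real, Real.norm_eq_abs, abs_le, one_div]
    constructor <;> nlinarith
  calc ‖χ (level n k σ) - P‖ ≤ ‖χ (level n k σ) - inner ℂ b ((π (level n k σ) : H →L[ℂ] H) ξ)‖ +
        ‖inner ℂ b ((π (level n k σ) : H →L[ℂ] H) ξ) - inner ℂ b ξ‖ + ‖inner ℂ b ξ - (P : ℂ)‖ := by
        have e1 := norm_sub_le_norm_sub_add_norm_sub (χ (level n k σ))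
          (inner ℂ b ((π (level n k σ) : H →L[ℂ] H) ξ)) (P : ℂ)
        have e2 := norm_sub_le_norm_sub_add_norm_sub
          (inner ℂ b ((π (level n k σ) : H →L[ℂ] H) ξ)) (inner ℂ b ξ) (P : ℂ)
        linarith
    _ ≤ _ := by linarith

end SymLimit

namespace SymLimit

variable {n : ℕ → ℕ} {χ : LimitGroup n → ℂ}

/-- A character that is a power of `1 - moved` on involutions is so everywhere. -/
theorem IsCharacter.eq_rpow_of_involution (hn : ∀ k, 1 < n k) (hχ : IsCharacter χ) {p : ℝ}
    (hp : 0 ≤ p) (hinv : ∀ t, t * t = 1 → χ t = (((1 - moved hn t) ^ p : ℝ) : ℂ))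
    (g : LimitGroup n) : χ g = (((1 - moved hn g) ^ p : ℝ) : ℂ) := by
  obtain ⟨k, σ, rfl⟩ := exists_mem_stage g
  obtain ⟨M, hM⟩ := exists_word_bound σ
  have hNk := N_real_pos hn k
  rw [moved_level]
  set P₀ := (1 - (σ.support.card : ℝ) / N n k) ^ p with hP₀
  -- Two limits in this order: for fixed $F$ of order $2^m$, $j\to\infty$ fills the fibres and sends
  -- $P$ to $P_0$; then $m\to\infty$ removes the error.
  have hbound : ∀ m : ℕ, m ≠ 0 → N n k ≤ 2 ^ m →
      ‖χ (level n k σ) - P₀‖ ≤ Real.sqrt (2 / 2 ^ m) + M * Real.sqrt (2 / 2 ^ m) + 1 / 2 ^ m := by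
    intro m hm hNm
    have : Fintype (GaloisField 2 m) := Fintype.ofFinite _
    have hcard : Fintype.card (GaloisField 2 m) = 2 ^ m := by
      rw [← Nat.card_eq_fintype_card, GaloisField.card 2 m hm]
    set P : ℕ → ℝ := fun j => (1 - σ.support.card *
      (((N n j / N n k / 2 ^ m : ℕ) : ℝ) * (2 ^ m : ℕ)) / N n j) ^ p with hP
    have h1 : ∀ j, k ≤ j → ‖χ (level n k σ) - P j‖ ≤ Real.sqrt (2 / 2 ^ m) +
        M * Real.sqrt (2 / 2 ^ m + 2 * (P j - P₀)) + 1 / 2 ^ m := by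
      intro j hj
      have := norm_sub_rpow_le hn hχ hp hinv σ hM (F := GaloisField 2 m) (by rwa [hcard]) hj
        (Q := N n j / N n k / 2 ^ m) (by rw [hcard]; exact Nat.div_mul_le_self _ _)
        (P := P j) (by rw [hcard]) hP₀
      rw [hcard] at this
      push_cast at this
      exact this
    have h2 : Tendsto P atTop (𝓝 P₀) := by
      have e1 : Tendsto (fun j => ((N n j / N n k / 2 ^ m : ℕ) : ℝ) * (2 ^ m : ℕ) / N n j) atTop
          (𝓝 (1 / N n k)) := by
        have e2 : Tendsto (fun j => 1 / (N n k : ℝ) - (2 ^ m : ℕ) / N n j) atTop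
            (𝓝 (1 / N n k)) := by
          have e3 : Tendsto (fun j => ((2 ^ m : ℕ) : ℝ) / N n j) atTop (𝓝 0) :=
            tendsto_const_nhds.div_atTop (tendsto_natCast_atTop_atTop.comp (tendsto_N hn))
          simpa using e3.const_sub (1 / (N n k : ℝ))
        refine tendsto_of_tendsto_of_tendsto_of_le_of_le' e2 tendsto_const_nhds ?_ ?_
        · filter_upwards [eventually_ge_atTop k] with j hj
          have hNj := N_real_pos hn j
          have e4 : ((N n j / N n k : ℕ) : ℝ) ≤
              (N n j / N n k / 2 ^ m : ℕ) * (2 ^ m : ℕ) + (2 ^ m : ℕ) := by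
            have := Nat.lt_div_mul_add (a := N n j / N n k) (b := 2 ^ m) (by positivity)
            exact_mod_cast this.le
          rw [div_real hn hj] at e4
          rw [le_div_iff₀ hNj]
          have e5 : (1 / (N n k : ℝ) - (2 ^ m : ℕ) / N n j) * N n j =
              N n j / N n k - (2 ^ m : ℕ) := by field_simp
          rw [e5]
          linarith
        · filter_upwards [eventually_ge_atTop k] with j hj
          have hNj := N_real_pos hn j
          have e4 : ((N n j / N n k / 2 ^ m : ℕ) : ℝ) * (2 ^ m : ℕ) ≤ (N n j / N n k : ℕ) := by
            exact_mod_cast Nat.div_mul_le_self _ _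
          rw [div_real hn hj] at e4
          rw [div_le_iff₀ hNj]
          have e5 : 1 / (N n k : ℝ) * N n j = N n j / N n k := by field_simp
          rw [e5]
          exact e4
      have e6 := ((Real.continuous_rpow_const hp).tendsto _).comp
        ((e1.const_mul (σ.support.card : ℝ)).const_sub 1)
      rw [mul_one_div] at e6
      refine e6.congr fun j => ?_
      simp only [hP, Function.comp_apply, mul_div_assoc]
    have h3 : Tendsto (fun j => ‖χ (level n k σ) - P j‖) atTop (𝓝 ‖χ (level n k σ) - P₀‖) :=
      (((Complex.continuous_ofReal.tendsto _).comp h2).const_sub _).norm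
    have h4 : Tendsto (fun j => Real.sqrt (2 / 2 ^ m) +
        M * Real.sqrt (2 / 2 ^ m + 2 * (P j - P₀)) + 1 / 2 ^ m) atTop
        (𝓝 (Real.sqrt (2 / 2 ^ m) + M * Real.sqrt (2 / 2 ^ m + 2 * (P₀ - P₀)) + 1 / 2 ^ m)) :=
      ((((Real.continuous_sqrt.tendsto _).comp
        (((h2.sub_const P₀).const_mul 2).const_add _)).const_mul _).const_add _).add_const _
    rw [sub_self, mul_zero, add_zero] at h4
    refine le_of_tendsto_of_tendsto h3 h4 ?_
    filter_upwards [eventually_ge_atTop k] with j hj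
    exact h1 j hj
  have hpow : Tendsto (fun m : ℕ => (2 : ℝ) ^ m) atTop atTop :=
    tendsto_pow_atTop_atTop_of_one_lt (by norm_num)
  have h2m : Tendsto (fun m : ℕ => Real.sqrt (2 / 2 ^ m)) atTop (𝓝 0) := by
    rw [← Real.sqrt_zero]
    exact (Real.continuous_sqrt.tendsto 0).comp (tendsto_const_nhds.div_atTop hpow)
  have hlim : Tendsto (fun m : ℕ => Real.sqrt (2 / 2 ^ m) + M * Real.sqrt (2 / 2 ^ m) + 1 / 2 ^ m)
      atTop (𝓝 0) := by
    simpa using (h2m.add (h2m.const_mul (M : ℝ))).add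
      ((tendsto_const_nhds (x := (1 : ℝ))).div_atTop hpow)
  rw [← sub_eq_zero, ← norm_le_zero_iff]
  refine ge_of_tendsto hlim ?_
  filter_upwards [eventually_ge_atTop (N n k)] with m hm
  exact hbound m (by have := N_pos hn k; omega) (hm.trans Nat.lt_two_pow_self.le)

end SymLimit

namespace SymLimit

/-! ### Iterated differences -/

/-- Differencing the whole chain of derivatives once preserves it and shortens it by one: a negative
derivative makes the function before it strictly decreasing, so its difference is negative. -/
theorem fwdDiff_iter_neg {h : ℝ} (hh : 0 < h) (r : ℕ) : ∀ f : ℕ → ℝ → ℝ,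
    (∀ i, i < r → ∀ x, 0 < x → HasDerivAt (f i) (f (i + 1) x) x) → (∀ x, 0 < x → f r x < 0) →
    ∀ x, 0 < x → (fwdDiff h)^[r] (f 0) x < 0 := by
  induction r with
  | zero => exact fun f _ h2 x hx => h2 x hx
  | succ r ih =>
    intro f h1 h2 x hx
    rw [Function.iterate_succ_apply]
    refine ih (fun i => fwdDiff h (f i)) (fun i hi y hy => ?_) (fun y hy => ?_) x hx
    · have e1 := (h1 i (by omega) (y + h) (by linarith)).comp_add_const y h
      exact e1.sub (h1 i (by omega) y hy)
    · have e1 : StrictAntiOn (f r) (Set.Ioi 0) := by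
        refine strictAntiOn_of_deriv_neg (convex_Ioi 0)
          (fun z hz => (h1 r (by omega) z hz).continuousAt.continuousWithinAt) fun z hz => ?_
        rw [interior_Ioi] at hz
        rw [(h1 r (by omega) z hz).deriv]
        exact h2 z hz
      have := e1 (Set.mem_Ioi.2 hy) (Set.mem_Ioi.2 (by linarith : 0 < y + h)) (by linarith)
      rw [fwdDiff]
      linarith

theorem fwdDiff_iter_rpow_neg {p : ℝ} (hp : 0 ≤ p) (hpn : ∀ m : ℕ, p ≠ m) {h x : ℝ} (hh : 0 < h)
    (hx : 0 < x) : (fwdDiff h)^[⌊p⌋₊ + 2] (fun x : ℝ => x ^ p) x < 0 := by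
  -- At order $\lfloor p\rfloor+2$ the coefficient $p(p-1)\cdots(p-\lfloor p\rfloor-1)$ of the
  -- derivative has exactly one negative factor, the last, and none is zero.
  have key := fwdDiff_iter_neg hh (⌊p⌋₊ + 2)
    (fun i x => (∏ t ∈ Finset.range i, (p - t)) * x ^ (p - i)) (fun i _ y hy => ?_)
    (fun y hy => ?_) x hx
  · simpa using key
  · have := (Real.hasDerivAt_rpow_const (x := y) (p := p - i) (Or.inl hy.ne')).const_mul
      (∏ t ∈ Finset.range i, (p - t))
    refine this.congr_deriv ?_
    rw [Finset.prod_range_succ, Nat.cast_add, Nat.cast_one, sub_add_eq_sub_sub]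
    ring
  · refine mul_neg_of_neg_of_pos ?_ (Real.rpow_pos_of_pos hy _)
    rw [Finset.prod_range_succ]
    refine mul_neg_of_pos_of_neg (Finset.prod_pos fun t ht => ?_) ?_
    · rw [Finset.mem_range, Nat.lt_succ_iff] at ht
      have h1 : (t : ℝ) ≤ ⌊p⌋₊ := by exact_mod_cast ht
      have h2 := lt_of_le_of_ne (Nat.floor_le hp) (hpn _).symm
      linarith
    · have := Nat.lt_floor_add_one p
      push_cast
      linarith

/-! ### Integrality of the exponent -/

/-- The sign character of the elementary abelian 2-group. -/
def parity {r : ℕ} (v : Fin r → ZMod 2) : ℝ := ∏ i, if v i = 0 then 1 else -1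

theorem parity_add {r : ℕ} (v w : Fin r → ZMod 2) : parity (v + w) = parity v * parity w := by
  have h : ∀ a b : ZMod 2, (if a + b = 0 then (1 : ℝ) else -1) =
      (if a = 0 then 1 else -1) * if b = 0 then 1 else -1 := by
    intro a b
    have key : ∀ a b : ZMod 2, (a = 0 ∧ b = 0 ∧ a + b = 0) ∨ (a = 0 ∧ b ≠ 0 ∧ a + b ≠ 0) ∨
      (a ≠ 0 ∧ b = 0 ∧ a + b ≠ 0) ∨ (a ≠ 0 ∧ b ≠ 0 ∧ a + b = 0) := by decide
    rcases key a b with ⟨h1, h2, h3⟩ | ⟨h1, h2, h3⟩ | ⟨h1, h2, h3⟩ | ⟨h1, h2, h3⟩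
    · rw [if_pos h3, if_pos h1, if_pos h2, one_mul]
    · rw [if_neg h3, if_pos h1, if_neg h2, one_mul]
    · rw [if_neg h3, if_neg h1, if_pos h2, mul_one]
    · rw [if_pos h3, if_neg h1, if_neg h2]
      norm_num
  rw [parity, parity, parity, ← Finset.prod_mul_distrib]
  exact Finset.prod_congr rfl fun i _ => h _ _

theorem parity_eq {r : ℕ} (v : Fin r → ZMod 2) :
    parity v = (-1) ^ (Finset.univ.filter fun i => v i ≠ 0).card := by
  rw [parity, Finset.prod_ite]
  simp

theorem sum_card_ne_zero {r : ℕ} (f : ℕ → ℝ) :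
    ∑ v : Fin r → ZMod 2, f (Finset.univ.filter fun i => v i ≠ 0).card =
      ∑ m ∈ Finset.range (r + 1), (r.choose m : ℝ) * f m := by
  have h1 : Function.Bijective fun v : Fin r → ZMod 2 => Finset.univ.filter fun i => v i ≠ 0 := by
    constructor
    · intro v w hvw
      ext i
      have h2 := Finset.ext_iff.1 hvw i
      simp only [Finset.mem_filter, Finset.mem_univ, true_and] at h2
      have key : ∀ a b : ZMod 2, (a ≠ 0 ↔ b ≠ 0) → a = b := by decide
      rw [key _ _ h2]
    · intro S
      refine ⟨fun i => if i ∈ S then 1 else 0, ?_⟩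
      ext i
      simp
  rw [Function.Bijective.sum_comp h1 fun S => f S.card, ← Finset.powerset_univ,
    Finset.sum_powerset_apply_card]
  simp

/-- The sum is $2^{-r}\bigl\|\sum_v\mathrm{parity}(v)\,\pi(\tau_v)\xi\bigr\|^2$ for $(\mathbb
Z/2)^r$ acting by disjoint transpositions, with the $v$ grouped by weight. -/
theorem alternating_sum_nonneg {n : ℕ → ℕ} (hn : ∀ k, 1 < n k) {χ : LimitGroup n → ℂ}
    (hχ : IsCharacter χ) {p : ℝ}
    (hinv : ∀ t, t * t = 1 → χ t = (((1 - moved hn t) ^ p : ℝ) : ℂ)) {j r : ℕ}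
    (hr : 2 * r ≤ N n j) :
    0 ≤ ∑ m ∈ Finset.range (r + 1), (r.choose m : ℝ) * ((-1) ^ m * (1 - 2 * m / N n j) ^ p) := by
  obtain ⟨τ, hτ1, hτ2, hτ3, -⟩ := exists_level_flips hn hr
  obtain ⟨H, i1, i2, i3, π, ρ, ξ, hG⟩ := hχ.exists_biGNS
  rw [← sum_card_ne_zero fun m => (-1) ^ m * (1 - 2 * m / N n j) ^ p]
  have h1 : ∀ v : Fin r → ZMod 2, χ (τ v) = (((1 - 2 *
      (Finset.univ.filter fun i => v i ≠ 0).card / N n j) ^ p : ℝ) : ℂ) := fun v => by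
    rw [hinv _ (hτ2 v), hτ3]
  set x : H := ∑ v, (parity v : ℂ) • (π (τ v) : H →L[ℂ] H) ξ with hx
  have h2 : inner ℂ x x = ((2 ^ r * ∑ v : Fin r → ZMod 2, parity v * (1 - 2 *
      (Finset.univ.filter fun i => v i ≠ 0).card / N n j) ^ p : ℝ) : ℂ) := by
    have h3 : ∀ v : Fin r → ZMod 2, ∑ w, inner ℂ ((parity v : ℂ) • (π (τ v) : H →L[ℂ] H) ξ)
        ((parity w : ℂ) • (π (τ w) : H →L[ℂ] H) ξ) = ∑ w, (parity w : ℂ) * χ (τ w) := by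
      intro v
      rw [← Equiv.sum_comp (Equiv.addLeft v)]
      refine Finset.sum_congr rfl fun w _ => ?_
      rw [Equiv.coe_addLeft, inner_smul_left, inner_smul_right, hG.toIsGNS.inner_apply, hτ1,
        inv_mul_cancel_left, parity_add, Complex.conj_ofReal]
      have h4 : parity v * parity v = 1 := by
        rw [← parity_add, zmod_two_add_self]
        simp [parity]
      have h5 : (parity v : ℂ) * parity v = 1 := by exact_mod_cast h4
      push_cast
      linear_combination (parity w * χ (τ w)) * h5
    rw [hx, sum_inner]
    simp only [inner_sum]
    rw [Finset.sum_congr rfl fun v _ => h3 v, Finset.sum_const, Finset.card_univ,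
      card_fin_fun_zmod_two, nsmul_eq_mul]
    simp only [h1]
    push_cast
    rfl
  have h3 : 0 ≤ RCLike.re (inner ℂ x x) := inner_self_nonneg
  rw [h2] at h3
  have h4 : 0 ≤ 2 ^ r * ∑ v : Fin r → ZMod 2, parity v * (1 - 2 *
      (Finset.univ.filter fun i => v i ≠ 0).card / N n j) ^ p := h3
  have h5 := nonneg_of_mul_nonneg_right h4 (by positivity)
  simpa only [parity_eq] using h5

/-- The alternating sum, read backwards, is the $r$-th forward difference of $x^p$ with step $2/N_j$
at $1-2r/N_j$. It is nonnegative by positivity, but negative for $r=\lfloor p\rfloor+2$ if $p$ is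
not an integer. -/
theorem exists_nat_eq_of_involution {n : ℕ → ℕ} (hn : ∀ k, 1 < n k) {χ : LimitGroup n → ℂ}
    (hχ : IsCharacter χ) {p : ℝ} (hp : 0 ≤ p)
    (hinv : ∀ t, t * t = 1 → χ t = (((1 - moved hn t) ^ p : ℝ) : ℂ)) : ∃ m : ℕ, p = m := by
  by_contra! hpn
  set r := ⌊p⌋₊ + 2 with hr
  obtain ⟨j, hj⟩ := ((tendsto_N hn).eventually_gt_atTop (2 * r)).exists
  have hNj := N_real_pos hn j
  have h1 := alternating_sum_nonneg hn hχ hinv hj.le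
  have hx : 0 < 1 - r * (2 / (N n j : ℝ)) := by
    have : (2 * r : ℝ) < N n j := by exact_mod_cast hj
    rw [sub_pos, mul_div_assoc', div_lt_one hNj]
    linarith
  have h2 := fwdDiff_iter_rpow_neg hp hpn (by positivity : 0 < 2 / (N n j : ℝ)) hx
  rw [fwdDiff_iter_eq_sum_shift, ← hr, ← Finset.sum_range_reflect] at h2
  refine absurd h1 (not_le.2 (lt_of_eq_of_lt (Finset.sum_congr rfl fun m hm => ?_) h2))
  have hm' : m ≤ r := Nat.lt_succ_iff.1 (Finset.mem_range.1 hm)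
  have e1 : r + 1 - 1 - m = r - m := by omega
  rw [e1, Nat.sub_sub_self hm', Nat.choose_symm hm', zsmul_eq_mul, nsmul_eq_mul,
    Nat.cast_sub hm']
  have e2 : (1 - r * (2 / (N n j : ℝ)) + (r - m) * (2 / N n j)) = 1 - 2 * m / N n j := by ring
  rw [e2]
  push_cast
  ring

/-! ### The classification -/

theorem IsAsympMul.mem_exChar {n : ℕ → ℕ} (hn : ∀ k, 1 < n k) {χ : LimitGroup n → ℂ}
    (h : IsAsympMul (stage n) χ) (hχ : IsCharacter χ) : χ ∈ exChar n hn := by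
  have hpow : ∀ {φ : LimitGroup n → ℂ} {p : ℝ}, IsCharacter φ → 0 ≤ p →
      (∀ t, t * t = 1 → φ t = (((1 - moved hn t) ^ p : ℝ) : ℂ)) →
      ∃ m : ℕ, ∀ g, φ g = chiNat n hn g ^ m := by
    intro φ p hφ hp hinv
    obtain ⟨m, rfl⟩ := exists_nat_eq_of_involution hn hφ hp hinv
    refine ⟨m, fun g => ?_⟩
    rw [hφ.eq_rpow_of_involution hn hp hinv, Real.rpow_natCast, chiNat_eq]
    push_cast
    rfl
  by_cases hne : ∃ g, g ≠ 1 ∧ χ g ≠ 0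
  · obtain ⟨p, hp, hinv | hinv⟩ := h.exists_rpow_involution hn hχ hne
    · obtain ⟨m, hm⟩ := hpow hχ hp hinv
      exact Or.inl (Or.inl ⟨m, funext hm⟩)
    · obtain ⟨m, hm⟩ := hpow (hχ.sgnInf_mul hn) hp hinv
      refine Or.inl (Or.inr ⟨m, funext fun g => ?_⟩)
      rw [← hm g, ← mul_assoc, sgnInf_mul_self, one_mul]
  · push Not at hne
    refine Or.inr (funext fun g => ?_)
    by_cases hg : g = 1
    · rw [hg, hχ.map_one, chiReg, if_pos rfl]
    · rw [hne g hg, chiReg, if_neg hg]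

end SymLimit

theorem mainTheorem2 (n : ℕ → ℕ) (hn : ∀ k, 1 < n k) :
    SymLimit.exChar n hn ⊆ {χ | SymLimit.IsCharacter χ} ∧
    SymLimit.exChar n hn ⊆ {χ | SymLimit.IsIndecomposable χ} ∧
    {χ | SymLimit.IsIndecomposable χ} ⊆ SymLimit.exChar n hn ∧
    Set.extremePoints ℝ {χ : SymLimit.LimitGroup n → ℂ | SymLimit.IsCharacter χ} =
      SymLimit.exChar n hn := by
  refine ⟨fun χ h => SymLimit.isCharacter_of_mem_exChar hn h, fun χ h =>
    (SymLimit.hasScalarMeans_of_mem_exChar hn h).isIndecomposable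
      (SymLimit.isCharacter_of_mem_exChar hn h), fun χ h =>
    (SymLimit.IsIndecomposable.isAsympMul SymLimit.stage_mono SymLimit.exists_mem_stage
      h).mem_exChar hn h.1, Set.Subset.antisymm (fun χ h => ?_) fun χ h =>
    (SymLimit.hasScalarMeans_of_mem_exChar hn h).mem_extremePoints
      (SymLimit.isCharacter_of_mem_exChar hn h)⟩
  exact (SymLimit.isAsympMul_of_mem_extremePoints SymLimit.stage_mono SymLimit.exists_mem_stage
    h).mem_exChar hn h.1
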